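/- **Setting.** Let $L\in\{1,\dots,K\}$ be the type of a cluster; a cluster of type $k$ has $M_k$ units and observed data $O=(Y,A,X)$ with outcomes $Y\in\mathbb R^{M_k}$, treatments $A\in\mathcal A_k=\{0,1\}^{M_k}$ and covariates $X\in\mathbb R^{d_k}$. The clusters are independent copies of $(O,L)\sim P^*$, with $p_k^*=\mathrm{pr}(L=k)>0$. For a law $P$ of $(O,L)$ and each $k$ let $e(a\mid x,k)=\mathrm{pr}(A=a\mid X=x,L=k)$, $g(a,x,k)=E(Y\mid A=a,X=x,L=k)$ and $\Sigma(a,x,k)=\mathrm{var}(Y\mid A=a,X=x,L=k)$; a star denotes the value at $P^*$. Let $Y(a)$, $a\in\mathcal A_k$, be the potential outcomes of a cluster of type $k$, and assume: * (A1) $Y=Y(A)$ almost surely; * (A2) $Y(a)$ and $A$ are conditionally independent given $X$ and $L=k$, for all $a\in\mathcal A_k$ and all $k$; * (A3) for some $c>0$, $c<e^*(a\mid x,k)<1-c$ for all $a\in\mathcal A_k$, all $k$ and almost every $x$ (for the law of $X$ given $L=k$); * (A4) for all $a$ and $k$, $g^*(a,X,k)$ and $\Sigma^*(a,X,k)$ exist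 and have finite expectations given $L=k$, and $\Sigma^*(a,x,k)$ is positive definite for almost every $x$. Let $w_k(a,x)\in\mathbb R^{M_k}$ be bounded weights, measurable in $x$, let $v_k$ be real functions of the type probability (in applications continuously differentiable), and let $$\theta_k^*=\sum_{a\in\mathcal A_k}E\{w_k^{T}(a,X)Y(a)\mid L=k\},\qquad \tau^*=\sum_{k=1}^K v_k(p_k^*)\theta_k^* .$$ Assume that $E[\{\sum_a w_k^{T}(a,X)g^*(a,X,k)\}^2\mid L=k]<\infty$ for each $k$. **Models.** The type probabilities are known. $\mathcal M_{NP}$ is the set of all laws $P$ of $(O,L)$ with $\mathrm{pr}_P(L=k)=p_k^*$ for all $k$ that satisfy (A3) (with a constant that may depend on $P$) and the existence and finiteness conditions of (A4). $\mathcal M_{NP,e^*}$ is the set of $P\in\mathcal M_{NP}$ whose propensity score is $e^*$. On $\mathcal M_{NP}$ put $\tau(P)=\sum_k v_k(p_k)\sum_a E_P\{w_k^{T}(a,X)g_P(a,X,k)\mid L=k\}$. A *regular parametric submodel* of a model is a family $(P_\eta)_{\eta\in H}$ in the model, $H\subseteq\mathbb R^r$ open, $r\ge1$, with $P_{\eta^*}=P^*$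 for a given $\eta^*\in H$, with densities $f_\eta$ with respect to one $\sigma$-finite measure $\mu$ such that $\sqrt{f_\eta}$ is continuously differentiable in $L^2(\mu)$, with nonsingular information matrix $J=E(ss^{T})$ at $\eta^*$, where $s=2\,\partial_\eta\sqrt{f_\eta}/\sqrt{f_\eta}\,|_{\eta=\eta^*}$ is the score, and such that, for all $a$ and $k$, $E_\eta\{\mathrm{tr}\,\Sigma_\eta(a,X,k)\mid L=k\}$ and $E_\eta[\{\sum_a w_k^{T}(a,X)g_\eta(a,X,k)\}^2\mid L=k]$ are bounded for $\eta$ near $\eta^*$. A function $\varphi\in L^2(P^*)$ is the *efficient influence function* of $\tau^*$ if, along every regular parametric submodel, $\eta\mapsto\tau(P_\eta)$ is differentiable at $\eta^*$ with gradient $E(\varphi s)$, and $\varphi$ lies in the tangent space, the $L^2(P^*)$-closure of the set of all linear combinations $b^{T}s$ of the score components of regular parametric submodels. The *semiparametric efficiency bound* is the supremum over regular parametric submodels of the Cramér–Rao bounds $D^{T}J^{-1}D$, $D=\partial_\eta\tau(P_\eta)|_{\eta=\eta^*}$. **Theorem.** $\tau(P^*)=\tau^*$, and in $\mathcal M_{NP}$,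 and also in $\mathcal M_{NP,e^*}$, the efficient influence function of $\tau^*$ is $\varphi(\tau^*)=\sum_{k=1}^K v_k(p_k^*)\varphi_k(\theta_k^*)$ with $$\varphi_k(\theta_k^*)=\frac{\mathbb 1(L=k)}{p_k^*}\Big[\sum_{a\in\mathcal A_k}w_k^{T}(a,X)\Big\{\frac{\mathbb 1(A=a)}{e^*(a\mid X,k)}\{Y-g^*(a,X,k)\}+g^*(a,X,k)\Big\}-\theta_k^*\Big].$$ In both models the semiparametric efficiency bound of $\tau^*$ is $$\mathrm{var}\{\varphi(\tau^*)\}=\sum_{k=1}^K v_k(p_k^*)^2\,\mathrm{SEB}_k(\theta_k^*),$$ $$\mathrm{SEB}_k(\theta_k^*)=\frac1{p_k^*}E\Big[\sum_{a\in\mathcal A_k}\frac{w_k^{T}(a,X)\Sigma^*(a,X,k)w_k(a,X)}{e^*(a\mid X,k)}+\Big\{\sum_{a\in\mathcal A_k}w_k^{T}(a,X)g^*(a,X,k)-\theta_k^*\Big\}^2\,\Big|\,L=k\Big].$$ -/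

import Mathlib

open MeasureTheory ProbabilityTheory Filter Topology
open scoped ENNReal Matrix

namespace PartialInterference

noncomputable section

/-! ### Smooth parametric submodels, scores, efficient influence functions (one observation) -/

/-- A smooth parametric submodel through the law `P`: an open finite-dimensional parameter set,
densities with respect to one σ-finite measure, and square-root densities that are continuously
differentiable in mean square, with derivative `ψ`. Values off the parameter set are irrelevant. -/
structure SmoothSubmodel {Z : Type*} [MeasurableSpace Z] (P : ProbabilityMeasure Z) where
  dim : ℕ
  dim_pos : 0 < dim
  param : Set (EuclideanSpace ℝ (Fin dim))
  isOpen_param : IsOpen param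
  /-- the true parameter value -/
  η₀ : EuclideanSpace ℝ (Fin dim)
  η₀_mem : η₀ ∈ param
  law : EuclideanSpace ℝ (Fin dim) → ProbabilityMeasure Z
  law_η₀ : law η₀ = P
  μ : Measure Z
  sigmaFinite_μ : SigmaFinite μ
  dens : EuclideanSpace ℝ (Fin dim) → Z → ℝ
  measurable_dens : ∀ η, Measurable (dens η)
  dens_nonneg : ∀ η z, 0 ≤ dens η z
  law_eq : ∀ η ∈ param, (law η : Measure Z) = μ.withDensity (fun z => ENNReal.ofReal (dens η z))
  ψ : EuclideanSpace ℝ (Fin dim) → Fin dim → Z → ℝ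
  memLp_ψ : ∀ η ∈ param, ∀ j, MemLp (ψ η j) 2 μ
  meanSquare_diff : ∀ η ∈ param,
    Tendsto (fun η' => (∫ z, (√(dens η' z) - √(dens η z) - ∑ j, (η' j - η j) * ψ η j z) ^ 2 ∂μ)
      / ‖η' - η‖ ^ 2) (𝓝[≠] η) (𝓝 0)
  meanSquare_cont : ∀ η ∈ param, ∀ j,
    Tendsto (fun η' => ∫ z, (ψ η' j z - ψ η j z) ^ 2 ∂μ) (𝓝 η) (𝓝 0)

namespace SmoothSubmodel

variable {Z : Type*} [MeasurableSpace Z] {P : ProbabilityMeasure Z}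

/-- The score at the truth: `∂ log f = 2 ∂√f / √f`. -/
def score (S : SmoothSubmodel P) (j : Fin S.dim) (z : Z) : ℝ :=
  2 * S.ψ S.η₀ j z / √(S.dens S.η₀ z)

/-- Fisher information matrix at the truth. -/
def information (S : SmoothSubmodel P) : Matrix (Fin S.dim) (Fin S.dim) ℝ :=
  Matrix.of fun i j => ∫ z, S.score i z * S.score j z ∂(P : Measure Z)

/-- Cramér–Rao bound of the submodel for the functional `τ`: `(∂τ)ᵀ J⁻¹ (∂τ)` at the truth. -/
def cramerRao (S : SmoothSubmodel P) (τ : ProbabilityMeasure Z → ℝ) : ℝ :=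
  let D : Fin S.dim → ℝ := (gradient (fun η => τ (S.law η)) S.η₀).ofLp
  D ⬝ᵥ (S.information⁻¹ *ᵥ D)

end SmoothSubmodel

/-- `φ` is the efficient influence function at `P` of `τ` relative to the class `𝒞` of submodels:
`φ` is square integrable, `τ` is differentiable along every submodel with gradient `E[φ · score]`,
and `φ` lies in the tangent space, the mean-square closure of the linear combinations of the
scores of the submodels. -/
def IsEfficientInfluenceFunction {Z : Type*} [MeasurableSpace Z] {P : ProbabilityMeasure Z}
    (𝒞 : Set (SmoothSubmodel P)) (τ : ProbabilityMeasure Z → ℝ) (φ : Z → ℝ) : Prop :=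
  MemLp φ 2 (P : Measure Z) ∧
  (∀ S ∈ 𝒞, HasGradientAt (fun η => τ (S.law η))
    (WithLp.toLp 2 fun j => ∫ z, φ z * S.score j z ∂(P : Measure Z)) S.η₀) ∧
  (∀ ε > 0, ∃ S ∈ 𝒞, ∃ b : Fin S.dim → ℝ,
    ∫ z, (φ z - ∑ j, b j * S.score j z) ^ 2 ∂(P : Measure Z) < ε)

/-- The semiparametric efficiency bound: the supremum of the Cramér–Rao bounds of the submodels. -/
def IsEfficiencyBound {Z : Type*} [MeasurableSpace Z] {P : ProbabilityMeasure Z}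
    (𝒞 : Set (SmoothSubmodel P)) (τ : ProbabilityMeasure Z → ℝ) (B : ℝ) : Prop :=
  IsLUB {c | ∃ S ∈ 𝒞, c = S.cramerRao τ} B

/-! ### Observed data of a cluster -/

/-- Treatment vectors of a cluster of size `m`. -/
abbrev Trt (m : ℕ) := Fin m → Bool

/-- Observations `(y, a, x)` of a cluster of size `m` with `d` covariate coordinates in total. -/
abbrev Obs (m d : ℕ) := (Fin m → ℝ) × Trt m × (Fin d → ℝ)

/-- Values of `(L, O)`: a cluster type together with an observation of the shape of that type. -/
abbrev Data {K : ℕ} (M d : Fin K → ℕ) := Σ k : Fin K, Obs (M k) (d k)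

/-- An observation of a cluster of type `k`, with its type. -/
def ofType {K : ℕ} {M d : Fin K → ℕ} (k : Fin K) (o : Obs (M k) (d k)) : Data M d := ⟨k, o⟩

section Regression

variable {m d : ℕ} (Q : Measure (Obs m d)) [IsFiniteMeasure Q]

/-- The law of the covariates. -/
def covLaw : Measure (Fin d → ℝ) := Q.map (fun o => o.2.2)

/-- The propensity score `e(a | x) = pr(A = a | X = x)`. -/
def propensity (a : Trt m) (x : Fin d → ℝ) : ℝ :=
  (condDistrib (fun o : Obs m d => o.2.1) (fun o => o.2.2) Q x).real {a}

/-- The conditional law of `Y` given `A = a`, `X = x`. -/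
def outcomeLaw (a : Trt m) (x : Fin d → ℝ) : Measure (Fin m → ℝ) :=
  condDistrib (fun o : Obs m d => o.1) (fun o => o.2) Q (a, x)

/-- The outcome regression `g(a, x) = E(Y | A = a, X = x)`. -/
def outcomeReg (a : Trt m) (x : Fin d → ℝ) : Fin m → ℝ :=
  fun j => ∫ y, y j ∂(outcomeLaw Q a x)

/-- The conditional covariance matrix `Σ(a, x) = var(Y | A = a, X = x)`. -/
def outcomeCov (a : Trt m) (x : Fin d → ℝ) : Matrix (Fin m) (Fin m) ℝ :=
  Matrix.of fun i j => cov[fun y => y i, fun y => y j; outcomeLaw Q a x]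

variable (w : Trt m → (Fin d → ℝ) → Fin m → ℝ)

/-- `∑ₐ wᵀ(a, x) g(a, x)`. -/
def weightedReg (x : Fin d → ℝ) : ℝ := ∑ a, w a x ⬝ᵥ outcomeReg Q a x

/-- `∑ₐ E{wᵀ(a, X) g(a, X)}`. -/
def thetaOf : ℝ := ∑ a, ∫ x, w a x ⬝ᵥ outcomeReg Q a x ∂(covLaw Q)

/-- `∑ₐ wᵀ(a, X) [1(A = a) / e(a | X) {Y - g(a, X)} + g(a, X)] - θ`. -/
def phi (θ : ℝ) (o : Obs m d) : ℝ :=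
  (∑ a, w a o.2.2 ⬝ᵥ (((if o.2.1 = a then 1 else 0) / propensity Q a o.2.2) •
    (o.1 - outcomeReg Q a o.2.2) + outcomeReg Q a o.2.2)) - θ

/-- `p⁻¹ E[∑ₐ wᵀ(a, X) Σ(a, X) w(a, X) / e(a | X) + {∑ₐ wᵀ(a, X) g(a, X) - θ}²]`. -/
def seb (p θ : ℝ) : ℝ :=
  1 / p * ∫ x, ((∑ a, (w a x ⬝ᵥ (outcomeCov Q a x *ᵥ w a x)) / propensity Q a x)
    + (weightedReg Q w x - θ) ^ 2) ∂(covLaw Q)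

end Regression

section Model

variable {K : ℕ} {M d : Fin K → ℕ}

/-- `p_k = pr(L = k)`. -/
def typeProb (P : ProbabilityMeasure (Data M d)) (k : Fin K) : ℝ :=
  (P : Measure (Data M d)).real (Sigma.fst ⁻¹' {k})

/-- The conditional law of `O` given `L = k`. -/
def lawGiven (P : ProbabilityMeasure (Data M d)) (k : Fin K) : Measure (Obs (M k) (d k)) :=
  ((P : Measure (Data M d))[|Sigma.fst ⁻¹' {k}]).comap (ofType k)

instance (P : ProbabilityMeasure (Data M d)) (k : Fin K) : IsFiniteMeasure (lawGiven P k) := by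
  unfold lawGiven; infer_instance

/-- Positivity/overlap. -/
def Overlap (P : ProbabilityMeasure (Data M d)) : Prop :=
  ∃ c > 0, ∀ k a, ∀ᵐ x ∂(covLaw (lawGiven P k)),
    c < propensity (lawGiven P k) a x ∧ propensity (lawGiven P k) a x < 1 - c

/-- `g(a, X, k)` and `Σ(a, X, k)` exist and have finite expectations given `L = k`. -/
def Moments (P : ProbabilityMeasure (Data M d)) : Prop :=
  ∀ k a,
    (∀ᵐ x ∂(covLaw (lawGiven P k)), ∀ j, MemLp (fun y => y j) 2 (outcomeLaw (lawGiven P k) a x)) ∧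
    (∀ j, Integrable (fun x => outcomeReg (lawGiven P k) a x j) (covLaw (lawGiven P k))) ∧
    (∀ i j, Integrable (fun x => outcomeCov (lawGiven P k) a x i j) (covLaw (lawGiven P k)))

/-- `Σ(a, x, k)` is positive definite. -/
def PosDefCov (P : ProbabilityMeasure (Data M d)) : Prop :=
  ∀ k a, ∀ᵐ x ∂(covLaw (lawGiven P k)), (outcomeCov (lawGiven P k) a x).PosDef

/-- The nonparametric model with known type probabilities `p`: all laws of `(O, L)` with these
type probabilities for which the estimand is defined. The clusters are independent copies of
`(O, L)`, so that the law of one cluster determines the law of the sample. -/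
def modelNP (M d : Fin K → ℕ) (p : Fin K → ℝ) : Set (ProbabilityMeasure (Data M d)) :=
  {P | (∀ k, typeProb P k = p k) ∧ Overlap P ∧ Moments P}

/-- The submodel of `modelNP` in which the propensity score is known to be that of `P₀`. -/
def modelNPe (p : Fin K → ℝ) (P₀ : ProbabilityMeasure (Data M d)) :
    Set (ProbabilityMeasure (Data M d)) :=
  {P | P ∈ modelNP M d p ∧ ∀ k a, ∀ᵐ x ∂(covLaw (lawGiven P k)),
    propensity (lawGiven P k) a x = propensity (lawGiven P₀ k) a x}

variable (w : ∀ k, Trt (M k) → (Fin (d k) → ℝ) → Fin (M k) → ℝ) (v : Fin K → ℝ → ℝ)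

/-- The estimand as a functional of the law of `(O, L)`:
`τ = ∑ₖ v_k(p_k) ∑ₐ E{w_kᵀ(a, X) g(a, X, k) | L = k}`. -/
def tau (P : ProbabilityMeasure (Data M d)) : ℝ :=
  ∑ k, v k (typeProb P k) * thetaOf (lawGiven P k) (w k)

/-- Regular parametric submodels of the model `𝓜` through `P`: smooth, contained in `𝓜`, with
nonsingular information, and with the second moments that enter the variance of the estimand
locally bounded around the true parameter. -/
def regularSubmodels (𝓜 : Set (ProbabilityMeasure (Data M d)))
    (P : ProbabilityMeasure (Data M d)) : Set (SmoothSubmodel P) :=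
  {S | (∀ η ∈ S.param, S.law η ∈ 𝓜) ∧ IsUnit S.information.det ∧
    ∃ C : ℝ, ∀ᶠ η in 𝓝 S.η₀, ∀ k,
      (∀ a, ∫ x, (outcomeCov (lawGiven (S.law η) k) a x).trace
        ∂(covLaw (lawGiven (S.law η) k)) ≤ C) ∧
      MemLp (weightedReg (lawGiven (S.law η) k) (w k)) 2 (covLaw (lawGiven (S.law η) k)) ∧
      ∫ x, weightedReg (lawGiven (S.law η) k) (w k) x ^ 2 ∂(covLaw (lawGiven (S.law η) k)) ≤ C}

/-- `φ_k = 1(L = k) / p_k · [∑ₐ w_kᵀ {1(A = a)/e (Y - g) + g} - θ_k]`; `Function.extend` along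
`ofType k` with default `0` is the multiplication by `1(L = k)`. -/
def varphi (P : ProbabilityMeasure (Data M d)) (θ : ℝ) (k : Fin K) : Data M d → ℝ :=
  Function.extend (ofType k)
    (fun o => 1 / typeProb P k * phi (lawGiven P k) (w k) θ o) 0

end Model

/-! ### Potential outcomes -/

/-- The random variables of a generic cluster. The variables with index `k` are those of a
cluster of type `k`; only their values on `{L = k}` matter. -/
structure Cluster {K : ℕ} (M d : Fin K → ℕ) (Ω : Type*) [MeasurableSpace Ω] where
  /-- cluster type -/
  L : Ω → Fin K
  /-- observed outcomes -/
  Y : ∀ k, Ω → Fin (M k) → ℝ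
  /-- treatments -/
  A : ∀ k, Ω → Trt (M k)
  /-- covariates -/
  X : ∀ k, Ω → Fin (d k) → ℝ
  /-- potential outcomes -/
  Ypot : ∀ k, Trt (M k) → Ω → Fin (M k) → ℝ
  measurable_L : Measurable L
  measurable_Y : ∀ k, Measurable (Y k)
  measurable_A : ∀ k, Measurable (A k)
  measurable_X : ∀ k, Measurable (X k)
  measurable_Ypot : ∀ k a, Measurable (Ypot k a)

namespace Cluster

variable {K : ℕ} {M d : Fin K → ℕ} {Ω : Type*} [MeasurableSpace Ω] (C : Cluster M d Ω)

/-- The observed data `(L, O)`. -/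
def obs (ω : Ω) : Data M d := ⟨C.L ω, C.Y (C.L ω) ω, C.A (C.L ω) ω, C.X (C.L ω) ω⟩

theorem measurable_obs : Measurable C.obs := by
  intro s hs
  have h : C.obs ⁻¹' s = ⋃ k, C.L ⁻¹' {k} ∩
      (fun ω => (C.Y k ω, C.A k ω, C.X k ω)) ⁻¹' (ofType k ⁻¹' s) := by
    ext ω
    simp [obs, ofType]
  rw [h]
  refine MeasurableSet.iUnion fun k => (C.measurable_L (measurableSet_singleton k)).inter ?_
  refine ((C.measurable_Y k).prodMk ((C.measurable_A k).prodMk (C.measurable_X k))) ?_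
  exact (MeasurableSpace.measurableSet_iInf.1 hs k)

variable (ρ : Measure Ω) [IsProbabilityMeasure ρ]

/-- The law of the observed data. -/
def observedLaw : ProbabilityMeasure (Data M d) :=
  ⟨ρ.map C.obs, Measure.isProbabilityMeasure_map C.measurable_obs.aemeasurable⟩

/-- Consistency: the observed outcome is the potential outcome at the received treatment. -/
def Consistency : Prop :=
  ∀ᵐ ω ∂ρ, C.Y (C.L ω) ω = C.Ypot (C.L ω) (C.A (C.L ω) ω) ω

/-- Conditional ignorability: `Y(a)` and `A` are conditionally independent given `X`, `L = k`;
stated for the joint law of `(Y(a), A, X)` given `L = k`. -/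
def Ignorability : Prop :=
  ∀ k (a : Trt (M k)),
    CondIndepFun (MeasurableSpace.comap (fun t : Obs (M k) (d k) => t.2.2) inferInstance)
      (Measurable.comap_le (by fun_prop))
      (fun t : Obs (M k) (d k) => t.1) (fun t => t.2.1)
      ((ρ[|C.L ⁻¹' {k}]).map fun ω => (C.Ypot k a ω, C.A k ω, C.X k ω))

/-- The causal parameter `θ_k = ∑ₐ E{w_kᵀ(a, X) Y(a) | L = k}`. -/
def theta (w : ∀ k, Trt (M k) → (Fin (d k) → ℝ) → Fin (M k) → ℝ) (k : Fin K) : ℝ :=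
  ∑ a, ∫ ω, w k a (C.X k ω) ⬝ᵥ C.Ypot k a ω ∂(ρ[|C.L ⁻¹' {k}])

end Cluster

end

end PartialInterference

/-! Identification. On the event `A = a` the observed and the potential outcome agree, so
ignorability and overlap make the law of `Y(a)` given `X` equal to the observed law of `Y` given `A
= a`, `X` (`integral_potentialOutcome`). Each `θ k` is thus the functional `thetaOf` of the observed
law. What remains is its derivative along an arbitrary regular submodel, a tangent space large
enough to contain the influence function, and the passage to the bound.

Derivative. A submodel only has root densities `s η` that are differentiable in mean square; its
regressions and propensity scores may vary with `η` in no smooth way. Double robustness gets around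
this. Let `H η` be the inverse-probability weighted score with the propensity at `η₀` and the
regression at `η`. It has the correct mean under the law at `η`, because residuals about the true
regression have mean zero whatever the weights, and also under the law at `η₀`, because there the
weights are the true ones (`IsGoodSet.integral_indicator_ipw`). So the increment of the functional
is `∫ (s η - s η₀) (s η + s η₀) H η dμ`. If `H η` is bounded in mean square under both laws and
tends to the true score `T` in L¹ at `η₀`, the derivative is `2 ∫ T (s η₀) ψ dμ`
(`IsSmoothPath.isLittleO_integral_sub`).

These two properties hold only on a good set of covariate values: overlap holds, the laws of `X` are
comparable, and the two regressions differ by at most a multiple of the residual standard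
deviations. Where this fails, the two laws can be told apart, either by the masses they give to sets
of covariates or by asking which regression the outcome is closer to. Hence the bad set has mass at
most a constant times the squared Hellinger distance restricted to the bad set itself
(`exists_isGoodSet`). This mass tends to zero, so the restricted distance is of smaller order than
`η - η₀` (`IsSmoothPath.isLittleO_l2_restrict`), and the bad set does not affect the derivative. On
the good set, L¹ closeness of the regressions comes from testing with the sign of their difference
times a residual (`IsGoodSet.integral_abs_sub_le`). The result is
`IsSmoothPath.isLittleO_sum_regression`.

Tangent space. The influence function is a residual with mean zero given `(A, X)` plus a centred
function of `X` (`phi_apply`). Both summands are truncated and recentred to bounded `b₂` and `b₁`;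
the densities `(1 + t b₁) (1 + t b₂)` then form a regular submodel with score `b₁ + b₂` that changes
neither the type probabilities nor the propensity score. The approximation therefore takes place
inside the smaller model, and knowledge of the propensity score changes nothing.

Bound. The Cramér–Rao bound of a submodel is the squared norm of the projection of the influence
function on the span of its scores, so the supremum is the full squared norm
(`IsEfficientInfluenceFunction.isEfficiencyBound`). The orthogonality of the two summands evaluates
it. -/

namespace PartialInterference

noncomputable section

set_option linter.unusedSectionVars false

/-! ### Mean-square estimates -/

section MeanSquare

variable {Ω : Type*} [MeasurableSpace Ω] {μ : Measure Ω}

/-- The mean-square norm of a real function. -/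
def l2 (μ : Measure Ω) (f : Ω → ℝ) : ℝ := √(∫ ω, f ω ^ 2 ∂μ)

theorem l2_nonneg (f : Ω → ℝ) : 0 ≤ l2 μ f := Real.sqrt_nonneg _

theorem l2_sq (f : Ω → ℝ) : l2 μ f ^ 2 = ∫ ω, f ω ^ 2 ∂μ :=
  Real.sq_sqrt (integral_nonneg fun _ => sq_nonneg _)

theorem abs_integral_mul_le_l2 {f g : Ω → ℝ} (hf : MemLp f 2 μ) (hg : MemLp g 2 μ) :
    |∫ ω, f ω * g ω ∂μ| ≤ l2 μ f * l2 μ g := by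
  have h2 : (ENNReal.ofReal 2) = 2 := by norm_num
  have h := integral_mul_le_Lp_mul_Lq_of_nonneg (μ := μ) (p := 2) (q := 2)
    (f := fun ω => |f ω|) (g := fun ω => |g ω|) ⟨by norm_num, by norm_num, by norm_num⟩
    (ae_of_all _ fun _ => abs_nonneg _) (ae_of_all _ fun _ => abs_nonneg _)
    (by rw [h2]; exact hf.abs) (by rw [h2]; exact hg.abs)
  have e : ∀ u : Ω → ℝ, (∫ ω, |u ω| ^ (2 : ℝ) ∂μ) ^ (1 / (2 : ℝ)) = l2 μ u := fun u => by
    rw [l2, Real.sqrt_eq_rpow]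
    congr 2
    ext ω
    rw [Real.rpow_two, sq_abs]
  rw [e, e] at h
  calc |∫ ω, f ω * g ω ∂μ| ≤ ∫ ω, |f ω * g ω| ∂μ := abs_integral_le_integral_abs
    _ = ∫ ω, |f ω| * |g ω| ∂μ := by simp_rw [abs_mul]
    _ ≤ _ := h

theorem integral_abs_mul_le_l2 {f g : Ω → ℝ} (hf : MemLp f 2 μ) (hg : MemLp g 2 μ) :
    ∫ ω, |f ω| * |g ω| ∂μ ≤ l2 μ f * l2 μ g := by
  have h := (le_abs_self _).trans (abs_integral_mul_le_l2 hf.abs hg.abs)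
  simpa [l2, sq_abs] using h

theorem l2_add_le {f g : Ω → ℝ} (hf : MemLp f 2 μ) (hg : MemLp g 2 μ) :
    l2 μ (fun ω => f ω + g ω) ≤ l2 μ f + l2 μ g := by
  refine Real.sqrt_le_iff.2 ⟨add_nonneg (l2_nonneg _) (l2_nonneg _), ?_⟩
  have hfg : Integrable (fun ω => f ω * g ω) μ := hf.integrable_mul hg
  have e : ∫ ω, (f ω + g ω) ^ 2 ∂μ =
      ∫ ω, f ω ^ 2 ∂μ + 2 * ∫ ω, f ω * g ω ∂μ + ∫ ω, g ω ^ 2 ∂μ := by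
    rw [← integral_const_mul, ← integral_add hf.integrable_sq (hfg.const_mul 2)]
    erw [← integral_add (hf.integrable_sq.add (hfg.const_mul 2)) hg.integrable_sq]
    exact integral_congr_ae (ae_of_all _ fun ω => by simp; ring)
  have := (le_abs_self _).trans (abs_integral_mul_le_l2 hf hg)
  rw [e, ← l2_sq, ← l2_sq]
  nlinarith

theorem l2_mono {f g : Ω → ℝ} (hg : MemLp g 2 μ) (h : ∀ᵐ ω ∂μ, |f ω| ≤ |g ω|) :
    l2 μ f ≤ l2 μ g :=
  Real.sqrt_le_sqrt (integral_mono_of_nonneg (ae_of_all _ fun _ => sq_nonneg _)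
    hg.integrable_sq (h.mono fun _ h => sq_le_sq.2 h))

theorem l2_const_mul (c : ℝ) (f : Ω → ℝ) : l2 μ (fun ω => c * f ω) = |c| * l2 μ f := by
  simp_rw [l2, mul_pow, integral_const_mul]
  rw [Real.sqrt_mul (sq_nonneg c), Real.sqrt_sq_eq_abs]

theorem l2_sum_le {ι : Type*} (t : Finset ι) {f : ι → Ω → ℝ} (hf : ∀ i, MemLp (f i) 2 μ) :
    l2 μ (fun ω => ∑ i ∈ t, f i ω) ≤ ∑ i ∈ t, l2 μ (f i) := by
  classical
  induction t using Finset.induction_on with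
  | empty => simp [l2]
  | insert a t ha ih =>
    simp_rw [Finset.sum_insert ha]
    exact (l2_add_le (hf a) (memLp_finsetSum t fun i _ => hf i)).trans (by gcongr)

theorem l2_restrict_le {f : Ω → ℝ} (hf : MemLp f 2 μ) (S : Set Ω) :
    l2 (μ.restrict S) f ≤ l2 μ f :=
  Real.sqrt_le_sqrt (setIntegral_le_integral hf.integrable_sq (ae_of_all _ fun _ => sq_nonneg _))

theorem l2_restrict_mono {f : Ω → ℝ} (hf : MemLp f 2 μ) {S T : Set Ω} (hST : S ⊆ T) :
    l2 (μ.restrict S) f ≤ l2 (μ.restrict T) f :=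
  Real.sqrt_le_sqrt (setIntegral_mono_set hf.integrable_sq.integrableOn
    (ae_of_all _ fun _ => sq_nonneg _) hST.eventuallyLE)

/-! ### Laws with a square-root density -/

/-- `s` is a square root of the density of the probability law `Q` with respect to `μ`. -/
structure IsRootDensity (μ : Measure Ω) (Q : Measure Ω) (s : Ω → ℝ) : Prop where
  measurable : Measurable s
  nonneg : ∀ ω, 0 ≤ s ω
  eq : Q = μ.withDensity fun ω => ENNReal.ofReal (s ω ^ 2)
  prob : IsProbabilityMeasure Q

namespace IsRootDensity

variable {Q : Measure Ω} {s : Ω → ℝ} (h : IsRootDensity μ Q s)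
include h

theorem integrable_iff {F : Ω → ℝ} :
    Integrable F Q ↔ Integrable (fun ω => F ω * s ω ^ 2) μ := by
  have := h.measurable
  rw [h.eq, integrable_withDensity_iff (by fun_prop) (ae_of_all _ fun _ => ENNReal.ofReal_lt_top)]
  simp_rw [ENNReal.toReal_ofReal (sq_nonneg _)]

theorem integral_eq (F : Ω → ℝ) : ∫ ω, F ω ∂Q = ∫ ω, F ω * s ω ^ 2 ∂μ := by
  have := h.measurable
  rw [h.eq, integral_withDensity_eq_integral_toReal_smul (by fun_prop)
    (ae_of_all _ fun _ => ENNReal.ofReal_lt_top)]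
  simp_rw [ENNReal.toReal_ofReal (sq_nonneg _), smul_eq_mul, mul_comm]

theorem memLp_iff {F : Ω → ℝ} (hF : Measurable F) :
    MemLp F 2 Q ↔ MemLp (fun ω => F ω * s ω) 2 μ := by
  have := h.measurable
  rw [memLp_two_iff_integrable_sq hF.aestronglyMeasurable,
    memLp_two_iff_integrable_sq (by fun_prop), h.integrable_iff]
  simp_rw [mul_pow]

theorem l2_eq (F : Ω → ℝ) : l2 Q F = l2 μ (fun ω => F ω * s ω) := by
  rw [l2, l2, h.integral_eq]
  simp_rw [mul_pow]

theorem memLp : MemLp s 2 μ := by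
  have := h.prob
  simpa using (h.memLp_iff measurable_const).1 (memLp_const (1 : ℝ))

theorem real_eq {S : Set Ω} (hS : MeasurableSet S) : Q.real S = ∫ ω in S, s ω ^ 2 ∂μ := by
  have := h.integral_eq (S.indicator 1)
  rw [integral_indicator_one hS] at this
  rw [this, ← integral_indicator hS]
  congr 1
  ext ω
  by_cases hω : ω ∈ S <;> simp [hω]

theorem sqrt_real_eq {S : Set Ω} (hS : MeasurableSet S) : √(Q.real S) = l2 (μ.restrict S) s := by
  rw [h.real_eq hS, l2]

end IsRootDensity

/-- `√(Q.real S)` is the norm of the root density in L² of `μ` restricted to `S`, so this is the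
triangle inequality. Keeping the restriction to `S` on the right is essential for the later use on
shrinking sets. -/
theorem sqrt_real_le {Q₀ Q₁ : Measure Ω} {s₀ s₁ : Ω → ℝ} (h₀ : IsRootDensity μ Q₀ s₀)
    (h₁ : IsRootDensity μ Q₁ s₁) {S : Set Ω} (hS : MeasurableSet S) :
    √(Q₁.real S) ≤ √(Q₀.real S) + l2 (μ.restrict S) (fun ω => s₁ ω - s₀ ω) := by
  rw [h₀.sqrt_real_eq hS, h₁.sqrt_real_eq hS]
  have := l2_add_le (h₀.memLp.restrict S) ((h₁.memLp.sub h₀.memLp).restrict S)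
  simpa only [Pi.sub_apply, add_sub_cancel, Pi.sub_def] using this

theorem sqrt_real_le' {Q₀ Q₁ : Measure Ω} {s₀ s₁ : Ω → ℝ} (h₀ : IsRootDensity μ Q₀ s₀)
    (h₁ : IsRootDensity μ Q₁ s₁) {S : Set Ω} (hS : MeasurableSet S) :
    √(Q₀.real S) ≤ √(Q₁.real S) + l2 (μ.restrict S) (fun ω => s₁ ω - s₀ ω) := by
  refine (sqrt_real_le h₁ h₀ hS).trans_eq ?_
  simp_rw [l2, sub_sq_comm]

/-- A set whose mass under `Q₀` is at least four times that under `Q₁`. -/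
theorem sqrt_real_le_of_four_mul_le {Q₀ Q₁ : Measure Ω} {s₀ s₁ : Ω → ℝ}
    (h₀ : IsRootDensity μ Q₀ s₀) (h₁ : IsRootDensity μ Q₁ s₁) {S : Set Ω} (hS : MeasurableSet S)
    (h : 4 * Q₁.real S ≤ Q₀.real S) :
    √(Q₀.real S) ≤ 2 * l2 (μ.restrict S) (fun ω => s₁ ω - s₀ ω) := by
  have h1 := sqrt_real_le' h₀ h₁ hS
  -- After the square root the mass under `Q₁` accounts for at most half of `√(Q₀.real S)`; the
  -- distance has to pay for the other half.
  have h2 := Real.sqrt_le_sqrt h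
  rw [Real.sqrt_mul (by norm_num), show (4 : ℝ) = 2 ^ 2 by norm_num,
    Real.sqrt_sq (by norm_num)] at h2
  linarith

/-- A set on which the two laws are told apart by the event `E`. -/
theorem sqrt_real_le_of_test {Q₀ Q₁ : Measure Ω} {s₀ s₁ : Ω → ℝ}
    (h₀ : IsRootDensity μ Q₀ s₀) (h₁ : IsRootDensity μ Q₁ s₁) {E S : Set Ω}
    (hE : MeasurableSet E) (hS : MeasurableSet S) (hES : E ⊆ S)
    (hE₁ : 16 * Q₁.real E ≤ Q₁.real S) (hE₀ : 16 * Q₀.real (S \ E) ≤ Q₀.real S) :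
    √(Q₀.real S) ≤ 5 / 2 * l2 (μ.restrict S) (fun ω => s₁ ω - s₀ ω) := by
  have := h₀.prob
  have hd := measureReal_sdiff_add_inter (μ := Q₀) (s := S) (t := E) hE
  rw [Set.inter_eq_right.2 hES] at hd
  -- `E` carries at least `15/16` of the `Q₀`-mass of `S`, and `16/9 * 15/16 ≥ 1`.
  have a1 : √(Q₀.real S) ≤ 4 / 3 * √(Q₀.real E) := by
    refine Real.sqrt_le_iff.2 ⟨by positivity, ?_⟩
    rw [mul_pow, Real.sq_sqrt measureReal_nonneg]
    linarith [measureReal_nonneg (μ := Q₀) (s := S)]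
  have a2 : 4 * √(Q₁.real E) ≤ √(Q₁.real S) := by
    have h2 := Real.sqrt_le_sqrt hE₁
    rwa [Real.sqrt_mul (by norm_num), show (16 : ℝ) = 4 ^ 2 by norm_num,
      Real.sqrt_sq (by norm_num)] at h2
  have a3 := sqrt_real_le' h₀ h₁ hE
  have a4 := sqrt_real_le h₀ h₁ hS
  have a5 := l2_restrict_mono (μ := μ) (h₁.memLp.sub h₀.memLp) hES
  simp only [Pi.sub_def] at a5
  -- With `δ` the distance on `S`: `√Q₀(S) ≤ 4/3 (√Q₁(E) + δ) ≤ 4/3 (√Q₁(S)/4 + δ) ≤ √Q₀(S)/3 +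
  -- 5δ/3`, whence the factor `5/2`.
  linarith

end MeanSquare

/-! ### Two laws with regression structure: where in the covariate space they can be told apart. -/

section PairOfLaws

variable {Ω : Type*} [MeasurableSpace Ω] {μ : Measure Ω}

/-- The difference of the densities factors as `(s₁ - s₀) (s₁ + s₀)`, so Cauchy–Schwarz bounds the
change of a mean by the Hellinger distance times the second moments under the two laws. -/
theorem abs_integral_sub_integral_le {Q₀ Q₁ : Measure Ω} {s₀ s₁ : Ω → ℝ}
    (h₀ : IsRootDensity μ Q₀ s₀) (h₁ : IsRootDensity μ Q₁ s₁) {F : Ω → ℝ} (hF : Measurable F)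
    (hF₀ : MemLp F 2 Q₀) (hF₁ : MemLp F 2 Q₁) :
    |∫ ω, F ω ∂Q₁ - ∫ ω, F ω ∂Q₀| ≤ l2 μ (fun ω => s₁ ω - s₀ ω) * (l2 Q₀ F + l2 Q₁ F) := by
  have := h₀.prob
  have := h₁.prob
  have m₀ := (h₀.memLp_iff hF).1 hF₀
  have m₁ := (h₁.memLp_iff hF).1 hF₁
  have i₀ := h₀.integrable_iff.1 (hF₀.integrable one_le_two)
  have i₁ := h₁.integrable_iff.1 (hF₁.integrable one_le_two)
  have e : ∫ ω, F ω ∂Q₁ - ∫ ω, F ω ∂Q₀ =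
      ∫ ω, (s₁ ω - s₀ ω) * (F ω * s₀ ω + F ω * s₁ ω) ∂μ := by
    rw [h₀.integral_eq, h₁.integral_eq, ← integral_sub i₁ i₀]
    exact integral_congr_ae (ae_of_all _ fun ω => by ring)
  rw [e, h₀.l2_eq, h₁.l2_eq]
  refine (abs_integral_mul_le_l2 (h₁.memLp.sub h₀.memLp) (m₀.add m₁)).trans ?_
  exact mul_le_mul_of_nonneg_left (l2_add_le m₀ m₁) (l2_nonneg _)

variable {ι 𝒳 : Type*} [Fintype ι] [MeasurableSpace ι] [MeasurableSingletonClass ι]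
  [MeasurableSpace 𝒳]

/-- Under `Q`, `e` is the conditional law of the discrete variable `A` given `X`, and `G`, `V` are
the conditional mean and variance of `U` given `A`, `X`; the means over `a` of `V` are finite, and
`∑ₐ G(a, X)` is square integrable. -/
structure IsRegression (Q : Measure Ω) (A : Ω → ι) (X : Ω → 𝒳) (U : Ω → ℝ) (e G V : ι → 𝒳 → ℝ) :
    Prop where
  measurable_A : Measurable A
  measurable_X : Measurable X
  measurable_U : Measurable U
  measurable_e : ∀ a, Measurable (e a)
  measurable_G : ∀ a, Measurable (G a)
  measurable_V : ∀ a, Measurable (V a)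
  e_nonneg : ∀ a x, 0 ≤ e a x
  e_le_one : ∀ a x, e a x ≤ 1
  V_nonneg : ∀ a x, 0 ≤ V a x
  setIntegral_X : ∀ a (f : 𝒳 → ℝ), Measurable f →
    ∫ ω in A ⁻¹' {a}, f (X ω) ∂Q = ∫ ω, e a (X ω) * f (X ω) ∂Q
  setIntegral_residual : ∀ a (c : 𝒳 → ℝ), Measurable c → (∃ C, ∀ x, |c x| ≤ C) →
    ∫ ω in A ⁻¹' {a}, c (X ω) * (U ω - G a (X ω)) ∂Q = 0
  setLIntegral_residual_sq : ∀ a (k : 𝒳 → ℝ≥0∞), Measurable k →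
    ∫⁻ ω in A ⁻¹' {a}, ENNReal.ofReal ((U ω - G a (X ω)) ^ 2) * k (X ω) ∂Q =
      ∫⁻ ω in A ⁻¹' {a}, ENNReal.ofReal (V a (X ω)) * k (X ω) ∂Q
  integrable_V : ∀ a, Integrable (fun ω => V a (X ω)) Q
  memLp_sum : MemLp (fun ω => ∑ a, G a (X ω)) 2 Q

/-- The inverse-probability weighted score with the propensity `e` and the regression `G`. -/
def ipw (A : Ω → ι) (X : Ω → 𝒳) (U : Ω → ℝ) (e G : ι → 𝒳 → ℝ) (ω : Ω) : ℝ :=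
  ∑ a, ((A ⁻¹' {a}).indicator (fun ω => (U ω - G a (X ω)) / e a (X ω)) ω + G a (X ω))

variable {A : Ω → ι} {X : Ω → 𝒳} {U : Ω → ℝ} {Q₀ Q₁ : Measure Ω}

theorem memLp_two_of_sq_le {Q : Measure Ω} {f g : Ω → ℝ} (hf : Measurable f) (hg : Integrable g Q)
    (h : ∀ᵐ ω ∂Q, f ω ^ 2 ≤ g ω) : MemLp f 2 Q ∧ l2 Q f ≤ √(∫ ω, g ω ∂Q) := by
  constructor
  · refine (memLp_two_iff_integrable_sq hf.aestronglyMeasurable).2 (hg.mono'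
      (by fun_prop) (h.mono fun ω h => ?_))
    rwa [Real.norm_eq_abs, abs_of_nonneg (sq_nonneg _)]
  · exact Real.sqrt_le_sqrt
      (integral_mono_of_nonneg (ae_of_all _ fun _ => sq_nonneg _) hg h)

namespace IsRegression

variable {Q : Measure Ω} {e G V : ι → 𝒳 → ℝ} (h : IsRegression Q A X U e G V)
include h

theorem measurable_ipw {e' : ι → 𝒳 → ℝ} (he : ∀ a, Measurable (e' a)) :
    Measurable (ipw A X U e' G) := by
  have h1 := h.measurable_A
  have h2 := h.measurable_X
  have h3 := h.measurable_U
  have h4 := h.measurable_G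
  refine Finset.measurable_sum _ fun a _ => Measurable.add ?_ ((h4 a).comp h2)
  exact ((h3.sub ((h4 a).comp h2)).div ((he a).comp h2)).indicator (h1 (measurableSet_singleton a))

theorem measurable_residual (a : ι) :
    Measurable ((A ⁻¹' {a}).indicator fun ω => U ω - G a (X ω)) :=
  (h.measurable_U.sub ((h.measurable_G a).comp h.measurable_X)).indicator
    (h.measurable_A (measurableSet_singleton a))

/-- The conditional variance identity is stated for `∫⁻` and so presupposes no integrability; with
weight one it yields the square integrability of the residual together with the bound. -/
theorem memLp_residual (a : ι) :
    MemLp ((A ⁻¹' {a}).indicator fun ω => U ω - G a (X ω)) 2 Q ∧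
      l2 Q ((A ⁻¹' {a}).indicator fun ω => U ω - G a (X ω)) ≤ √(∫ ω, V a (X ω) ∂Q) := by
  have hm := h.measurable_residual a
  have hA : MeasurableSet (A ⁻¹' {a}) := h.measurable_A (measurableSet_singleton a)
  have h1 : ∫⁻ ω, ENNReal.ofReal (((A ⁻¹' {a}).indicator (fun ω => U ω - G a (X ω)) ω) ^ 2) ∂Q =
      ∫⁻ ω in A ⁻¹' {a}, ENNReal.ofReal (V a (X ω)) ∂Q := by
    have := h.setLIntegral_residual_sq a 1 measurable_const
    simp only [Pi.one_apply, mul_one] at this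
    rw [← this, ← lintegral_indicator hA]
    congr 1
    ext ω
    by_cases hω : ω ∈ A ⁻¹' {a}
    · simp only [Set.indicator_of_mem hω]
    · simp only [Set.indicator_of_notMem hω]; simp
  have h2 : ∫⁻ ω in A ⁻¹' {a}, ENNReal.ofReal (V a (X ω)) ∂Q ≤
      ENNReal.ofReal (∫ ω, V a (X ω) ∂Q) := by
    rw [ofReal_integral_eq_lintegral_ofReal (h.integrable_V a)
      (ae_of_all _ fun ω => h.V_nonneg _ _)]
    exact setLIntegral_le_lintegral _ _
  have h3 : MemLp ((A ⁻¹' {a}).indicator fun ω => U ω - G a (X ω)) 2 Q := by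
    refine (memLp_two_iff_integrable_sq hm.aestronglyMeasurable).2 ?_
    refine ⟨(hm.pow_const 2).aestronglyMeasurable, ?_⟩
    rw [hasFiniteIntegral_iff_ofReal (ae_of_all _ fun _ => sq_nonneg _), h1]
    exact h2.trans_lt ENNReal.ofReal_lt_top
  refine ⟨h3, Real.sqrt_le_sqrt ?_⟩
  rw [← ENNReal.ofReal_le_ofReal_iff (integral_nonneg fun ω => h.V_nonneg _ _),
    ofReal_integral_eq_lintegral_ofReal h3.integrable_sq (ae_of_all _ fun _ => sq_nonneg _), h1]
  exact h2

/-- Averaging the indicator of `A = a` given `X` produces the propensity, which is at least `c` on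
the support of `f`. This is how estimates within one treatment arm become estimates for the law of
`X`, at the price `1 / c`. -/
theorem overlap_integral_le (a : ι) {c : ℝ} {f : 𝒳 → ℝ} (hf : Measurable f)
    (hfi : Integrable (fun ω => f (X ω)) Q) (hf0 : ∀ x, 0 ≤ f x) (hc : ∀ x, f x ≠ 0 → c ≤ e a x) :
    c * ∫ ω, f (X ω) ∂Q ≤ ∫ ω in A ⁻¹' {a}, f (X ω) ∂Q := by
  rw [h.setIntegral_X a f hf, ← integral_const_mul]
  have hm : Measurable fun ω => e a (X ω) := (h.measurable_e a).comp h.measurable_X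
  refine integral_mono (hfi.const_mul c) (hfi.bdd_mul hm.aestronglyMeasurable (c := 1)
    (ae_of_all _ fun ω => ?_)) fun ω => ?_
  · rw [Real.norm_eq_abs, abs_of_nonneg (h.e_nonneg _ _)]
    exact h.e_le_one _ _
  · by_cases h0 : f (X ω) = 0
    · simp [h0]
    · exact mul_le_mul_of_nonneg_right (hc _ h0) (hf0 _)

/-- Conditional Chebyshev inequality. -/
theorem measure_residual_le [IsFiniteMeasure Q] (a : ι) {E : Set Ω} {B : Set 𝒳} {b : 𝒳 → ℝ}
    (hE : MeasurableSet E) (hB : MeasurableSet B) (hb : Measurable b)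
    (hEB : E ⊆ A ⁻¹' {a} ∩ X ⁻¹' B) (hpos : ∀ x ∈ B, 0 < b x)
    (hE' : ∀ ω ∈ E, b (X ω) ≤ 4 * (U ω - G a (X ω)) ^ 2) (hV : ∀ x ∈ B, 64 * V a x ≤ b x) :
    16 * Q.real E ≤ Q.real (A ⁻¹' {a} ∩ X ⁻¹' B) := by
  have hA : MeasurableSet (A ⁻¹' {a}) := h.measurable_A (measurableSet_singleton a)
  have hX := h.measurable_X
  have hU := h.measurable_U
  have hG := h.measurable_G
  -- Weighting the variance identity by `64 / b`: on `E` the squared residual is at least `b / 4`,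
  -- so the weighted integrand is at least `16`, while on `B` the weighted variance is at most `1`.
  set k : 𝒳 → ℝ≥0∞ := B.indicator fun x => ENNReal.ofReal (64 / b x) with hk
  have hkm : Measurable k := (measurable_const.div hb).ennreal_ofReal.indicator hB
  have key := h.setLIntegral_residual_sq a k hkm
  have l1 : 16 * Q E ≤ ∫⁻ ω in A ⁻¹' {a}, ENNReal.ofReal ((U ω - G a (X ω)) ^ 2) * k (X ω) ∂Q := by
    calc 16 * Q E = ∫⁻ ω in A ⁻¹' {a}, E.indicator (fun _ => 16) ω ∂Q := by
          rw [lintegral_indicator hE, Measure.restrict_restrict hE, setLIntegral_const,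
            Set.inter_eq_left.2 fun ω hω => (hEB hω).1]
      _ ≤ _ := by
          refine lintegral_mono fun ω => ?_
          by_cases hω : ω ∈ E
          · have hB' : X ω ∈ B := (hEB hω).2
            simp only [hk, Set.indicator_of_mem hω, Set.indicator_of_mem hB']
            rw [← ENNReal.ofReal_mul (sq_nonneg _)]
            refine ENNReal.le_ofReal_iff_toReal_le (by simp) ?_ |>.2 ?_
            · have := hpos _ hB'; positivity
            · have := hpos _ hB'
              have h2 := hE' _ hω
              rw [mul_div_assoc', le_div_iff₀ this]
              simp
              linarith
          · simp [Set.indicator_of_notMem hω]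
  have l2 : ∫⁻ ω in A ⁻¹' {a}, ENNReal.ofReal (V a (X ω)) * k (X ω) ∂Q ≤
      Q (A ⁻¹' {a} ∩ X ⁻¹' B) := by
    calc _ ≤ ∫⁻ ω in A ⁻¹' {a}, (X ⁻¹' B).indicator 1 ω ∂Q := by
          refine lintegral_mono fun ω => ?_
          by_cases hω : X ω ∈ B
          · have hω' : ω ∈ X ⁻¹' B := hω
            simp only [hk, Set.indicator_of_mem hω, Set.indicator_of_mem hω', Pi.one_apply]
            rw [← ENNReal.ofReal_mul (h.V_nonneg _ _), ENNReal.ofReal_le_one, mul_div_assoc',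
              div_le_one (hpos _ hω)]
            linarith [hV _ hω]
          · simp [hk, Set.indicator_of_notMem hω]
      _ = _ := by
          rw [lintegral_indicator_one (hX hB), Measure.restrict_apply (hX hB), Set.inter_comm]
  have l3 := ENNReal.toReal_mono (measure_ne_top _ _) (l1.trans (key.trans_le l2))
  simpa [Measure.real] using l3

end IsRegression

variable {s₀ s₁ : Ω → ℝ} {e₀ G₀ V₀ e₁ G₁ V₁ : ι → 𝒳 → ℝ}

/-- The values of `X` at which the regressions differ by much more than the residual standard
deviations have a small probability. -/
theorem sqrt_real_separated_le (h₀ : IsRootDensity μ Q₀ s₀) (h₁ : IsRootDensity μ Q₁ s₁)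
    (r₀ : IsRegression Q₀ A X U e₀ G₀ V₀) (r₁ : IsRegression Q₁ A X U e₁ G₁ V₁) (a : ι) :
    √(Q₀.real (A ⁻¹' {a} ∩ X ⁻¹' {x | 64 * (V₀ a x + V₁ a x) < (G₁ a x - G₀ a x) ^ 2})) ≤
      5 / 2 * l2 (μ.restrict (A ⁻¹' {a} ∩
        X ⁻¹' {x | 64 * (V₀ a x + V₁ a x) < (G₁ a x - G₀ a x) ^ 2})) (fun ω => s₁ ω - s₀ ω) := by
  have := h₀.prob
  have := h₁.prob
  have hA : MeasurableSet (A ⁻¹' {a}) := r₀.measurable_A (measurableSet_singleton a)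
  have hX := r₀.measurable_X
  have hU := r₀.measurable_U
  have mG₀ := r₀.measurable_G a
  have mG₁ := r₁.measurable_G a
  have mV₀ := r₀.measurable_V a
  have mV₁ := r₁.measurable_V a
  set B : Set 𝒳 := {x | 64 * (V₀ a x + V₁ a x) < (G₁ a x - G₀ a x) ^ 2} with hBdef
  have hB : MeasurableSet B := measurableSet_lt (by fun_prop) (by fun_prop)
  -- The test between the two laws: `E` says that `U` is at least as close to `G₀` as to `G₁`. On
  -- `E` the residual about `G₁`, and off `E` the residual about `G₀`, is at least half the gap
  -- between the regressions, so by Chebyshev each error has conditional probability at most `4 V /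
  -- (G₁ - G₀)² ≤ 1/16`.
  set E : Set Ω := (A ⁻¹' {a} ∩ X ⁻¹' B) ∩ {ω | |U ω - G₀ a (X ω)| ≤ |U ω - G₁ a (X ω)|} with hEdef
  have hS := hA.inter (hX hB)
  have hE : MeasurableSet E := hS.inter (measurableSet_le (by fun_prop) (by fun_prop))
  have hpos : ∀ x ∈ B, 0 < (G₁ a x - G₀ a x) ^ 2 := fun x hx => by
    have h1 : 64 * (V₀ a x + V₁ a x) < (G₁ a x - G₀ a x) ^ 2 := hx
    linarith [r₀.V_nonneg a x, r₁.V_nonneg a x]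
  have hV : ∀ x ∈ B, 64 * V₀ a x ≤ (G₁ a x - G₀ a x) ^ 2 ∧
      64 * V₁ a x ≤ (G₁ a x - G₀ a x) ^ 2 := fun x hx => by
    have h1 : 64 * (V₀ a x + V₁ a x) < (G₁ a x - G₀ a x) ^ 2 := hx
    constructor <;> linarith [r₀.V_nonneg a x, r₁.V_nonneg a x]
  have hsq : ∀ u g g' : ℝ, |u - g| ≤ |u - g'| → (g' - g) ^ 2 ≤ 4 * (u - g') ^ 2 := by
    intro u g g' hu
    have h1 : |g' - g| ≤ |u - g| + |u - g'| := by
      have := abs_sub (u - g) (u - g')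
      rwa [show u - g - (u - g') = g' - g by ring] at this
    have h2 : |g' - g| ≤ |2 * (u - g')| := by rw [abs_mul, abs_two]; linarith
    have h3 := sq_le_sq.2 h2
    linarith
  have mb : Measurable fun x => (G₁ a x - G₀ a x) ^ 2 := by fun_prop
  refine sqrt_real_le_of_test h₀ h₁ hE hS Set.inter_subset_left ?_ ?_
  · refine r₁.measure_residual_le a hE hB mb Set.inter_subset_left hpos ?_ fun x hx => (hV x hx).2
    exact fun ω hω => hsq _ _ _ hω.2
  · refine r₀.measure_residual_le a (hS.diff hE) hB mb Set.sdiff_subset hpos ?_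
      fun x hx => (hV x hx).1
    intro ω hω
    have h1 : ¬ |U ω - G₀ a (X ω)| ≤ |U ω - G₁ a (X ω)| := fun h2 => hω.2 ⟨hω.1, h2⟩
    rw [sub_sq_comm]
    exact hsq _ _ _ (not_le.1 h1).le

/-- A set of good values of `X`: overlap, regressions that differ by at most a multiple of the
residual standard deviations, and laws of `X` one of which dominates the other. -/
structure IsGoodSet (Q₀ Q₁ : Measure Ω) (X : Ω → 𝒳) (e₀ G₀ V₀ G₁ V₁ : ι → 𝒳 → ℝ) (c : ℝ)
    (S : Set 𝒳) : Prop where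
  measurableSet : MeasurableSet S
  overlap : ∀ x ∈ S, ∀ a, c < e₀ a x
  sq_le : ∀ x ∈ S, ∀ a, (G₁ a x - G₀ a x) ^ 2 ≤ 64 * (V₀ a x + V₁ a x)
  dominated : (Q₀.map X).restrict S ≤ (4 : ℝ≥0∞) • Q₁.map X

/-- A covariate value is bad if overlap fails, which is a null event, if the law of `X` under `Q₀`
is not dominated by four times that under `Q₁`, or if in some arm the regressions are too far apart
for the residual variances. In the last two cases the laws are distinguishable on the bad set, and
the testing bounds control its mass. The point is that the right side has the distance on the bad
set only, not the whole distance. -/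
theorem exists_isGoodSet (h₀ : IsRootDensity μ Q₀ s₀) (h₁ : IsRootDensity μ Q₁ s₁)
    (r₀ : IsRegression Q₀ A X U e₀ G₀ V₀) (r₁ : IsRegression Q₁ A X U e₁ G₁ V₁) {c : ℝ}
    (hc : 0 < c) (he : ∀ a, ∀ᵐ ω ∂Q₀, c < e₀ a (X ω)) :
    ∃ S, IsGoodSet Q₀ Q₁ X e₀ G₀ V₀ G₁ V₁ c S ∧
      Q₀.real (X ⁻¹' Sᶜ) ≤ (4 + Fintype.card ι * (25 / 4 / c)) *
        l2 (μ.restrict (X ⁻¹' Sᶜ)) (fun ω => s₁ ω - s₀ ω) ^ 2 := by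
  have := h₀.prob
  have := h₁.prob
  have hX := r₀.measurable_X
  have me := r₀.measurable_e
  have mG₀ := r₀.measurable_G
  have mG₁ := r₁.measurable_G
  have mV₀ := r₀.measurable_V
  have mV₁ := r₁.measurable_V
  have hΔ : MemLp (fun ω => s₁ ω - s₀ ω) 2 μ := h₁.memLp.sub h₀.memLp
  have : IsFiniteMeasure ((4 : ℝ≥0∞) • Q₁.map X) := Measure.smul_finite _ (by simp)
  -- On `N` the law of `X` under `Q₀` exceeds four times that under `Q₁`; off `N` it is dominated.
  obtain ⟨N, hN, hN1, hN2⟩ := hahn_decomposition (Q₀.map X) ((4 : ℝ≥0∞) • Q₁.map X)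
  set D : ι → Set 𝒳 := fun a => {x | 64 * (V₀ a x + V₁ a x) < (G₁ a x - G₀ a x) ^ 2} with hDdef
  have hD : ∀ a, MeasurableSet (D a) := fun a => measurableSet_lt (by fun_prop) (by fun_prop)
  set O : Set 𝒳 := {x | ∀ a, c < e₀ a x} with hOdef
  have hO : MeasurableSet O := by
    rw [hOdef, Set.ofPred_forall]
    exact MeasurableSet.iInter fun a => measurableSet_lt measurable_const (me a)
  have hO0 : Q₀.real (X ⁻¹' Oᶜ) = 0 := by
    have : Q₀ (X ⁻¹' Oᶜ) = 0 := by
      have := ae_iff.1 (ae_all_iff.2 he)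
      exact this
    rw [Measure.real, this, ENNReal.toReal_zero]
  set S : Set 𝒳 := O ∩ Nᶜ ∩ ⋂ a, (D a)ᶜ with hSdef
  have hS : MeasurableSet S :=
    (hO.inter hN.compl).inter (MeasurableSet.iInter fun a => (hD a).compl)
  refine ⟨S, ⟨hS, fun x hx => hx.1.1, fun x hx a => ?_, ?_⟩, ?_⟩
  · have h1 : x ∉ D a := (Set.mem_iInter.1 hx.2 a)
    exact not_lt.1 h1
  · refine Measure.le_iff.2 fun t ht => ?_
    rw [Measure.restrict_apply ht]
    exact (hN2 _ (ht.inter hS) fun x hx => hx.2.1.2).trans (measure_mono Set.inter_subset_left)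
  · set δ := l2 (μ.restrict (X ⁻¹' Sᶜ)) (fun ω => s₁ ω - s₀ ω) with hδ
    have hmono : ∀ T ⊆ X ⁻¹' Sᶜ, l2 (μ.restrict T) (fun ω => s₁ ω - s₀ ω) ≤ δ :=
      fun T hT => l2_restrict_mono hΔ hT
    have bN : Q₀.real (X ⁻¹' N) ≤ 4 * δ ^ 2 := by
      have h4 : 4 * Q₁.real (X ⁻¹' N) ≤ Q₀.real (X ⁻¹' N) := by
        have := ENNReal.toReal_mono (measure_ne_top _ _) (hN1 N hN subset_rfl)
        simpa [Measure.real, Measure.map_apply hX hN] using this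
      have h5 := (sqrt_real_le_of_four_mul_le h₀ h₁ (hX hN) h4).trans
        (mul_le_mul_of_nonneg_left (hmono _ fun ω hω h' => h'.1.2 hω) zero_le_two)
      have hn := l2_nonneg (μ := μ.restrict (X ⁻¹' Sᶜ)) fun ω => s₁ ω - s₀ ω
      have h6 := (Real.sqrt_le_left (by positivity)).1 h5
      linarith
    have bD : ∀ a, Q₀.real (X ⁻¹' (O ∩ D a)) ≤ 25 / 4 / c * δ ^ 2 := by
      intro a
      have h5 := (sqrt_real_separated_le h₀ h₁ r₀ r₁ a).trans
        (mul_le_mul_of_nonneg_left (hmono _ fun ω hω h' => Set.mem_iInter.1 h'.2 a hω.2)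
          (by norm_num))
      have hn := l2_nonneg (μ := μ.restrict (X ⁻¹' Sᶜ)) fun ω => s₁ ω - s₀ ω
      have h6 := (Real.sqrt_le_left (by positivity)).1 h5
      have hA : MeasurableSet (A ⁻¹' {a}) := r₀.measurable_A (measurableSet_singleton a)
      -- The separation bound concerns the arm `A = a` only. Overlap, valid on `O`, extends it to
      -- all observations and turns `(5/2)²` into `25 / 4 / c`.
      have h7 : c * Q₀.real (X ⁻¹' (O ∩ D a)) ≤ Q₀.real (A ⁻¹' {a} ∩ X ⁻¹' D a) := by
        have hOD := hO.inter (hD a)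
        have := r₀.overlap_integral_le a (f := (O ∩ D a).indicator 1)
          (measurable_one.indicator hOD)
          (((integrable_const (1 : ℝ)).indicator (hX hOD)).congr (ae_of_all _ fun _ => rfl))
          (fun x => Set.indicator_nonneg (fun _ _ => zero_le_one) x)
          (fun x hx => (Set.mem_of_indicator_ne_zero hx).1 a |>.le)
        have e : (fun ω => (O ∩ D a).indicator (1 : 𝒳 → ℝ) (X ω)) =
            (X ⁻¹' (O ∩ D a)).indicator 1 := rfl
        rw [e, integral_indicator_one (hX hOD), integral_indicator_one (hX hOD),
          measureReal_restrict_apply (hX hOD)] at this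
        refine this.trans (measureReal_mono ?_)
        exact fun ω hω => ⟨hω.2, hω.1.2⟩
      rw [div_mul_eq_mul_div, le_div_iff₀ hc]
      nlinarith
    have hcov : X ⁻¹' Sᶜ ⊆ X ⁻¹' Oᶜ ∪ X ⁻¹' N ∪ ⋃ a, X ⁻¹' (O ∩ D a) := by
      intro ω hω
      by_contra hcon
      simp only [Set.mem_union, Set.mem_iUnion, Set.mem_preimage, not_or, not_exists] at hcon
      refine hω ⟨⟨not_not.1 hcon.1.1, hcon.1.2⟩, Set.mem_iInter.2 fun a ha => ?_⟩
      exact hcon.2 a ⟨not_not.1 hcon.1.1, ha⟩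
    calc Q₀.real (X ⁻¹' Sᶜ) ≤ Q₀.real (X ⁻¹' Oᶜ ∪ X ⁻¹' N ∪ ⋃ a, X ⁻¹' (O ∩ D a)) :=
          measureReal_mono hcov
      _ ≤ Q₀.real (X ⁻¹' Oᶜ) + Q₀.real (X ⁻¹' N) + ∑ a, Q₀.real (X ⁻¹' (O ∩ D a)) :=
          (measureReal_union_le _ _).trans (add_le_add (measureReal_union_le _ _)
            (measureReal_iUnion_fintype_le _))
      _ ≤ 0 + 4 * δ ^ 2 + ∑ a : ι, 25 / 4 / c * δ ^ 2 :=
          add_le_add (add_le_add hO0.le bN) (Finset.sum_le_sum fun a _ => bD a)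
      _ = _ := by simp; ring

end PairOfLaws

/-! ### Estimates on a good set: moments, closeness of regressions, double robustness. -/

section PairOfLaws

variable {Ω : Type*} [MeasurableSpace Ω] {μ : Measure Ω}
variable {ι 𝒳 : Type*} [Fintype ι] [MeasurableSpace ι] [MeasurableSingletonClass ι]
  [MeasurableSpace 𝒳]
variable {A : Ω → ι} {X : Ω → 𝒳} {U : Ω → ℝ} {Q₀ Q₁ : Measure Ω}
variable {s₀ s₁ : Ω → ℝ} {e₀ G₀ V₀ e₁ G₁ V₁ : ι → 𝒳 → ℝ}

omit [MeasurableSpace Ω] in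
theorem abs_indicator_le_abs_self (T : Set Ω) (f : Ω → ℝ) (ω : Ω) :
    |T.indicator f ω| ≤ |f ω| := by
  by_cases h : ω ∈ T <;> simp [h]

/-- Write `U - G' = (U - G) + (G - G')`: the first part averages to zero within the arm, and the
second is a function of `X`, for which the arm contributes its propensity. The centring `G'` will be
the regression of another law. -/
theorem IsRegression.setIntegral_residual_of {Q : Measure Ω} [IsFiniteMeasure Q]
    {e G V : ι → 𝒳 → ℝ} (h : IsRegression Q A X U e G V) (a : ι) {k G' : 𝒳 → ℝ}
    (hk : Measurable k) (hkb : ∃ C, ∀ x, |k x| ≤ C) (hG' : Measurable G')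
    (hi : Integrable (fun ω => k (X ω) * (G a (X ω) - G' (X ω))) Q) :
    ∫ ω in A ⁻¹' {a}, k (X ω) * (U ω - G' (X ω)) ∂Q =
      ∫ ω, e a (X ω) * (k (X ω) * (G a (X ω) - G' (X ω))) ∂Q := by
  have hA : MeasurableSet (A ⁻¹' {a}) := h.measurable_A (measurableSet_singleton a)
  have hG := h.measurable_G a
  have hX := h.measurable_X
  have hU := h.measurable_U
  obtain ⟨C, hC⟩ := hkb
  have h1 := h.setIntegral_residual a k hk ⟨C, hC⟩
  have h2 := h.setIntegral_X a (fun x => k x * (G a x - G' x)) (by fun_prop)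
  have i1 : IntegrableOn (fun ω => k (X ω) * (U ω - G a (X ω))) (A ⁻¹' {a}) Q := by
    have := ((h.memLp_residual a).1.integrable one_le_two)
    rw [integrable_indicator_iff hA] at this
    exact this.bdd_mul (c := C) ((hk.comp hX).aestronglyMeasurable) (ae_of_all _ fun ω => hC _)
  rw [← h2, ← zero_add (∫ ω in A ⁻¹' {a}, k (X ω) * (G a (X ω) - G' (X ω)) ∂Q), ← h1,
    ← integral_add i1 hi.integrableOn]
  exact integral_congr_ae (ae_of_all _ fun ω => by ring)

namespace IsGoodSet

variable {c : ℝ} {S : Set 𝒳} (g : IsGoodSet Q₀ Q₁ X e₀ G₀ V₀ G₁ V₁ c S)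
include g

omit [Fintype ι] [MeasurableSpace ι] [MeasurableSingletonClass ι] in
theorem integral_indicator_le (hX : Measurable X) {f : 𝒳 → ℝ} (hf : Measurable f)
    (hf0 : ∀ x, 0 ≤ f x) (hi : Integrable (fun ω => f (X ω)) Q₁) :
    Integrable ((X ⁻¹' S).indicator fun ω => f (X ω)) Q₀ ∧
      ∫ ω, (X ⁻¹' S).indicator (fun ω => f (X ω)) ω ∂Q₀ ≤ 4 * ∫ ω, f (X ω) ∂Q₁ := by
  have i1 : Integrable f (Q₁.map X) :=
    (integrable_map_measure hf.aestronglyMeasurable hX.aemeasurable).2 hi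
  have i4 : Integrable f ((4 : ℝ≥0∞) • Q₁.map X) := i1.smul_measure (by simp)
  have i0 : IntegrableOn f S (Q₀.map X) := i4.mono_measure g.dominated
  have e1 : ((X ⁻¹' S).indicator fun ω => f (X ω)) = fun ω => S.indicator f (X ω) := rfl
  constructor
  · rw [e1]
    exact (integrable_map_measure (hf.indicator g.measurableSet).aestronglyMeasurable
      hX.aemeasurable).1 ((integrable_indicator_iff g.measurableSet).2 i0)
  · rw [e1, ← integral_map hX.aemeasurable (hf.indicator g.measurableSet).aestronglyMeasurable,
      ← integral_map hX.aemeasurable hf.aestronglyMeasurable, integral_indicator g.measurableSet]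
    refine (integral_mono_measure g.dominated (ae_of_all _ hf0) i4).trans_eq ?_
    rw [integral_smul_measure]
    simp

variable (h₀ : IsRootDensity μ Q₀ s₀) (h₁ : IsRootDensity μ Q₁ s₁)
    (r₀ : IsRegression Q₀ A X U e₀ G₀ V₀) (r₁ : IsRegression Q₁ A X U e₁ G₁ V₁) {C : ℝ}
    (hC₀ : ∀ a, ∫ ω, V₀ a (X ω) ∂Q₀ ≤ C) (hC₁ : ∀ a, ∫ ω, V₁ a (X ω) ∂Q₁ ≤ C)
include r₀ r₁ hC₀ hC₁

theorem memLp_sub (a : ι) :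
    MemLp ((X ⁻¹' S).indicator fun ω => G₁ a (X ω) - G₀ a (X ω)) 2 Q₀ ∧
      l2 Q₀ ((X ⁻¹' S).indicator fun ω => G₁ a (X ω) - G₀ a (X ω)) ≤ 18 * √C := by
  have hX := r₀.measurable_X
  have mG₀ := r₀.measurable_G a
  have mG₁ := r₁.measurable_G a
  have mS := hX g.measurableSet
  obtain ⟨i1, hi1⟩ := g.integral_indicator_le hX (r₁.measurable_V a) (r₁.V_nonneg a)
    (r₁.integrable_V a)
  have i0 : Integrable (fun ω => V₀ a (X ω)) Q₀ := r₀.integrable_V a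
  obtain ⟨m, hm⟩ := memLp_two_of_sq_le
    (f := (X ⁻¹' S).indicator fun ω => G₁ a (X ω) - G₀ a (X ω))
    (g := fun ω => 64 * (V₀ a (X ω) + (X ⁻¹' S).indicator (fun ω => V₁ a (X ω)) ω))
    (Measurable.indicator (by fun_prop) mS) ((i0.add i1).const_mul 64) (ae_of_all _ fun ω => by
      by_cases hω : ω ∈ X ⁻¹' S
      · simp only [Set.indicator_of_mem hω]
        exact g.sq_le _ hω a
      · simp only [Set.indicator_of_notMem hω]
        have := r₀.V_nonneg a (X ω)
        nlinarith)
  refine ⟨m, hm.trans ?_⟩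
  have hC : 0 ≤ C := (integral_nonneg fun ω => r₀.V_nonneg a _).trans (hC₀ a)
  rw [integral_const_mul, integral_add i0 i1]
  -- The domination factor `4` gives `64 (C + 4 C) = 320 C`, and `18² = 324`.
  refine Real.sqrt_le_iff.2 ⟨by positivity, ?_⟩
  rw [mul_pow, Real.sq_sqrt hC]
  have := hC₀ a
  have := hC₁ a
  nlinarith

theorem memLp_residual₁ (a : ι) :
    MemLp ((X ⁻¹' S).indicator ((A ⁻¹' {a}).indicator fun ω => U ω - G₁ a (X ω))) 2 Q₁ ∧
      l2 Q₁ ((X ⁻¹' S).indicator ((A ⁻¹' {a}).indicator fun ω => U ω - G₁ a (X ω))) ≤ √C := by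
  obtain ⟨m, hm⟩ := r₁.memLp_residual a
  refine ⟨m.indicator (r₀.measurable_X g.measurableSet), ?_⟩
  refine (l2_mono m (ae_of_all _ fun ω => ?_)).trans (hm.trans (Real.sqrt_le_sqrt (hC₁ a)))
  exact abs_indicator_le_abs_self _ _ _

/-- Under `Q₀` the residual about the foreign regression `G₁` is the residual about `G₀`, of norm at
most `√C`, minus the difference of the regressions, of norm at most `18 √C` on the good set. -/
theorem memLp_residual₀ (a : ι) :
    MemLp ((X ⁻¹' S).indicator ((A ⁻¹' {a}).indicator fun ω => U ω - G₁ a (X ω))) 2 Q₀ ∧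
      l2 Q₀ ((X ⁻¹' S).indicator ((A ⁻¹' {a}).indicator fun ω => U ω - G₁ a (X ω))) ≤
        19 * √C := by
  have hX := r₀.measurable_X
  have mS := hX g.measurableSet
  have hA : MeasurableSet (A ⁻¹' {a}) := r₀.measurable_A (measurableSet_singleton a)
  obtain ⟨m, hm⟩ := r₀.memLp_residual a
  obtain ⟨m', hm'⟩ := g.memLp_sub r₀ r₁ hC₀ hC₁ a
  have b1 : l2 Q₀ ((X ⁻¹' S).indicator ((A ⁻¹' {a}).indicator fun ω => U ω - G₀ a (X ω))) ≤ √C :=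
    (l2_mono m (ae_of_all _ fun ω => abs_indicator_le_abs_self _ _ _)).trans
      (hm.trans (Real.sqrt_le_sqrt (hC₀ a)))
  have b2 : l2 Q₀ (fun ω => (-1 : ℝ) * (A ⁻¹' {a}).indicator
      ((X ⁻¹' S).indicator fun ω => G₁ a (X ω) - G₀ a (X ω)) ω) ≤ 18 * √C := by
    rw [l2_const_mul, abs_neg, abs_one, one_mul]
    exact (l2_mono m' (ae_of_all _ fun ω => abs_indicator_le_abs_self _ _ _)).trans hm'
  have e : ((X ⁻¹' S).indicator ((A ⁻¹' {a}).indicator fun ω => U ω - G₁ a (X ω))) = fun ω =>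
      (X ⁻¹' S).indicator ((A ⁻¹' {a}).indicator fun ω => U ω - G₀ a (X ω)) ω + (-1 : ℝ) *
      (A ⁻¹' {a}).indicator ((X ⁻¹' S).indicator fun ω => G₁ a (X ω) - G₀ a (X ω)) ω := by
    ext ω
    by_cases h1 : ω ∈ X ⁻¹' S <;> by_cases h2 : ω ∈ A ⁻¹' {a} <;>
      simp only [Set.indicator_of_mem, Set.indicator_of_notMem, h1, h2, not_false_eq_true] <;> ring
  have m1 := m.indicator mS
  have m2 := (m'.indicator hA).const_mul (-1 : ℝ)
  rw [e]
  exact ⟨m1.add m2, (l2_add_le m1 m2).trans (by linarith)⟩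

include h₀ h₁ in
-- Test both laws with the residual about `G₁` times the sign of `G₁ - G₀`. Its mean is zero under
-- `Q₁`, and under `Q₀` it is minus the integral of `|G₁ - G₀|` over the arm. The two means differ
-- by at most the Hellinger distance times `(19 + 1) √C`, and overlap replaces the arm by the whole
-- law of `X`.
theorem integral_abs_sub_le (hc : 0 < c) (a : ι) :
    ∫ ω, |(X ⁻¹' S).indicator (fun ω => G₁ a (X ω) - G₀ a (X ω)) ω| ∂Q₀ ≤
      c⁻¹ * (l2 μ (fun ω => s₁ ω - s₀ ω) * (20 * √C)) := by
  have := h₀.prob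
  have := h₁.prob
  have hX := r₀.measurable_X
  have mG₀ := r₀.measurable_G a
  have mG₁ := r₁.measurable_G a
  have mS := hX g.measurableSet
  have hA : MeasurableSet (A ⁻¹' {a}) := r₀.measurable_A (measurableSet_singleton a)
  obtain ⟨m, -⟩ := g.memLp_sub r₀ r₁ hC₀ hC₁ a
  obtain ⟨mR₀, bR₀⟩ := g.memLp_residual₀ r₀ r₁ hC₀ hC₁ a
  obtain ⟨mR₁, bR₁⟩ := g.memLp_residual₁ r₀ r₁ hC₀ hC₁ a
  set R := (X ⁻¹' S).indicator ((A ⁻¹' {a}).indicator fun ω => U ω - G₁ a (X ω)) with hR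
  have mR : Measurable R := (r₁.measurable_residual a).indicator mS
  set f : 𝒳 → ℝ := S.indicator fun x => |G₁ a x - G₀ a x| with hf
  have hfm : Measurable f := Measurable.indicator (by fun_prop) g.measurableSet
  have ef : ∀ ω, |(X ⁻¹' S).indicator (fun ω => G₁ a (X ω) - G₀ a (X ω)) ω| = f (X ω) := by
    intro ω
    by_cases hω : X ω ∈ S
    · have hω' : ω ∈ X ⁻¹' S := hω
      simp only [hf, Set.indicator_of_mem hω, Set.indicator_of_mem hω']
    · have hω' : ω ∉ X ⁻¹' S := hω
      simp only [hf, Set.indicator_of_notMem hω, Set.indicator_of_notMem hω', abs_zero]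
  have hfi : Integrable (fun ω => f (X ω)) Q₀ := by
    simp_rw [← ef]
    exact (m.integrable one_le_two).abs
  have l1 := r₀.overlap_integral_le a (c := c) hfm hfi
    (fun x => Set.indicator_nonneg (fun _ _ => abs_nonneg _) x)
    fun x hx => (g.overlap x (Set.mem_of_indicator_ne_zero hx) a).le
  set k : 𝒳 → ℝ := S.indicator fun x => if G₀ a x ≤ G₁ a x then 1 else -1 with hk
  have hkm : Measurable k := Measurable.indicator
    (Measurable.ite (measurableSet_le mG₀ mG₁) measurable_const measurable_const) g.measurableSet
  have hkb : ∀ x, |k x| ≤ 1 := by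
    intro x
    by_cases hx : x ∈ S
    · simp only [hk, Set.indicator_of_mem hx]
      split_ifs <;> simp
    · simp [hk, Set.indicator_of_notMem hx]
  have hkD : ∀ x, k x * (G₀ a x - G₁ a x) = -f x := by
    intro x
    by_cases hx : x ∈ S
    · simp only [hk, hf, Set.indicator_of_mem hx]
      split_ifs with h
      · rw [abs_of_nonneg (by linarith)]; ring
      · rw [abs_of_nonpos (by linarith)]; ring
    · simp [hk, hf, Set.indicator_of_notMem hx]
  have eR : ∀ Q : Measure Ω, ∫ ω, k (X ω) * R ω ∂Q =
      ∫ ω in A ⁻¹' {a}, k (X ω) * (U ω - G₁ a (X ω)) ∂Q := by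
    intro Q
    rw [← integral_indicator hA]
    congr 1
    ext ω
    by_cases h1 : X ω ∈ S
    · have h1' : ω ∈ X ⁻¹' S := h1
      by_cases h2 : ω ∈ A ⁻¹' {a} <;>
      simp only [hR, Set.indicator_of_mem, Set.indicator_of_notMem, h1', h2, not_false_eq_true,
        mul_zero]
    · have : k (X ω) = 0 := Set.indicator_of_notMem h1 _
      simp only [this, zero_mul]
      by_cases h2 : ω ∈ A ⁻¹' {a}
      · rw [Set.indicator_of_mem h2, this, zero_mul]
      · rw [Set.indicator_of_notMem h2]
  have e0 : ∫ ω, k (X ω) * R ω ∂Q₀ = -∫ ω in A ⁻¹' {a}, f (X ω) ∂Q₀ := by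
    rw [eR, r₀.setIntegral_residual_of a hkm ⟨1, hkb⟩ mG₁ (by simp_rw [hkD]; exact hfi.neg),
      r₀.setIntegral_X a f hfm, ← integral_neg]
    simp_rw [hkD, mul_neg]
  have e1 : ∫ ω, k (X ω) * R ω ∂Q₁ = 0 := by
    rw [eR, r₁.setIntegral_residual a k hkm ⟨1, hkb⟩]
  have hkR : ∀ ω, |k (X ω) * R ω| ≤ |R ω| := fun ω => by
    rw [abs_mul]
    exact mul_le_of_le_one_left (abs_nonneg _) (hkb _)
  have mk : Measurable fun ω => k (X ω) * R ω := (hkm.comp hX).mul mR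
  have key := abs_integral_sub_integral_le h₀ h₁ mk
    (mR₀.mono mk.aestronglyMeasurable (ae_of_all _ hkR))
    (mR₁.mono mk.aestronglyMeasurable (ae_of_all _ hkR))
  have b0 := l2_mono mR₀ (ae_of_all _ hkR)
  have b1 := l2_mono mR₁ (ae_of_all _ hkR)
  rw [e0, e1, zero_sub, neg_neg] at key
  have l2 := (le_abs_self _).trans key
  simp_rw [ef]
  rw [inv_mul_eq_div, le_div_iff₀ hc, mul_comm]
  refine l1.trans (l2.trans (mul_le_mul_of_nonneg_left ?_ (l2_nonneg _)))
  linarith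

omit hC₀ hC₁ in
theorem indicator_ipw_eq (ω : Ω) : (X ⁻¹' S).indicator (ipw A X U e₀ G₁) ω =
    (∑ a, (e₀ a (X ω))⁻¹ * (X ⁻¹' S).indicator ((A ⁻¹' {a}).indicator
      fun ω => U ω - G₁ a (X ω)) ω) + (X ⁻¹' S).indicator (fun ω => ∑ a, G₁ a (X ω)) ω := by
  by_cases h1 : ω ∈ X ⁻¹' S
  · simp only [Set.indicator_of_mem h1, ipw]
    rw [Finset.sum_add_distrib]
    congr 1
    refine Finset.sum_congr rfl fun a _ => ?_
    by_cases h2 : ω ∈ A ⁻¹' {a}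
    · simp only [Set.indicator_of_mem h2]; rw [div_eq_inv_mul]
    · simp only [Set.indicator_of_notMem h2, mul_zero]
  · simp [Set.indicator_of_notMem h1]

omit hC₀ hC₁ in
theorem memLp_indicator_ipw (hc : 0 < c) {Q : Measure Ω} {K L : ℝ}
    (hR : ∀ a, MemLp ((X ⁻¹' S).indicator ((A ⁻¹' {a}).indicator fun ω => U ω - G₁ a (X ω))) 2 Q ∧
      l2 Q ((X ⁻¹' S).indicator ((A ⁻¹' {a}).indicator fun ω => U ω - G₁ a (X ω))) ≤ K)
    (hW : MemLp ((X ⁻¹' S).indicator fun ω => ∑ a, G₁ a (X ω)) 2 Q ∧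
      l2 Q ((X ⁻¹' S).indicator fun ω => ∑ a, G₁ a (X ω)) ≤ L) :
    MemLp ((X ⁻¹' S).indicator (ipw A X U e₀ G₁)) 2 Q ∧
      l2 Q ((X ⁻¹' S).indicator (ipw A X U e₀ G₁)) ≤ Fintype.card ι * (c⁻¹ * K) + L := by
  have hX := r₀.measurable_X
  have mS := hX g.measurableSet
  set R : ι → Ω → ℝ := fun a => (X ⁻¹' S).indicator ((A ⁻¹' {a}).indicator
    fun ω => U ω - G₁ a (X ω)) with hRdef
  have mR : ∀ a, Measurable (R a) := fun a => (r₁.measurable_residual a).indicator mS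
  have hle : ∀ a ω, |(e₀ a (X ω))⁻¹ * R a ω| ≤ |c⁻¹ * R a ω| := by
    intro a ω
    by_cases h1 : ω ∈ X ⁻¹' S
    · rw [abs_mul, abs_mul]
      refine mul_le_mul_of_nonneg_right ?_ (abs_nonneg _)
      have h2 := g.overlap _ h1 a
      rw [abs_of_pos (inv_pos.2 (hc.trans h2)), abs_of_pos (inv_pos.2 hc)]
      exact inv_anti₀ hc h2.le
    · have : R a ω = 0 := Set.indicator_of_notMem h1 _
      simp [this]
  have mR' : ∀ a, MemLp (fun ω => (e₀ a (X ω))⁻¹ * R a ω) 2 Q := fun a =>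
    ((hR a).1.const_mul c⁻¹).mono ((((r₀.measurable_e a).comp hX).inv.mul
      (mR a)).aestronglyMeasurable) (ae_of_all _ (hle a))
  have bR' : ∀ a, l2 Q (fun ω => (e₀ a (X ω))⁻¹ * R a ω) ≤ c⁻¹ * K := fun a => by
    refine (l2_mono ((hR a).1.const_mul c⁻¹) (ae_of_all _ (hle a))).trans ?_
    rw [l2_const_mul, abs_of_pos (inv_pos.2 hc)]
    exact mul_le_mul_of_nonneg_left (hR a).2 (inv_pos.2 hc).le
  have e : (X ⁻¹' S).indicator (ipw A X U e₀ G₁) = fun ω =>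
      (∑ a, (e₀ a (X ω))⁻¹ * R a ω) + (X ⁻¹' S).indicator (fun ω => ∑ a, G₁ a (X ω)) ω :=
    funext fun ω => g.indicator_ipw_eq r₀ r₁ ω
  have mS' := memLp_finsetSum Finset.univ fun a _ => mR' a
  rw [e]
  refine ⟨mS'.add hW.1, (l2_add_le mS' hW.1).trans (add_le_add ?_ hW.2)⟩
  refine (l2_sum_le _ mR').trans ((Finset.sum_le_sum fun a _ => bR' a).trans_eq ?_)
  simp

omit hC₀ hC₁ in
-- Double robustness. The condition `he` holds if the propensity of `Q` is `e₀`, and it also holds,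
-- trivially, if the regression of `Q` is `G₁`. So the hybrid score with the propensity of one law
-- and the regression of the other has the right mean over the good set under both.
theorem integral_indicator_ipw [IsFiniteMeasure Q₀] (hc : 0 < c) {Q : Measure Ω}
    [IsFiniteMeasure Q] {e G V : ι → 𝒳 → ℝ} (r : IsRegression Q A X U e G V)
    (hR : ∀ a, MemLp ((X ⁻¹' S).indicator ((A ⁻¹' {a}).indicator fun ω => U ω - G₁ a (X ω))) 2 Q)
    (hW : MemLp ((X ⁻¹' S).indicator fun ω => ∑ a, G₁ a (X ω)) 2 Q)
    (hD : ∀ a, Integrable ((X ⁻¹' S).indicator fun ω => G a (X ω) - G₁ a (X ω)) Q)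
    (he : ∀ a x, x ∈ S → e a x * (G a x - G₁ a x) = e₀ a x * (G a x - G₁ a x)) :
    ∫ ω, (X ⁻¹' S).indicator (ipw A X U e₀ G₁) ω ∂Q =
      ∫ ω in X ⁻¹' S, ∑ a, G a (X ω) ∂Q := by
  have hX := r₀.measurable_X
  have mS := hX g.measurableSet
  set R : ι → Ω → ℝ := fun a => (X ⁻¹' S).indicator ((A ⁻¹' {a}).indicator
    fun ω => U ω - G₁ a (X ω)) with hRdef
  have mR : ∀ a, Measurable (R a) := fun a => (r₁.measurable_residual a).indicator mS
  set k : ι → 𝒳 → ℝ := fun a => S.indicator fun x => (e₀ a x)⁻¹ with hk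
  have hkm : ∀ a, Measurable (k a) := fun a => (r₀.measurable_e a).inv.indicator g.measurableSet
  have hkb : ∀ a x, |k a x| ≤ c⁻¹ := by
    intro a x
    by_cases hx : x ∈ S
    · simp only [hk, Set.indicator_of_mem hx]
      have h2 := g.overlap _ hx a
      rw [abs_of_pos (inv_pos.2 (hc.trans h2))]
      exact inv_anti₀ hc h2.le
    · simp only [hk, Set.indicator_of_notMem hx, abs_zero]
      exact (inv_pos.2 hc).le
  have e1 : ∀ a ω, (e₀ a (X ω))⁻¹ * R a ω = k a (X ω) * R a ω := by
    intro a ω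
    by_cases h1 : X ω ∈ S
    · simp only [hk, Set.indicator_of_mem h1]
    · have h1' : ω ∉ X ⁻¹' S := h1
      have : R a ω = 0 := Set.indicator_of_notMem h1' _
      simp [this]
  have iR : ∀ a, Integrable (fun ω => k a (X ω) * R a ω) Q := fun a =>
    ((hR a).integrable one_le_two).bdd_mul (c := c⁻¹)
      (((hkm a).comp hX).aestronglyMeasurable) (ae_of_all _ fun ω => hkb a _)
  have hkD : ∀ a ω, k a (X ω) * (G a (X ω) - G₁ a (X ω)) =
      k a (X ω) * (X ⁻¹' S).indicator (fun ω => G a (X ω) - G₁ a (X ω)) ω := by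
    intro a ω
    by_cases h1 : X ω ∈ S
    · have h1' : ω ∈ X ⁻¹' S := h1
      simp only [Set.indicator_of_mem h1']
    · have : k a (X ω) = 0 := Set.indicator_of_notMem h1 _
      simp [this]
  have e2 : ∀ a, ∫ ω, k a (X ω) * R a ω ∂Q =
      ∫ ω, (X ⁻¹' S).indicator (fun ω => G a (X ω) - G₁ a (X ω)) ω ∂Q := by
    intro a
    have hA : MeasurableSet (A ⁻¹' {a}) := r₀.measurable_A (measurableSet_singleton a)
    have : ∫ ω, k a (X ω) * R a ω ∂Q =
        ∫ ω in A ⁻¹' {a}, k a (X ω) * (U ω - G₁ a (X ω)) ∂Q := by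
      rw [← integral_indicator hA]
      congr 1
      ext ω
      by_cases h1 : X ω ∈ S
      · have h1' : ω ∈ X ⁻¹' S := h1
        by_cases h2 : ω ∈ A ⁻¹' {a} <;>
        simp only [hRdef, Set.indicator_of_mem, Set.indicator_of_notMem, h1', h2,
          not_false_eq_true, mul_zero]
      · have : k a (X ω) = 0 := Set.indicator_of_notMem h1 _
        simp only [this, zero_mul]
        by_cases h2 : ω ∈ A ⁻¹' {a}
        · rw [Set.indicator_of_mem h2, this, zero_mul]
        · rw [Set.indicator_of_notMem h2]
    rw [this, r.setIntegral_residual_of a (hkm a) ⟨_, hkb a⟩ (r₁.measurable_G a)]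
    · congr 1
      ext ω
      by_cases h1 : X ω ∈ S
      · have h1' : ω ∈ X ⁻¹' S := h1
        simp only [hk, Set.indicator_of_mem h1', Set.indicator_of_mem h1]
        have h2 := hc.trans (g.overlap _ h1 a)
        rw [mul_left_comm, he a _ h1, ← mul_assoc, inv_mul_cancel₀ h2.ne', one_mul]
      · have h1' : ω ∉ X ⁻¹' S := h1
        simp [hk, Set.indicator_of_notMem h1', Set.indicator_of_notMem h1]
    · simp_rw [hkD]
      exact (hD a).bdd_mul (c := c⁻¹) (((hkm a).comp hX).aestronglyMeasurable)
        (ae_of_all _ fun ω => hkb a _)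
  have e3 : ∀ ω, (X ⁻¹' S).indicator (ipw A X U e₀ G₁) ω =
      (∑ a, k a (X ω) * R a ω) + (X ⁻¹' S).indicator (fun ω => ∑ a, G₁ a (X ω)) ω := fun ω => by
    rw [g.indicator_ipw_eq r₀ r₁ ω]
    simp_rw [← e1]
    rfl
  simp_rw [e3]
  have iW := hW.integrable one_le_two
  rw [integral_add (integrable_finsetSum _ fun a _ => iR a) iW,
    integral_finsetSum _ fun a _ => iR a]
  simp_rw [e2]
  rw [← integral_finsetSum _ fun a _ => hD a,
    ← integral_add (integrable_finsetSum _ fun a _ => hD a) iW, ← integral_indicator mS]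
  congr 1
  ext ω
  by_cases h1 : ω ∈ X ⁻¹' S
  · simp only [Set.indicator_of_mem h1]
    rw [← Finset.sum_add_distrib]
    exact Finset.sum_congr rfl fun a _ => by ring
  · simp [Set.indicator_of_notMem h1]

include h₀ h₁ in
-- Replacing `G₀` by `G₁` changes the summand of `a` by `(1 - 1 / e₀) (G₁ - G₀)` in the arm and by
-- `G₁ - G₀` outside it; both factors are at most `1 + 1 / c` in absolute value.
theorem integral_abs_indicator_ipw_sub_le (hc : 0 < c) :
    ∫ ω, |(X ⁻¹' S).indicator (ipw A X U e₀ G₁) ω -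
        (X ⁻¹' S).indicator (ipw A X U e₀ G₀) ω| ∂Q₀ ≤
      Fintype.card ι * ((1 + c⁻¹) * (c⁻¹ * (l2 μ (fun ω => s₁ ω - s₀ ω) * (20 * √C)))) := by
  have := h₀.prob
  set D : ι → Ω → ℝ := fun a => (X ⁻¹' S).indicator fun ω => G₁ a (X ω) - G₀ a (X ω) with hD
  have iD : ∀ a, Integrable (fun ω => |D a ω|) Q₀ := fun a =>
    ((g.memLp_sub r₀ r₁ hC₀ hC₁ a).1.integrable one_le_two).abs
  have hle : ∀ ω, |(X ⁻¹' S).indicator (ipw A X U e₀ G₁) ω -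
      (X ⁻¹' S).indicator (ipw A X U e₀ G₀) ω| ≤ ∑ a, (1 + c⁻¹) * |D a ω| := by
    intro ω
    by_cases h1 : ω ∈ X ⁻¹' S
    · simp only [hD, Set.indicator_of_mem h1, ipw]
      rw [← Finset.sum_sub_distrib]
      refine (Finset.abs_sum_le_sum_abs _ _).trans (Finset.sum_le_sum fun a _ => ?_)
      have h2 := g.overlap _ h1 a
      have h3 : (e₀ a (X ω))⁻¹ ≤ c⁻¹ := inv_anti₀ hc h2.le
      have h4 : 0 < (e₀ a (X ω))⁻¹ := inv_pos.2 (hc.trans h2)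
      by_cases h5 : ω ∈ A ⁻¹' {a}
      · simp only [Set.indicator_of_mem h5]
        have : (U ω - G₁ a (X ω)) / e₀ a (X ω) + G₁ a (X ω) -
            ((U ω - G₀ a (X ω)) / e₀ a (X ω) + G₀ a (X ω)) =
            (1 - (e₀ a (X ω))⁻¹) * (G₁ a (X ω) - G₀ a (X ω)) := by
          rw [div_eq_mul_inv, div_eq_mul_inv]; ring
        rw [this, abs_mul]
        refine mul_le_mul_of_nonneg_right ?_ (abs_nonneg _)
        rw [abs_le]
        constructor <;> linarith
      · simp only [Set.indicator_of_notMem h5]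
        rw [zero_add, zero_add]
        refine le_mul_of_one_le_left (abs_nonneg _) ?_
        linarith
    · simp only [hD, Set.indicator_of_notMem h1]
      simp
  refine (integral_mono_of_nonneg (ae_of_all _ fun _ => abs_nonneg _)
    (integrable_finsetSum _ fun a _ => (iD a).const_mul _) (ae_of_all _ hle)).trans ?_
  rw [integral_finsetSum _ fun a _ => (iD a).const_mul _]
  simp_rw [integral_const_mul]
  refine (Finset.sum_le_sum fun a _ => mul_le_mul_of_nonneg_left
    (g.integral_abs_sub_le h₀ h₁ r₀ r₁ hC₀ hC₁ hc a) (by positivity)).trans_eq ?_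
  simp

end IsGoodSet

end PairOfLaws

/-! ### Paths of laws whose root densities are differentiable in mean square. -/

section SmoothPath

variable {Ω : Type*} [MeasurableSpace Ω] {μ : Measure Ω} {n : ℕ}

/-- A family of laws whose root densities are differentiable in mean square at `η₀`. -/
structure IsSmoothPath (μ : Measure Ω) (Q : EuclideanSpace ℝ (Fin n) → Measure Ω)
    (s : EuclideanSpace ℝ (Fin n) → Ω → ℝ) (ψ : Fin n → Ω → ℝ) (η₀ : EuclideanSpace ℝ (Fin n)) :
    Prop where
  root : ∀ᶠ η in 𝓝 η₀, IsRootDensity μ (Q η) (s η)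
  memLp : ∀ j, MemLp (ψ j) 2 μ
  diff : Tendsto (fun η => (∫ ω, (s η ω - s η₀ ω - ∑ j, (η j - η₀ j) * ψ j ω) ^ 2 ∂μ) /
    ‖η - η₀‖ ^ 2) (𝓝[≠] η₀) (𝓝 0)

/-- `f` clipped at `± N g`. -/
def clip (N : ℝ) (g f : Ω → ℝ) (ω : Ω) : ℝ := max (-(N * g ω)) (min (f ω) (N * g ω))

theorem abs_clip_le {N : ℝ} (hN : 0 ≤ N) {g : Ω → ℝ} (hg : ∀ ω, 0 ≤ g ω) (f : Ω → ℝ) (ω : Ω) :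
    |clip N g f ω| ≤ N * g ω := by
  have := mul_nonneg hN (hg ω)
  rw [abs_le]
  exact ⟨le_max_left _ _, max_le (by linarith) (min_le_right _ _)⟩

theorem abs_sub_clip_le {N : ℝ} (hN : 0 ≤ N) {g : Ω → ℝ} (hg : ∀ ω, 0 ≤ g ω) (f : Ω → ℝ) (ω : Ω) :
    |f ω - clip N g f ω| ≤ |f ω| := by
  have h0 := mul_nonneg hN (hg ω)
  unfold clip
  rcases le_total (f ω) (N * g ω) with h1 | h1
  · rw [min_eq_left h1]
    rcases le_total (-(N * g ω)) (f ω) with h2 | h2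
    · rw [max_eq_right h2]; simp
    · rw [max_eq_left h2, abs_of_nonpos (by linarith), abs_of_nonpos (by linarith)]; linarith
  · rw [min_eq_right h1, max_eq_right (by linarith), abs_of_nonneg (by linarith),
      abs_of_nonneg (by linarith)]; linarith

theorem memLp_clip {f g : Ω → ℝ} (hf : MemLp f 2 μ) (hg : Measurable g) {N : ℝ} (hN : 0 ≤ N)
    (hg0 : ∀ ω, 0 ≤ g ω) : MemLp (fun ω => f ω - clip N g f ω) 2 μ := by
  refine hf.mono ?_ (ae_of_all _ fun ω => abs_sub_clip_le hN hg0 f ω)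
  have h := hf.aestronglyMeasurable.aemeasurable
  unfold clip
  exact AEMeasurable.aestronglyMeasurable (by fun_prop)

/-- Where `g > 0` the clipping is eventually inactive, where `g = 0` there is nothing to clip, and
dominated convergence concludes. Used with `f = ψ j` and `g` the root density: up to a small error
in L², `ψ j` is bounded by a multiple of the root density, so integrals against it are controlled by
the law at `η₀`. -/
theorem exists_l2_sub_clip_lt {f g : Ω → ℝ} (hf : MemLp f 2 μ) (hg : Measurable g)
    (hg0 : ∀ ω, 0 ≤ g ω) (hfg : ∀ᵐ ω ∂μ, g ω = 0 → f ω = 0) {ε : ℝ} (hε : 0 < ε) :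
    ∃ N : ℝ, 0 ≤ N ∧ l2 μ (fun ω => f ω - clip N g f ω) < ε := by
  have h : Tendsto (fun N : ℕ => ∫ ω, (f ω - clip N g f ω) ^ 2 ∂μ) atTop (𝓝 (∫ _, (0 : ℝ) ∂μ)) := by
    refine tendsto_integral_of_dominated_convergence (fun ω => f ω ^ 2)
      (fun N => (memLp_clip hf hg N.cast_nonneg hg0).aestronglyMeasurable.pow 2)
      hf.integrable_sq (fun N => ae_of_all _ fun ω => ?_) (hfg.mono fun ω hω => ?_)
    · rw [Real.norm_eq_abs, abs_of_nonneg (sq_nonneg _)]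
      exact sq_le_sq.2 (abs_sub_clip_le N.cast_nonneg hg0 f ω)
    · refine tendsto_const_nhds.congr' ?_
      rcases eq_or_lt_of_le (hg0 ω) with h0 | h0
      · refine Eventually.of_forall fun N => ?_
        simp [clip, hω h0.symm, ← h0]
      · filter_upwards [eventually_ge_atTop ⌈|f ω| / g ω⌉₊] with N hN
        have h1 : |f ω| ≤ N * g ω := by
          rw [← div_le_iff₀ h0]
          exact (Nat.le_ceil _).trans (Nat.cast_le.2 hN)
        rw [abs_le] at h1
        simp [clip, min_eq_left h1.2, max_eq_right h1.1]
  rw [integral_zero] at h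
  have h2 := (Real.continuous_sqrt.tendsto 0).comp h
  rw [Real.sqrt_zero] at h2
  obtain ⟨N, hN⟩ := (h2.eventually (gt_mem_nhds hε)).exists
  exact ⟨N, N.cast_nonneg, hN⟩

theorem tendsto_add_single (η₀ : EuclideanSpace ℝ (Fin n)) (j : Fin n) (σ : ℝ) :
    Tendsto (fun t : ℝ => η₀ + EuclideanSpace.single j (σ * t)) (𝓝[>] 0) (𝓝 η₀) := by
  have : Continuous fun t : ℝ => η₀ + EuclideanSpace.single j (σ * t) := by
    refine continuous_const.add ?_
    have h2 : (fun t : ℝ => EuclideanSpace.single j (σ * t)) =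
        fun t : ℝ => t • EuclideanSpace.single j σ := by
      ext t i
      simp [mul_comm]
    rw [h2]
    exact continuous_id.smul continuous_const
  have h3 := this.tendsto 0
  simp only [mul_zero] at h3
  have h4 : (EuclideanSpace.single j (0 : ℝ)) = 0 := by ext i; simp
  rw [h4, add_zero] at h3
  exact h3.mono_left nhdsWithin_le_nhds

variable {Q : EuclideanSpace ℝ (Fin n) → Measure Ω} {s : EuclideanSpace ℝ (Fin n) → Ω → ℝ}
  {ψ : Fin n → Ω → ℝ} {η₀ : EuclideanSpace ℝ (Fin n)}

namespace IsSmoothPath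

variable (p : IsSmoothPath μ Q s ψ η₀)
include p

theorem root₀ : IsRootDensity μ (Q η₀) (s η₀) := p.root.self_of_nhds

theorem memLp_remainder {η : EuclideanSpace ℝ (Fin n)} (h : IsRootDensity μ (Q η) (s η)) :
    MemLp (fun ω => s η ω - s η₀ ω - ∑ j, (η j - η₀ j) * ψ j ω) 2 μ :=
  (h.memLp.sub p.root₀.memLp).sub (memLp_finsetSum _ fun j _ => (p.memLp j).const_mul _)

theorem isLittleO_remainder :
    (fun η => l2 μ (fun ω => s η ω - s η₀ ω - ∑ j, (η j - η₀ j) * ψ j ω)) =o[𝓝 η₀]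
      fun η => η - η₀ := by
  have h := (Real.continuous_sqrt.tendsto 0).comp p.diff
  rw [Real.sqrt_zero] at h
  have h0 : l2 μ (fun ω => s η₀ ω - s η₀ ω - ∑ j, (η₀ j - η₀ j) * ψ j ω) = 0 := by simp [l2]
  rw [← Asymptotics.isLittleO_norm_right]
  have h1 : (fun η => l2 μ (fun ω => s η ω - s η₀ ω - ∑ j, (η j - η₀ j) * ψ j ω)) =o[𝓝[≠] η₀]
      fun η => ‖η - η₀‖ := by
    rw [Asymptotics.isLittleO_iff_tendsto']
    · refine h.congr fun η => ?_
      simp only [Function.comp, l2]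
      rw [Real.sqrt_div' _ (sq_nonneg _), Real.sqrt_sq (norm_nonneg _)]
    · filter_upwards [self_mem_nhdsWithin] with η hη h'
      exact absurd (sub_eq_zero.1 (norm_eq_zero.1 h')) hη
  have h2 := h1.insert (x := η₀) h0
  have h3 : insert η₀ ({η₀}ᶜ : Set (EuclideanSpace ℝ (Fin n))) = Set.univ := by
    ext x
    simpa using eq_or_ne x η₀
  rwa [h3, nhdsWithin_univ] at h2

theorem abs_sub_apply_le (η : EuclideanSpace ℝ (Fin n)) (j : Fin n) : |η j - η₀ j| ≤ ‖η - η₀‖ := by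
  have := PiLp.norm_apply_le (η - η₀) j
  simpa using this

theorem l2_restrict_sub_le {η : EuclideanSpace ℝ (Fin n)} (h : IsRootDensity μ (Q η) (s η))
    (B : Set Ω) : l2 (μ.restrict B) (fun ω => s η ω - s η₀ ω) ≤
      l2 μ (fun ω => s η ω - s η₀ ω - ∑ j, (η j - η₀ j) * ψ j ω) +
        ‖η - η₀‖ * ∑ j, l2 (μ.restrict B) (ψ j) := by
  have m1 := (p.memLp_remainder h)
  have m2 : ∀ j, MemLp (fun ω => (η j - η₀ j) * ψ j ω) 2 (μ.restrict B) := fun j =>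
    ((p.memLp j).const_mul _).restrict B
  have h1 := l2_add_le (m1.restrict B) (memLp_finsetSum Finset.univ fun j _ => m2 j)
  simp only [sub_add_cancel] at h1
  refine h1.trans (add_le_add (l2_restrict_le m1 B) ((l2_sum_le _ m2).trans ?_))
  rw [Finset.mul_sum]
  refine Finset.sum_le_sum fun j _ => ?_
  rw [l2_const_mul]
  exact mul_le_mul_of_nonneg_right (abs_sub_apply_le p η j) (l2_nonneg _)

theorem isBigO_l2_sub : (fun η => l2 μ (fun ω => s η ω - s η₀ ω)) =O[𝓝 η₀] fun η => η - η₀ := by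
  have h1 : (fun η => l2 μ (fun ω => s η ω - s η₀ ω - ∑ j, (η j - η₀ j) * ψ j ω) +
      ‖η - η₀‖ * ∑ j, l2 (μ.restrict Set.univ) (ψ j)) =O[𝓝 η₀] fun η => η - η₀ := by
    refine p.isLittleO_remainder.isBigO.add ?_
    have := (Asymptotics.isBigO_refl (fun η => ‖η - η₀‖) (𝓝 η₀)).mul
      (Asymptotics.isBigO_refl (fun _ => ∑ j, l2 (μ.restrict Set.univ) (ψ j)) (𝓝 η₀))
    refine Asymptotics.IsBigO.of_bound (∑ j, l2 (μ.restrict Set.univ) (ψ j))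
      (Eventually.of_forall fun η => ?_)
    rw [norm_mul, norm_norm, Real.norm_eq_abs,
      abs_of_nonneg (Finset.sum_nonneg fun j _ => l2_nonneg _), mul_comm]
  refine (Asymptotics.IsBigO.of_bound 1 ?_).trans h1
  filter_upwards [p.root] with η hη
  have := p.l2_restrict_sub_le hη Set.univ
  rw [Measure.restrict_univ] at this
  rw [one_mul, Real.norm_eq_abs, Real.norm_eq_abs, abs_of_nonneg (l2_nonneg _),
    Measure.restrict_univ]
  exact this.trans (le_abs_self _)

theorem tendsto_l2_sub : Tendsto (fun η => l2 μ (fun ω => s η ω - s η₀ ω)) (𝓝 η₀) (𝓝 0) := by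
  refine p.isBigO_l2_sub.trans_tendsto ?_
  have : Tendsto (fun η : EuclideanSpace ℝ (Fin n) => η - η₀) (𝓝 η₀) (𝓝 (η₀ - η₀)) :=
    (continuous_id.sub continuous_const).tendsto _
  rwa [sub_self] at this

/-- One-sided directional remainder. -/
theorem tendsto_direction (j : Fin n) {σ : ℝ} (hσ : σ ≠ 0) :
    Tendsto (fun t : ℝ => (∫ ω, (s (η₀ + EuclideanSpace.single j (σ * t)) ω - s η₀ ω -
      (σ * t) * ψ j ω) ^ 2 ∂μ) / (σ * t) ^ 2) (𝓝[>] 0) (𝓝 0) := by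
  have h1 : Tendsto (fun t : ℝ => η₀ + EuclideanSpace.single j (σ * t)) (𝓝[>] 0) (𝓝[≠] η₀) := by
    refine tendsto_nhdsWithin_iff.2 ⟨?_, ?_⟩
    · exact tendsto_add_single η₀ j σ
    · filter_upwards [self_mem_nhdsWithin] with t ht h'
      have := congrArg (fun u : EuclideanSpace ℝ (Fin n) => u j) h'
      simp at this
      exact this.elim hσ (ne_of_gt ht)
  refine (p.diff.comp h1).congr fun t => ?_
  simp only [Function.comp, add_sub_cancel_left, PiLp.add_apply, PiLp.norm_single,
    Real.norm_eq_abs, sq_abs]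
  congr 2
  ext ω
  congr 2
  rw [Finset.sum_eq_single j]
  · simp
  · intro i _ hi
    simp [hi]
  · simp

/-- The derivative of the root density vanishes where the density vanishes. -/
theorem ae_eq_zero (j : Fin n) : ∀ᵐ ω ∂μ, s η₀ ω = 0 → ψ j ω = 0 := by
  have h0 := p.root₀
  -- A root density is non-negative, so at its zeros it is minimal along the path and its derivative
  -- in either direction is non-negative. Quantitatively, where `s η₀ = 0` and `σ ψ < 0` the
  -- remainder of the expansion is at least `t |σ ψ|`, which mean-square differentiability forbids
  -- on a set of positive measure.
  have key : ∀ σ : ℝ, σ ≠ 0 → ∀ᵐ ω ∂μ, s η₀ ω = 0 → 0 ≤ σ * ψ j ω := by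
    intro σ hσ
    set f : Ω → ℝ := fun ω => {ω | s η₀ ω = 0}.indicator (fun ω => min (σ * ψ j ω) 0) ω with hf
    have mZ : MeasurableSet {ω | s η₀ ω = 0} := h0.measurable (measurableSet_singleton 0)
    have hψm := (p.memLp j).aestronglyMeasurable.aemeasurable
    have hfm : MemLp f 2 μ := by
      refine ((p.memLp j).const_mul σ).mono ?_ (ae_of_all _ fun ω => ?_)
      · refine AEStronglyMeasurable.indicator ?_ mZ
        exact AEMeasurable.aestronglyMeasurable (by fun_prop)
      · refine (abs_indicator_le_abs_self _ _ _).trans ?_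
        rcases le_total (σ * ψ j ω) 0 with h | h
        · rw [min_eq_left h]; rfl
        · rw [min_eq_right h]; simpa using norm_nonneg (σ * ψ j ω)
    have hr : ∀ᶠ t : ℝ in 𝓝[>] 0, IsRootDensity μ (Q (η₀ + EuclideanSpace.single j (σ * t)))
        (s (η₀ + EuclideanSpace.single j (σ * t))) :=
      (tendsto_add_single η₀ j σ).eventually p.root
    have hle : ∀ᶠ t : ℝ in 𝓝[>] 0, ∫ ω, f ω ^ 2 ∂μ ≤ σ ^ 2 *
        ((∫ ω, (s (η₀ + EuclideanSpace.single j (σ * t)) ω - s η₀ ω - (σ * t) * ψ j ω) ^ 2 ∂μ) /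
          (σ * t) ^ 2) := by
      filter_upwards [self_mem_nhdsWithin, hr] with t ht hrt
      have ht' : (0 : ℝ) < t := ht
      have mrem : MemLp (fun ω => s (η₀ + EuclideanSpace.single j (σ * t)) ω - s η₀ ω -
          (σ * t) * ψ j ω) 2 μ := (hrt.memLp.sub h0.memLp).sub ((p.memLp j).const_mul _)
      have hdiv : ∀ I : ℝ, σ ^ 2 * (I / (σ * t) ^ 2) = I / t ^ 2 := fun I => by field_simp
      rw [hdiv, le_div_iff₀ (by positivity), ← integral_mul_const]
      refine integral_mono (hfm.integrable_sq.mul_const _) mrem.integrable_sq fun ω => ?_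
      by_cases hω : s η₀ ω = 0
      · have hω' : ω ∈ {ω | s η₀ ω = 0} := hω
        simp only [hf, Set.indicator_of_mem hω', hω, sub_zero]
        have hs := hrt.nonneg ω
        rcases le_total (σ * ψ j ω) 0 with h | h
        · rw [min_eq_left h, ← mul_pow]
          refine sq_le_sq.2 ?_
          rw [abs_of_nonpos (mul_nonpos_of_nonpos_of_nonneg h ht'.le), abs_of_nonneg (by nlinarith)]
          nlinarith
        · rw [min_eq_right h]
          nlinarith [sq_nonneg (s (η₀ + EuclideanSpace.single j (σ * t)) ω - σ * t * ψ j ω)]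
      · have hω' : ω ∉ {ω | s η₀ ω = 0} := hω
        simp only [hf, Set.indicator_of_notMem hω']
        nlinarith [sq_nonneg (s (η₀ + EuclideanSpace.single j (σ * t)) ω - s η₀ ω -
          σ * t * ψ j ω)]
    have hlim := (p.tendsto_direction j hσ).const_mul (σ ^ 2)
    rw [mul_zero] at hlim
    have h00 := ge_of_tendsto hlim hle
    have h000 := le_antisymm h00 (integral_nonneg fun _ => sq_nonneg _)
    have := (integral_eq_zero_iff_of_nonneg (fun _ => sq_nonneg _) hfm.integrable_sq).1 h000
    filter_upwards [this] with ω hω hs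
    have hω' : ω ∈ {ω | s η₀ ω = 0} := hs
    simp only [hf, Set.indicator_of_mem hω', Pi.zero_apply] at hω
    have h5 := pow_eq_zero_iff (two_ne_zero) |>.1 hω
    exact min_eq_right_iff.1 h5
  filter_upwards [key 1 one_ne_zero, key (-1) (by norm_num)] with ω h1 h2 hs
  have := h1 hs
  have := h2 hs
  linarith

/-- `ψ j` vanishes where the density does, so the measure with density `(ψ j)²` is absolutely
continuous with respect to the law at `η₀`. Clipping makes this quantitative: on `B η` the clipped
part has norm at most `N` times the root of the mass of `B η`. -/
theorem tendsto_l2_restrict {B : EuclideanSpace ℝ (Fin n) → Set Ω}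
    (hB : ∀ᶠ η in 𝓝 η₀, MeasurableSet (B η))
    (h : Tendsto (fun η => (Q η₀).real (B η)) (𝓝 η₀) (𝓝 0)) (j : Fin n) :
    Tendsto (fun η => l2 (μ.restrict (B η)) (ψ j)) (𝓝 η₀) (𝓝 0) := by
  have h0 := p.root₀
  refine tendsto_order.2 ⟨fun b hb => Eventually.of_forall fun η => hb.trans_le (l2_nonneg _),
    fun b hb => ?_⟩
  obtain ⟨N, hN, hlt⟩ := exists_l2_sub_clip_lt (p.memLp j) h0.measurable h0.nonneg
    (p.ae_eq_zero j) (half_pos hb)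
  have h1 := ((Real.continuous_sqrt.tendsto 0).comp h).const_mul N
  rw [Real.sqrt_zero, mul_zero] at h1
  filter_upwards [hB, h1.eventually (gt_mem_nhds (half_pos hb))] with η hη hsm
  have m1 := memLp_clip (p.memLp j) h0.measurable hN h0.nonneg
  have m2 : MemLp (clip N (s η₀) (ψ j)) 2 μ := by
    have := (p.memLp j).sub m1
    refine this.ae_eq (ae_of_all _ fun ω => ?_)
    simp
  have h2 := l2_add_le (m1.restrict (B η)) (m2.restrict (B η))
  simp only [sub_add_cancel] at h2
  have h3 : l2 (μ.restrict (B η)) (clip N (s η₀) (ψ j)) ≤ N * √((Q η₀).real (B η)) := by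
    rw [h0.sqrt_real_eq hη, ← abs_of_nonneg hN, ← l2_const_mul, abs_of_nonneg hN]
    refine l2_mono ((h0.memLp.const_mul N).restrict _) (ae_of_all _ fun ω => ?_)
    exact (abs_clip_le hN h0.nonneg _ ω).trans (le_abs_self _)
  have h4 := l2_restrict_le m1 (B η)
  simp only [Function.comp] at hsm
  calc l2 (μ.restrict (B η)) (ψ j) ≤ _ := h2
    _ < b := by linarith

/-- The linear term of the expansion is restricted to sets of vanishing mass and the remainder is
small anyway. This is what makes the bad sets of covariate values negligible. -/
theorem isLittleO_l2_restrict {B : EuclideanSpace ℝ (Fin n) → Set Ω}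
    (hB : ∀ᶠ η in 𝓝 η₀, MeasurableSet (B η))
    (h : Tendsto (fun η => (Q η₀).real (B η)) (𝓝 η₀) (𝓝 0)) :
    (fun η => l2 (μ.restrict (B η)) (fun ω => s η ω - s η₀ ω)) =o[𝓝 η₀] fun η => η - η₀ := by
  have h1 : Tendsto (fun η => ∑ j, l2 (μ.restrict (B η)) (ψ j)) (𝓝 η₀) (𝓝 0) := by
    have := tendsto_finsetSum Finset.univ fun j _ => p.tendsto_l2_restrict hB h j
    simpa using this
  have h2 : (fun η => ‖η - η₀‖ * ∑ j, l2 (μ.restrict (B η)) (ψ j)) =o[𝓝 η₀] fun η => η - η₀ := by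
    have := (Asymptotics.isBigO_refl (fun η => ‖η - η₀‖) (𝓝 η₀)).mul_isLittleO
      ((Asymptotics.isLittleO_one_iff ℝ).2 h1)
    simp only [mul_one] at this
    exact Asymptotics.isLittleO_norm_right.1 this
  refine (Asymptotics.IsBigO.of_bound 1 ?_).trans_isLittleO (p.isLittleO_remainder.add h2)
  filter_upwards [p.root] with η hη
  rw [one_mul, Real.norm_eq_abs, Real.norm_eq_abs, abs_of_nonneg (l2_nonneg _)]
  exact (p.l2_restrict_sub_le hη (B η)).trans (le_abs_self _)

/-- Differentiability of `∫ Hη dQη - ∫ Hη dQ₀` for functions `Hη` close to `T`. -/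
theorem isLittleO_integral_sub {H : EuclideanSpace ℝ (Fin n) → Ω → ℝ} {T : Ω → ℝ} {C : ℝ}
    (hH : ∀ᶠ η in 𝓝 η₀, Measurable (H η) ∧ (MemLp (H η) 2 (Q η₀) ∧ l2 (Q η₀) (H η) ≤ C) ∧
      (MemLp (H η) 2 (Q η) ∧ l2 (Q η) (H η) ≤ C))
    (hTm : Measurable T) (hT : MemLp T 2 (Q η₀))
    (hlim : Tendsto (fun η => ∫ ω, |H η ω - T ω| ∂(Q η₀)) (𝓝 η₀) (𝓝 0)) :
    (fun η => ∫ ω, H η ω ∂(Q η) - ∫ ω, H η ω ∂(Q η₀) -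
      ∑ j, (η j - η₀ j) * (2 * ∫ ω, T ω * s η₀ ω * ψ j ω ∂μ)) =o[𝓝 η₀] fun η => η - η₀ := by
  have h0 := p.root₀
  have := h0.prob
  have mT := (h0.memLp_iff hTm).1 hT
  set W : EuclideanSpace ℝ (Fin n) → Ω → ℝ := fun η ω => H η ω * s η₀ ω + H η ω * s η ω with hW
  -- The increment is `∫ (s η - s η₀) W η dμ`, and `W η` should be replaced by `2 T (s η₀)`. The
  -- error `K η` need not tend to zero in L²; it is bounded there and tends to zero in L¹ with
  -- weight `s η₀`, which suffices for its pairing with `ψ j`.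
  set K : EuclideanSpace ℝ (Fin n) → Ω → ℝ := fun η ω => W η ω - 2 * (T ω * s η₀ ω) with hK
  have mW : ∀ᶠ η in 𝓝 η₀, MemLp (W η) 2 μ ∧ l2 μ (W η) ≤ 2 * C := by
    filter_upwards [hH, p.root] with η hη hr
    have m0 := (h0.memLp_iff hη.1).1 hη.2.1.1
    have m1 := (hr.memLp_iff hη.1).1 hη.2.2.1
    refine ⟨m0.add m1, (l2_add_le m0 m1).trans ?_⟩
    have b0 := hη.2.1.2
    have b1 := hη.2.2.2
    rw [h0.l2_eq] at b0
    rw [hr.l2_eq] at b1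
    linarith
  set C' : ℝ := 2 * C + 2 * l2 (Q η₀) T with hC'
  have mK : ∀ᶠ η in 𝓝 η₀, MemLp (K η) 2 μ ∧ l2 μ (K η) ≤ C' := by
    filter_upwards [mW] with η hη
    refine ⟨hη.1.sub (mT.const_mul 2), ?_⟩
    have := l2_add_le hη.1 (mT.const_mul (-2))
    rw [l2_const_mul, ← h0.l2_eq] at this
    have e : K η = fun ω => W η ω + -2 * (T ω * s η₀ ω) := by ext ω; simp only [hK]; ring
    rw [e]
    simp only [abs_neg, abs_two] at this
    linarith [hη.2]
  -- `s η₀ K η = 2 (H η - T) (s η₀)² + H η (s η₀) (s η - s η₀)`: the first term is the assumed L¹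
  -- distance, and the second is handled by Cauchy–Schwarz.
  have hsK : Tendsto (fun η => ∫ ω, s η₀ ω * |K η ω| ∂μ) (𝓝 η₀) (𝓝 0) := by
    have hb : Tendsto (fun η => 2 * (∫ ω, |H η ω - T ω| ∂(Q η₀)) +
        C * l2 μ (fun ω => s η ω - s η₀ ω)) (𝓝 η₀) (𝓝 0) := by
      have := (hlim.const_mul 2).add (p.tendsto_l2_sub.const_mul C)
      simpa using this
    refine squeeze_zero' (Eventually.of_forall fun η => integral_nonneg fun ω =>
      mul_nonneg (h0.nonneg _) (abs_nonneg _)) ?_ hb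
    filter_upwards [hH, p.root] with η hη hr
    have m0 := (h0.memLp_iff hη.1).1 hη.2.1.1
    have b0 := hη.2.1.2
    rw [h0.l2_eq] at b0
    have mΔ : MemLp (fun ω => s η ω - s η₀ ω) 2 μ := hr.memLp.sub h0.memLp
    have i1 : Integrable (fun ω => |H η ω - T ω| * s η₀ ω ^ 2) μ :=
      h0.integrable_iff.1 ((hη.2.1.1.sub hT).integrable one_le_two).abs
    have i2 : Integrable (fun ω => |H η ω * s η₀ ω| * |s η ω - s η₀ ω|) μ :=
      m0.abs.integrable_mul mΔ.abs
    have b1 := integral_abs_mul_le_l2 m0 mΔ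
    calc ∫ ω, s η₀ ω * |K η ω| ∂μ ≤ ∫ ω, (2 * (|H η ω - T ω| * s η₀ ω ^ 2) +
          |H η ω * s η₀ ω| * |s η ω - s η₀ ω|) ∂μ := by
          refine integral_mono_of_nonneg (ae_of_all _ fun ω =>
            mul_nonneg (h0.nonneg _) (abs_nonneg _)) ((i1.const_mul 2).add i2)
            (ae_of_all _ fun ω => ?_)
          have hs := h0.nonneg ω
          have e : K η ω = 2 * ((H η ω - T ω) * s η₀ ω) + H η ω * (s η ω - s η₀ ω) := by
            simp only [hK, hW]; ring
          have e2 : |K η ω| ≤ 2 * (|H η ω - T ω| * s η₀ ω) + |H η ω| * |s η ω - s η₀ ω| := by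
            rw [e]
            refine (abs_add_le _ _).trans_eq ?_
            rw [abs_mul, abs_mul, abs_mul, abs_two, abs_of_nonneg hs]
          have e3 := mul_le_mul_of_nonneg_left e2 hs
          refine e3.trans_eq ?_
          simp only [abs_mul, abs_of_nonneg hs]
          ring
      _ = 2 * (∫ ω, |H η ω - T ω| ∂(Q η₀)) + ∫ ω, |H η ω * s η₀ ω| * |s η ω - s η₀ ω| ∂μ := by
          rw [integral_add (i1.const_mul 2) i2, integral_const_mul, h0.integral_eq]
      _ ≤ _ := by
          gcongr
          exact b1.trans (mul_le_mul_of_nonneg_right b0 (l2_nonneg _))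
  -- Split `ψ j` into a part of small L² norm, paired with the bounded `K η`, and a part bounded by
  -- `N (s η₀)`, paired by means of `hsK`.
  have hψK : ∀ j, Tendsto (fun η => ∫ ω, ψ j ω * K η ω ∂μ) (𝓝 η₀) (𝓝 0) := by
    intro j
    rw [tendsto_zero_iff_abs_tendsto_zero]
    refine tendsto_order.2 ⟨fun b hb => Eventually.of_forall fun η => hb.trans_le (abs_nonneg _),
      fun b hb => ?_⟩
    obtain ⟨N, hN, hlt⟩ := exists_l2_sub_clip_lt (p.memLp j) h0.measurable h0.nonneg
      (p.ae_eq_zero j) (ε := b / 2 / (|C'| + 1)) (by positivity)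
    have h1 := hsK.const_mul N
    rw [mul_zero] at h1
    filter_upwards [mK, h1.eventually (gt_mem_nhds (half_pos hb))] with η hη hsm
    have m1 := memLp_clip (p.memLp j) h0.measurable hN h0.nonneg
    have m2 : MemLp (clip N (s η₀) (ψ j)) 2 μ := by
      have := (p.memLp j).sub m1
      refine this.ae_eq (ae_of_all _ fun ω => ?_)
      simp
    have e : ∫ ω, ψ j ω * K η ω ∂μ = ∫ ω, (ψ j ω - clip N (s η₀) (ψ j) ω) * K η ω ∂μ +
        ∫ ω, clip N (s η₀) (ψ j) ω * K η ω ∂μ := by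
      have i1 : Integrable (fun ω => (ψ j ω - clip N (s η₀) (ψ j) ω) * K η ω) μ :=
        m1.integrable_mul hη.1
      have i2 : Integrable (fun ω => clip N (s η₀) (ψ j) ω * K η ω) μ := m2.integrable_mul hη.1
      rw [← integral_add i1 i2]
      exact integral_congr_ae (ae_of_all _ fun ω => by simp only; ring)
    have b1 := abs_integral_mul_le_l2 m1 hη.1
    have b2 : |∫ ω, clip N (s η₀) (ψ j) ω * K η ω ∂μ| ≤ N * ∫ ω, s η₀ ω * |K η ω| ∂μ := by
      rw [← integral_const_mul]
      refine abs_integral_le_integral_abs.trans (integral_mono_of_nonneg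
        (ae_of_all _ fun _ => abs_nonneg _)
        ((h0.memLp.integrable_mul hη.1.abs).const_mul N) (ae_of_all _ fun ω => ?_))
      change |clip N (s η₀) (ψ j) ω * K η ω| ≤ N * (s η₀ ω * |K η ω|)
      rw [abs_mul, ← mul_assoc]
      exact mul_le_mul_of_nonneg_right (abs_clip_le hN h0.nonneg _ ω) (abs_nonneg _)
    have b3 : l2 μ (fun ω => ψ j ω - clip N (s η₀) (ψ j) ω) * l2 μ (K η) ≤ b / 2 := by
      have h3 : l2 μ (K η) ≤ |C'| + 1 := hη.2.trans ((le_abs_self _).trans (by linarith))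
      calc _ ≤ b / 2 / (|C'| + 1) * (|C'| + 1) :=
            mul_le_mul hlt.le h3 (l2_nonneg _) (by positivity)
        _ = b / 2 := by field_simp
    simp only [Function.comp]
    rw [e]
    have := abs_add_le (∫ ω, (ψ j ω - clip N (s η₀) (ψ j) ω) * K η ω ∂μ)
      (∫ ω, clip N (s η₀) (ψ j) ω * K η ω ∂μ)
    linarith
  have f1 : (fun η => l2 μ (fun ω => s η ω - s η₀ ω - ∑ j, (η j - η₀ j) * ψ j ω) * (2 * C))
      =o[𝓝 η₀] fun η => η - η₀ := by
    refine Asymptotics.IsBigO.trans_isLittleO ?_ p.isLittleO_remainder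
    simp_rw [mul_comm _ (2 * C)]
    exact Asymptotics.isBigO_const_mul_self _ _ _
  have f2 : (fun η => ‖η - η₀‖ * ∑ j, |∫ ω, ψ j ω * K η ω ∂μ|) =o[𝓝 η₀] fun η => η - η₀ := by
    have h1 : Tendsto (fun η => ∑ j, |∫ ω, ψ j ω * K η ω ∂μ|) (𝓝 η₀) (𝓝 0) := by
      have := tendsto_finsetSum Finset.univ fun j _ => (hψK j).abs
      simpa using this
    have := (Asymptotics.isBigO_refl (fun η => ‖η - η₀‖) (𝓝 η₀)).mul_isLittleO
      ((Asymptotics.isLittleO_one_iff ℝ).2 h1)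
    simp only [mul_one] at this
    exact Asymptotics.isLittleO_norm_right.1 this
  refine (Asymptotics.IsBigO.of_bound 1 ?_).trans_isLittleO (f1.add f2)
  filter_upwards [hH, p.root, mW, mK] with η hη hr hWη hKη
  have := hr.prob
  have i0 := h0.integrable_iff.1 (hη.2.1.1.integrable one_le_two)
  have i1 := hr.integrable_iff.1 (hη.2.2.1.integrable one_le_two)
  have mrem := p.memLp_remainder hr
  have irW : Integrable (fun ω => (s η ω - s η₀ ω - ∑ j, (η j - η₀ j) * ψ j ω) * W η ω) μ :=
    mrem.integrable_mul hWη.1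
  have iψK : ∀ j, Integrable (fun ω => ψ j ω * K η ω) μ := fun j =>
    (p.memLp j).integrable_mul hKη.1
  have iψT : ∀ j, Integrable (fun ω => T ω * s η₀ ω * ψ j ω) μ := fun j =>
    mT.integrable_mul (p.memLp j)
  -- Exact error: the remainder of the root density against `W η`, plus the linear term against `K
  -- η`.
  have e : ∫ ω, H η ω ∂(Q η) - ∫ ω, H η ω ∂(Q η₀) -
      ∑ j, (η j - η₀ j) * (2 * ∫ ω, T ω * s η₀ ω * ψ j ω ∂μ) =
      ∫ ω, (s η ω - s η₀ ω - ∑ j, (η j - η₀ j) * ψ j ω) * W η ω ∂μ +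
        ∑ j, (η j - η₀ j) * ∫ ω, ψ j ω * K η ω ∂μ := by
    have iS : ∀ j, Integrable (fun ω => (η j - η₀ j) * (ψ j ω * K η ω) +
        (η j - η₀ j) * (2 * (T ω * s η₀ ω * ψ j ω))) μ := fun j =>
      ((iψK j).const_mul _).add (((iψT j).const_mul 2).const_mul _)
    rw [sub_eq_iff_eq_add, add_assoc, ← Finset.sum_add_distrib]
    simp_rw [← integral_const_mul]
    have e2 : ∀ j, ∫ ω, (η j - η₀ j) * (ψ j ω * K η ω) ∂μ +
        ∫ ω, (η j - η₀ j) * (2 * (T ω * s η₀ ω * ψ j ω)) ∂μ =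
        ∫ ω, ((η j - η₀ j) * (ψ j ω * K η ω) +
          (η j - η₀ j) * (2 * (T ω * s η₀ ω * ψ j ω))) ∂μ := fun j =>
      (integral_add ((iψK j).const_mul _) (((iψT j).const_mul 2).const_mul _)).symm
    simp_rw [e2]
    rw [← integral_finsetSum _ fun j _ => iS j,
      ← integral_add irW (integrable_finsetSum _ fun j _ => iS j), hr.integral_eq, h0.integral_eq,
      ← integral_sub i1 i0]
    refine integral_congr_ae (ae_of_all _ fun ω => ?_)
    simp only
    have e3 : ∑ j, ((η j - η₀ j) * (ψ j ω * K η ω) +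
        (η j - η₀ j) * (2 * (T ω * s η₀ ω * ψ j ω))) = (∑ j, (η j - η₀ j) * ψ j ω) * W η ω := by
      rw [Finset.sum_mul]
      exact Finset.sum_congr rfl fun j _ => by simp only [hK]; ring
    rw [e3]
    simp only [hW]
    ring
  rw [e, one_mul, Real.norm_eq_abs, Real.norm_eq_abs]
  refine le_trans ?_ (le_abs_self _)
  refine (abs_add_le _ _).trans (add_le_add ?_ ?_)
  · exact (abs_integral_mul_le_l2 mrem hWη.1).trans
      (mul_le_mul_of_nonneg_left hWη.2 (l2_nonneg _))
  · rw [Finset.mul_sum]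
    refine (Finset.abs_sum_le_sum_abs _ _).trans (Finset.sum_le_sum fun j _ => ?_)
    rw [abs_mul]
    exact mul_le_mul_of_nonneg_right (abs_sub_apply_le p η j) (abs_nonneg _)

end IsSmoothPath

end SmoothPath

/-! ### Differentiability of the sum of the regressions along a smooth path. -/

section Gradient

variable {Ω : Type*} [MeasurableSpace Ω] {μ : Measure Ω}
variable {ι 𝒳 : Type*} [Fintype ι] [MeasurableSpace ι] [MeasurableSingletonClass ι]
  [MeasurableSpace 𝒳] {A : Ω → ι} {X : Ω → 𝒳} {U : Ω → ℝ}

/-- The estimates for pairs of laws are applied to the pair `(Q, Q)`; the set where overlap holds is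
then good, and it has full measure. -/
theorem IsRegression.memLp_ipw {Q : Measure Ω} [IsProbabilityMeasure Q] {e G V : ι → 𝒳 → ℝ}
    (r : IsRegression Q A X U e G V) {c : ℝ} (hc : 0 < c) (he : ∀ a, ∀ᵐ ω ∂Q, c < e a (X ω)) :
    MemLp (ipw A X U e G) 2 Q := by
  have hX := r.measurable_X
  have me := r.measurable_e
  set S : Set 𝒳 := {x | ∀ a, c < e a x} with hSdef
  have hS : MeasurableSet S := by
    rw [hSdef, Set.ofPred_forall]
    exact MeasurableSet.iInter fun a => measurableSet_lt measurable_const (me a)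
  have g : IsGoodSet Q Q X e G V G V c S := by
    refine ⟨hS, fun x hx => hx, fun x _ a => ?_, ?_⟩
    · have := r.V_nonneg a x
      simp only [sub_self]
      nlinarith
    · refine Measure.restrict_le_self.trans (Measure.le_iff.2 fun t _ => ?_)
      rw [Measure.smul_apply, smul_eq_mul]
      exact le_mul_of_one_le_left' (by norm_num)
  set K := ∑ a, ∫ ω, V a (X ω) ∂Q with hK
  have hV : ∀ a, ∫ ω, V a (X ω) ∂Q ≤ K := fun a =>
    Finset.single_le_sum (f := fun a => ∫ ω, V a (X ω) ∂Q)
      (fun a _ => integral_nonneg fun ω => r.V_nonneg a _) (Finset.mem_univ a)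
  obtain ⟨m, -⟩ := g.memLp_indicator_ipw r r hc (fun a => g.memLp_residual₁ r r hV hV a)
    ⟨r.memLp_sum.indicator (hX hS), le_rfl⟩
  refine m.ae_eq ?_
  filter_upwards [ae_all_iff.2 he] with ω hω
  exact Set.indicator_of_mem (show ω ∈ X ⁻¹' S from hω) _

variable {n : ℕ} {Q : EuclideanSpace ℝ (Fin n) → Measure Ω}
  {s : EuclideanSpace ℝ (Fin n) → Ω → ℝ} {ψ : Fin n → Ω → ℝ} {η₀ : EuclideanSpace ℝ (Fin n)}

theorem IsRootDensity.abs_setIntegral_le {Q : Measure Ω} {s : Ω → ℝ} (h : IsRootDensity μ Q s)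
    {f : Ω → ℝ} (hf : MemLp f 2 Q) {B : Set Ω} (hB : MeasurableSet B) :
    |∫ ω in B, f ω ∂Q| ≤ l2 Q f * √(Q.real B) := by
  have := h.prob
  have m1 : MemLp (B.indicator (1 : Ω → ℝ)) 2 Q := (memLp_const (1 : ℝ)).indicator hB
  have h1 := abs_integral_mul_le_l2 hf m1
  have e1 : ∫ ω, f ω * B.indicator 1 ω ∂Q = ∫ ω in B, f ω ∂Q := by
    rw [← integral_indicator hB]
    congr 1
    ext ω
    by_cases hω : ω ∈ B <;> simp [hω]
  have e2 : l2 Q (B.indicator 1) = √(Q.real B) := by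
    rw [l2, ← integral_indicator_one hB]
    congr 2
    ext ω
    by_cases hω : ω ∈ B <;> simp [hω]
  rwa [e1, e2] at h1

/-- Differentiability of `∑ₐ E{G(a, X)}` along a smooth path of laws, in the direction of the
inverse-probability weighted score. -/
theorem IsSmoothPath.isLittleO_sum_regression (p : IsSmoothPath μ Q s ψ η₀)
    {e G V : EuclideanSpace ℝ (Fin n) → ι → 𝒳 → ℝ}
    (r : ∀ᶠ η in 𝓝 η₀, IsRegression (Q η) A X U (e η) (G η) (V η)) {c : ℝ} (hc : 0 < c)
    (he : ∀ a, ∀ᵐ ω ∂(Q η₀), c < e η₀ a (X ω)) {C : ℝ}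
    (hV : ∀ᶠ η in 𝓝 η₀, ∀ a, ∫ ω, V η a (X ω) ∂(Q η) ≤ C)
    (hG : ∀ᶠ η in 𝓝 η₀, ∫ ω, (∑ a, G η a (X ω)) ^ 2 ∂(Q η) ≤ C) :
    (fun η => ∫ ω, ∑ a, G η a (X ω) ∂(Q η) - ∫ ω, ∑ a, G η₀ a (X ω) ∂(Q η₀) -
      ∑ j, (η j - η₀ j) * (2 * ∫ ω, ipw A X U (e η₀) (G η₀) ω * s η₀ ω * ψ j ω ∂μ))
      =o[𝓝 η₀] fun η => η - η₀ := by
  have h0 := p.root₀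
  have r0 := r.self_of_nhds
  have hV0 := hV.self_of_nhds
  have := h0.prob
  have hX := r0.measurable_X
  set K : ℝ := 4 + Fintype.card ι * (25 / 4 / c) with hK
  have hK0 : 0 ≤ K := by positivity
  have hex : ∀ᶠ η in 𝓝 η₀, ∃ S, IsGoodSet (Q η₀) (Q η) X (e η₀) (G η₀) (V η₀) (G η) (V η) c S ∧
      (Q η₀).real (X ⁻¹' Sᶜ) ≤ K *
        l2 (μ.restrict (X ⁻¹' Sᶜ)) (fun ω => s η ω - s η₀ ω) ^ 2 := by
    filter_upwards [p.root, r] with η h1 r1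
    exact exists_isGoodSet h0 h1 r0 r1 hc he
  -- The good set depends on `η`, with no relation between different `η`. None is needed, since only
  -- the mass of the complements enters.
  obtain ⟨S, hS⟩ := hex.choice
  set B : EuclideanSpace ℝ (Fin n) → Set Ω := fun η => X ⁻¹' (S η)ᶜ with hB
  have mB : ∀ᶠ η in 𝓝 η₀, MeasurableSet (B η) := hS.mono fun η h => hX h.1.measurableSet.compl
  have hQB : Tendsto (fun η => (Q η₀).real (B η)) (𝓝 η₀) (𝓝 0) := by
    have h1 : Tendsto (fun η => K * l2 μ (fun ω => s η ω - s η₀ ω) ^ 2) (𝓝 η₀) (𝓝 0) := by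
      have := (p.tendsto_l2_sub.pow 2).const_mul K
      simpa using this
    refine squeeze_zero' (Eventually.of_forall fun η => measureReal_nonneg) ?_ h1
    filter_upwards [hS, p.root] with η h hr
    refine h.2.trans (mul_le_mul_of_nonneg_left ?_ hK0)
    exact pow_le_pow_left₀ (l2_nonneg _) (l2_restrict_le (hr.memLp.sub h0.memLp) _) 2
  -- The gain from localization: the crude bound by the full distance shows that the bad sets have
  -- vanishing mass, hence the distance restricted to them is `o(η - η₀)`, and inserting this in the
  -- localized bound makes the root of their mass `o(η - η₀)` as well.
  have hδ := p.isLittleO_l2_restrict mB hQB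
  set T := ipw A X U (e η₀) (G η₀) with hT
  have mT : MemLp T 2 (Q η₀) := r0.memLp_ipw hc he
  have hTm : Measurable T := r0.measurable_ipw r0.measurable_e
  -- The hybrid score: propensity at `η₀`, regression at `η`, restricted to the good set of `η`.
  set H : EuclideanSpace ℝ (Fin n) → Ω → ℝ := fun η =>
    (X ⁻¹' (S η)).indicator (ipw A X U (e η₀) (G η)) with hH
  set C' : ℝ := Fintype.card ι * (c⁻¹ * (19 * √C)) + 2 * √C with hC'
  have hW : ∀ᶠ η in 𝓝 η₀,
      (MemLp ((X ⁻¹' (S η)).indicator fun ω => ∑ a, G η a (X ω)) 2 (Q η₀) ∧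
        l2 (Q η₀) ((X ⁻¹' (S η)).indicator fun ω => ∑ a, G η a (X ω)) ≤ 2 * √C) ∧
      (MemLp ((X ⁻¹' (S η)).indicator fun ω => ∑ a, G η a (X ω)) 2 (Q η) ∧
        l2 (Q η) ((X ⁻¹' (S η)).indicator fun ω => ∑ a, G η a (X ω)) ≤ 2 * √C) := by
    filter_upwards [hS, r, hG] with η h r1 hGη
    have mS := hX h.1.measurableSet
    have mG : Measurable fun x => ∑ a, G η a x :=
      Finset.measurable_sum _ fun a _ => r1.measurable_G a
    constructor
    · obtain ⟨i, hi⟩ := h.1.integral_indicator_le hX (f := fun x => (∑ a, G η a x) ^ 2)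
        (mG.pow_const 2) (fun x => sq_nonneg _) r1.memLp_sum.integrable_sq
      obtain ⟨m, hm⟩ := memLp_two_of_sq_le
        (f := (X ⁻¹' (S η)).indicator fun ω => ∑ a, G η a (X ω))
        ((mG.comp hX).indicator mS) i (ae_of_all _ fun ω => by
          by_cases hω : ω ∈ X ⁻¹' (S η) <;> simp only [Set.indicator_of_mem,
            Set.indicator_of_notMem, hω, not_false_eq_true, le_refl]
          norm_num)
      refine ⟨m, hm.trans ?_⟩
      rw [show 2 * √C = √(4 * C) by
        rw [Real.sqrt_mul (by norm_num), show (4 : ℝ) = 2 ^ 2 by norm_num,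
          Real.sqrt_sq (by norm_num)]]
      exact Real.sqrt_le_sqrt (by linarith)
    · refine ⟨r1.memLp_sum.indicator mS, (l2_mono r1.memLp_sum
        (ae_of_all _ fun ω => abs_indicator_le_abs_self _ (fun ω => ∑ a, G η a (X ω)) ω)).trans ?_⟩
      refine (Real.sqrt_le_sqrt hGη).trans ?_
      linarith [Real.sqrt_nonneg C]
  have hHb : ∀ᶠ η in 𝓝 η₀, Measurable (H η) ∧ (MemLp (H η) 2 (Q η₀) ∧ l2 (Q η₀) (H η) ≤ C') ∧
      (MemLp (H η) 2 (Q η) ∧ l2 (Q η) (H η) ≤ C') := by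
    filter_upwards [hS, r, hW, hV] with η h r1 hWη hVη
    refine ⟨(r1.measurable_ipw r0.measurable_e).indicator (hX h.1.measurableSet), ?_, ?_⟩
    · exact h.1.memLp_indicator_ipw r0 r1 hc (fun a => h.1.memLp_residual₀ r0 r1 hV0 hVη a) hWη.1
    · refine h.1.memLp_indicator_ipw r0 r1 hc (fun a => ?_) hWη.2
      obtain ⟨m, hm⟩ := h.1.memLp_residual₁ r0 r1 hV0 hVη a
      exact ⟨m, hm.trans (by linarith [Real.sqrt_nonneg C])⟩
  have hlim : Tendsto (fun η => ∫ ω, |H η ω - T ω| ∂(Q η₀)) (𝓝 η₀) (𝓝 0) := by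
    have hb : Tendsto (fun η => Fintype.card ι * ((1 + c⁻¹) * (c⁻¹ *
        (l2 μ (fun ω => s η ω - s η₀ ω) * (20 * √C)))) + l2 (Q η₀) T * √((Q η₀).real (B η)))
        (𝓝 η₀) (𝓝 0) := by
      have h1 := ((((p.tendsto_l2_sub.mul_const (20 * √C)).const_mul c⁻¹).const_mul
        (1 + c⁻¹)).const_mul (Fintype.card ι : ℝ)).add
        (((Real.continuous_sqrt.tendsto 0).comp hQB).const_mul (l2 (Q η₀) T))
      simpa using h1
    refine squeeze_zero' (Eventually.of_forall fun η => integral_nonneg fun ω => abs_nonneg _)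
      ?_ hb
    filter_upwards [hS, r, hV, p.root, hHb] with η h r1 hVη h1 hHη
    have mS := hX h.1.measurableSet
    have i1 : Integrable (fun ω => |H η ω - (X ⁻¹' (S η)).indicator T ω|) (Q η₀) :=
      ((hHη.2.1.1.sub (mT.indicator mS)).integrable one_le_two).abs
    have i2 : Integrable (fun ω => |(B η).indicator T ω|) (Q η₀) :=
      ((mT.indicator mS.compl).integrable one_le_two).abs
    have b1 := h.1.integral_abs_indicator_ipw_sub_le h0 h1 r0 r1 hV0 hVη hc
    have b2 : ∫ ω, |(B η).indicator T ω| ∂(Q η₀) ≤ l2 (Q η₀) T * √((Q η₀).real (B η)) := by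
      have := h0.abs_setIntegral_le mT.abs (B := B η) mS.compl
      have e1 : ∫ ω, |(B η).indicator T ω| ∂(Q η₀) = ∫ ω in B η, |T ω| ∂(Q η₀) := by
        rw [← integral_indicator (show MeasurableSet (B η) from mS.compl)]
        congr 1
        ext ω
        by_cases hω : ω ∈ B η <;> simp [hω]
      rw [e1]
      refine (le_abs_self _).trans (this.trans_eq ?_)
      simp only [l2, Pi.abs_apply, sq_abs]
    calc ∫ ω, |H η ω - T ω| ∂(Q η₀) ≤ ∫ ω, (|H η ω - (X ⁻¹' (S η)).indicator T ω| +
          |(B η).indicator T ω|) ∂(Q η₀) := by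
          refine integral_mono_of_nonneg (ae_of_all _ fun _ => abs_nonneg _) (i1.add i2)
            (ae_of_all _ fun ω => ?_)
          have e1 : T ω = (X ⁻¹' (S η)).indicator T ω + (B η).indicator T ω := by
            have := congrFun (Set.indicator_self_add_compl (X ⁻¹' (S η)) T) ω
            exact this.symm
          change |H η ω - T ω| ≤ _
          conv_lhs => rw [e1, ← sub_sub]
          exact abs_sub _ _
      _ = _ := integral_add i1 i2
      _ ≤ _ := add_le_add b1 b2
  have main := p.isLittleO_integral_sub hHb hTm mT hlim
  have f1 : (fun η => √C * ((√K + 1) * l2 (μ.restrict (B η)) (fun ω => s η ω - s η₀ ω)) +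
      √C * (√K * l2 (μ.restrict (B η)) (fun ω => s η ω - s η₀ ω))) =o[𝓝 η₀] fun η => η - η₀ :=
    ((hδ.const_mul_left _).const_mul_left _).add ((hδ.const_mul_left _).const_mul_left _)
  -- On the bad set, each of the two integrals is at most `√C` times the root of the mass of that
  -- set, hence of smaller order separately; no cancellation is needed.
  have f2 : (fun η => ∫ ω in B η, ∑ a, G η a (X ω) ∂(Q η) -
      ∫ ω in B η, ∑ a, G η₀ a (X ω) ∂(Q η₀)) =o[𝓝 η₀] fun η => η - η₀ := by
    refine (Asymptotics.IsBigO.of_bound 1 ?_).trans_isLittleO f1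
    filter_upwards [hS, r, hG, p.root] with η h r1 hGη h1
    have mBη : MeasurableSet (B η) := hX h.1.measurableSet.compl
    set δ := l2 (μ.restrict (B η)) (fun ω => s η ω - s η₀ ω) with hδdef
    have hδ0 : 0 ≤ δ := l2_nonneg _
    have b0 : √((Q η₀).real (B η)) ≤ √K * δ := by
      refine (Real.sqrt_le_sqrt h.2).trans_eq ?_
      rw [Real.sqrt_mul hK0, Real.sqrt_sq hδ0]
    have b1 : √((Q η).real (B η)) ≤ (√K + 1) * δ := by
      have := sqrt_real_le h0 h1 mBη
      linarith
    have c1 := h1.abs_setIntegral_le r1.memLp_sum mBη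
    have c0 := h0.abs_setIntegral_le r0.memLp_sum mBη
    have d1 : l2 (Q η) (fun ω => ∑ a, G η a (X ω)) ≤ √C := Real.sqrt_le_sqrt hGη
    have d0 : l2 (Q η₀) (fun ω => ∑ a, G η₀ a (X ω)) ≤ √C := Real.sqrt_le_sqrt hG.self_of_nhds
    rw [one_mul, Real.norm_eq_abs, Real.norm_eq_abs]
    refine le_trans ?_ (le_abs_self _)
    refine (abs_sub _ _).trans (add_le_add (c1.trans ?_) (c0.trans ?_))
    · exact mul_le_mul d1 b1 (Real.sqrt_nonneg _) (Real.sqrt_nonneg _)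
    · exact mul_le_mul d0 b0 (Real.sqrt_nonneg _) (Real.sqrt_nonneg _)
  refine (main.add f2).congr' ?_ EventuallyEq.rfl
  filter_upwards [hS, r, hV, hW, p.root] with η h r1 hVη hWη h1
  have := h1.prob
  have mS := hX h.1.measurableSet
  have eB : B η = (X ⁻¹' (S η))ᶜ := rfl
  -- The two sides of double robustness: at `η` the regression in `H η` is the true one, and at
  -- `η₀`, in `e0` below, the propensity is.
  have e1 : ∫ ω, H η ω ∂(Q η) = ∫ ω in X ⁻¹' (S η), ∑ a, G η a (X ω) ∂(Q η) :=
    h.1.integral_indicator_ipw r0 r1 hc r1 (fun a => (h.1.memLp_residual₁ r0 r1 hV0 hVη a).1)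
      hWη.2.1 (fun a => by simp) fun a x _ => by simp
  have e0 : ∫ ω, H η ω ∂(Q η₀) = ∫ ω in X ⁻¹' (S η), ∑ a, G η₀ a (X ω) ∂(Q η₀) :=
    h.1.integral_indicator_ipw r0 r1 hc r0 (fun a => (h.1.memLp_residual₀ r0 r1 hV0 hVη a).1)
      hWη.1.1 (fun a => by
        have := (h.1.memLp_sub r0 r1 hV0 hVη a).1.integrable one_le_two
        refine this.neg.congr (ae_of_all _ fun ω => ?_)
        by_cases hω : ω ∈ X ⁻¹' (S η) <;> simp [hω]) fun a x _ => rfl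
  have a1 := integral_add_compl mS (r1.memLp_sum.integrable one_le_two)
  have a0 := integral_add_compl mS (r0.memLp_sum.integrable one_le_two)
  rw [e1, e0, eB, ← a1, ← a0]
  ring

end Gradient

/-! ### Regression structure of the law of one observation -/

section Observation

variable {m d : ℕ} (Q : Measure (Obs m d)) [IsFiniteMeasure Q]

/-- The conditional law of `Y` given `(A, X)`, as a kernel. -/
def outcomeKernel : Kernel (Trt m × (Fin d → ℝ)) (Fin m → ℝ) :=
  condDistrib (fun o : Obs m d => o.1) (fun o => o.2) Q

instance : IsMarkovKernel (outcomeKernel Q) := by unfold outcomeKernel; infer_instance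

instance (a : Trt m) (x : Fin d → ℝ) : IsProbabilityMeasure (outcomeLaw Q a x) := by
  unfold outcomeLaw; infer_instance

instance : IsFiniteMeasure (covLaw Q) := by unfold covLaw; infer_instance

theorem map_snd_compProd_outcomeKernel :
    (Q.map fun o => o.2) ⊗ₘ outcomeKernel Q = Q.map fun o => (o.2, o.1) :=
  compProd_map_condDistrib (by fun_prop)

theorem lintegral_eq_lintegral_outcomeLaw {F : Obs m d → ℝ≥0∞} (hF : Measurable F) :
    ∫⁻ o, F o ∂Q = ∫⁻ o, ∫⁻ y, F (y, o.2) ∂(outcomeLaw Q o.2.1 o.2.2) ∂Q := by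
  have h1 : Measurable fun z : (Trt m × (Fin d → ℝ)) × (Fin m → ℝ) => F (z.2, z.1) := by fun_prop
  have h2 := Measure.lintegral_compProd (μ := Q.map fun o => o.2) (κ := outcomeKernel Q) h1
  rw [map_snd_compProd_outcomeKernel, lintegral_map h1 (by fun_prop),
    lintegral_map (h1.lintegral_kernel_prod_right' (κ := outcomeKernel Q)) (by fun_prop)] at h2
  exact h2

theorem integrable_swap {F : Obs m d → ℝ} (hF : Integrable F Q) :
    Integrable (fun z : (Trt m × (Fin d → ℝ)) × (Fin m → ℝ) => F (z.2, z.1))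
      ((Q.map fun o => o.2) ⊗ₘ outcomeKernel Q) := by
  rw [map_snd_compProd_outcomeKernel]
  have he : MeasurableEmbedding (fun o : Obs m d => (o.2, o.1)) :=
    MeasurableEquiv.prodComm.measurableEmbedding
  exact he.integrable_map_iff.2 hF

theorem integrable_integral_map {F : Obs m d → ℝ} (hF : Integrable F Q) :
    Integrable (fun z => ∫ y, F (y, z) ∂(outcomeKernel Q z)) (Q.map fun o => o.2) := by
  have h1 := integrable_swap Q hF
  rw [map_snd_compProd_outcomeKernel] at h1
  exact h1.integral_condDistrib_map (by fun_prop)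

theorem integrable_integral_outcomeLaw {F : Obs m d → ℝ} (hF : Integrable F Q) :
    Integrable (fun o => ∫ y, F (y, o.2) ∂(outcomeLaw Q o.2.1 o.2.2)) Q :=
  (integrable_integral_map Q hF).comp_measurable (f := fun o : Obs m d => o.2) (by fun_prop)

theorem integral_eq_integral_outcomeLaw {F : Obs m d → ℝ} (hF : Integrable F Q) :
    ∫ o, F o ∂Q = ∫ o, ∫ y, F (y, o.2) ∂(outcomeLaw Q o.2.1 o.2.2) ∂Q := by
  have h1 := integrable_swap Q hF
  have h2 := Measure.integral_compProd h1
  have he : MeasurableEmbedding (fun o : Obs m d => (o.2, o.1)) :=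
    MeasurableEquiv.prodComm.measurableEmbedding
  have h3 := (integrable_integral_map Q hF).aestronglyMeasurable
  rw [map_snd_compProd_outcomeKernel, he.integral_map, integral_map (by fun_prop) h3] at h2
  exact h2

theorem ae_integrable_outcomeLaw {F : Obs m d → ℝ} (hF : Integrable F Q) :
    ∀ᵐ o ∂Q, Integrable (fun y => F (y, o.2)) (outcomeLaw Q o.2.1 o.2.2) :=
  ae_of_ae_map (f := fun o : Obs m d => o.2) (by fun_prop)
    (Measure.integrable_compProd_iff (integrable_swap Q hF).1 |>.1 (integrable_swap Q hF)).1

/-! #### The propensity score -/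

theorem propensity_nonneg (a : Trt m) (x : Fin d → ℝ) : 0 ≤ propensity Q a x := measureReal_nonneg

theorem propensity_le_one (a : Trt m) (x : Fin d → ℝ) : propensity Q a x ≤ 1 := measureReal_le_one

theorem measurable_propensity (a : Trt m) : Measurable (propensity Q a) :=
  (Kernel.measurable_coe _ (measurableSet_singleton a)).ennreal_toReal

theorem sum_propensity (x : Fin d → ℝ) : ∑ a, propensity Q a x = 1 := by
  have := sum_measureReal_singleton (μ := condDistrib (fun o : Obs m d => o.2.1)
    (fun o => o.2.2) Q x) (Finset.univ : Finset (Trt m))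
  simp only [Finset.coe_univ, probReal_univ] at this
  exact this

theorem measurableSet_treatment (a : Trt m) :
    MeasurableSet ((fun o : Obs m d => o.2.1) ⁻¹' {a}) :=
  (by fun_prop : Measurable fun o : Obs m d => o.2.1) (measurableSet_singleton a)

/-- The law of `X` on `{A = a}` has density `e(a | ·)`. -/
theorem map_restrict_treatment (a : Trt m) :
    (Q.restrict ((fun o => o.2.1) ⁻¹' {a})).map (fun o => o.2.2) =
      (covLaw Q).withDensity fun x => ENNReal.ofReal (propensity Q a x) := by
  ext t ht
  have hX : Measurable fun o : Obs m d => o.2.2 := by fun_prop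
  rw [Measure.map_apply hX ht, Measure.restrict_apply (hX ht), withDensity_apply _ ht,
    ← setLIntegral_preimage_condDistrib (μ := Q) (Y := fun o : Obs m d => o.2.1) hX (by fun_prop)
    (measurableSet_singleton a) ht, covLaw, setLIntegral_map ht
    (measurable_propensity Q a).ennreal_ofReal hX]
  refine lintegral_congr fun o => ?_
  rw [propensity, ofReal_measureReal]

theorem setLIntegral_treatment (a : Trt m) {f : (Fin d → ℝ) → ℝ≥0∞} (hf : Measurable f) :
    ∫⁻ o in (fun o => o.2.1) ⁻¹' {a}, f o.2.2 ∂Q =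
      ∫⁻ x, ENNReal.ofReal (propensity Q a x) * f x ∂(covLaw Q) := by
  have hX : Measurable fun o : Obs m d => o.2.2 := by fun_prop
  rw [← lintegral_map hf hX, map_restrict_treatment, lintegral_withDensity_eq_lintegral_mul _
    (measurable_propensity Q a).ennreal_ofReal hf]
  rfl

theorem integral_covLaw {f : (Fin d → ℝ) → ℝ} (hf : AEStronglyMeasurable f (covLaw Q)) :
    ∫ x, f x ∂(covLaw Q) = ∫ o, f o.2.2 ∂Q :=
  integral_map (by fun_prop) hf

theorem integrable_covLaw_iff {f : (Fin d → ℝ) → ℝ} (hf : AEStronglyMeasurable f (covLaw Q)) :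
    Integrable f (covLaw Q) ↔ Integrable (fun o : Obs m d => f o.2.2) Q :=
  integrable_map_measure hf (by fun_prop)

theorem ae_covLaw_iff {p : (Fin d → ℝ) → Prop} (hp : MeasurableSet {x | p x}) :
    (∀ᵐ x ∂(covLaw Q), p x) ↔ ∀ᵐ o ∂Q, p o.2.2 :=
  ae_map_iff (by fun_prop) hp

theorem ae_of_ae_covLaw {p : (Fin d → ℝ) → Prop} (h : ∀ᵐ x ∂(covLaw Q), p x) :
    ∀ᵐ o ∂Q, p o.2.2 :=
  ae_of_ae_map (f := fun o : Obs m d => o.2.2) (by fun_prop) h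

theorem setIntegral_treatment (a : Trt m) {f : (Fin d → ℝ) → ℝ} (hf : Measurable f) :
    ∫ o in (fun o => o.2.1) ⁻¹' {a}, f o.2.2 ∂Q = ∫ o, propensity Q a o.2.2 * f o.2.2 ∂Q := by
  rw [← integral_covLaw Q (f := fun x => propensity Q a x * f x)
    ((measurable_propensity Q a).mul hf).aestronglyMeasurable,
    ← integral_map (φ := fun o : Obs m d => o.2.2) (by fun_prop) hf.aestronglyMeasurable,
    map_restrict_treatment, integral_withDensity_eq_integral_toReal_smul
    (measurable_propensity Q a).ennreal_ofReal (ae_of_all _ fun _ => ENNReal.ofReal_lt_top)]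
  simp_rw [ENNReal.toReal_ofReal (propensity_nonneg Q _ _), smul_eq_mul]

/-- Under overlap, what holds almost surely at `(A, X)` holds for every treatment at almost every
covariate value. -/
theorem ae_covLaw_of_ae {a : Trt m} (he : ∀ᵐ x ∂(covLaw Q), 0 < propensity Q a x)
    {p : Trt m → (Fin d → ℝ) → Prop} (h : ∀ᵐ z ∂(Q.map fun o => o.2), p z.1 z.2) :
    ∀ᵐ x ∂(covLaw Q), p a x := by
  have hX : Measurable fun o : Obs m d => o.2.2 := by fun_prop
  have h2 : Measurable fun o : Obs m d => o.2 := by fun_prop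
  set N := toMeasurable (Q.map fun o => o.2) {z | ¬ p z.1 z.2} with hN
  have mN : MeasurableSet N := measurableSet_toMeasurable _ _
  have h0 : (Q.map fun o => o.2) N = 0 := by rw [hN, measure_toMeasurable]; exact ae_iff.1 h
  set t : Set (Fin d → ℝ) := {x | (a, x) ∈ N} with ht
  have mt : MeasurableSet t := (by fun_prop : Measurable fun x : Fin d → ℝ => (a, x)) mN
  have h3 : ((Q.restrict ((fun o => o.2.1) ⁻¹' {a})).map (fun o => o.2.2)) t = 0 := by
    rw [Measure.map_apply hX mt, Measure.restrict_apply (hX mt)]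
    refine measure_mono_null ?_ (Measure.map_apply h2 mN ▸ h0)
    rintro o ⟨ho1, ho2⟩
    have : o.2.1 = a := ho2
    change o.2 ∈ N
    have h4 : (a, o.2.2) ∈ N := ho1
    rwa [← this] at h4
  rw [map_restrict_treatment, withDensity_apply_eq_zero
    (measurable_propensity Q a).ennreal_ofReal] at h3
  have h5 : ∀ᵐ x ∂(covLaw Q), ¬ (ENNReal.ofReal (propensity Q a x) ≠ 0 ∧ x ∈ t) := by
    rw [ae_iff]
    simp only [not_not]
    exact h3
  filter_upwards [h5, he] with x hx hex
  by_contra hp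
  refine hx ⟨by simpa using hex, subset_toMeasurable _ _ hp⟩

/-! #### The outcome regression -/

theorem measurable_integral_outcomeLaw {F : (Trt m × (Fin d → ℝ)) × (Fin m → ℝ) → ℝ}
    (hF : Measurable F) (a : Trt m) :
    Measurable fun x => ∫ y, F ((a, x), y) ∂(outcomeLaw Q a x) := by
  have h := (hF.stronglyMeasurable.integral_kernel_prod_right' (κ := outcomeKernel Q)).measurable
  exact h.comp (by fun_prop : Measurable fun x : Fin d → ℝ => (a, x))

theorem measurable_outcomeReg (a : Trt m) (j : Fin m) :
    Measurable fun x => outcomeReg Q a x j :=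
  measurable_integral_outcomeLaw Q (F := fun z => z.2 j) (by fun_prop) a

/-- Existence and finiteness of conditional means and variances. -/
structure HasMoments : Prop where
  memLp : ∀ a, ∀ᵐ x ∂(covLaw Q), ∀ j, MemLp (fun y => y j) 2 (outcomeLaw Q a x)
  integrable_reg : ∀ a j, Integrable (fun x => outcomeReg Q a x j) (covLaw Q)
  integrable_cov : ∀ a i j, Integrable (fun x => outcomeCov Q a x i j) (covLaw Q)

/-- The conditional variance of `wᵀ Y` given `A = a`, `X = x`. -/
def weightedVar (w : Trt m → (Fin d → ℝ) → Fin m → ℝ) (a : Trt m) (x : Fin d → ℝ) : ℝ :=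
  ∫ y, (w a x ⬝ᵥ y - w a x ⬝ᵥ outcomeReg Q a x) ^ 2 ∂(outcomeLaw Q a x)

variable {w : Trt m → (Fin d → ℝ) → Fin m → ℝ}

theorem weightedVar_nonneg (a : Trt m) (x : Fin d → ℝ) : 0 ≤ weightedVar Q w a x :=
  integral_nonneg fun _ => sq_nonneg _

theorem measurable_dotProduct_reg (hw : ∀ a, Measurable (w a)) (a : Trt m) :
    Measurable fun x => w a x ⬝ᵥ outcomeReg Q a x := by
  unfold dotProduct
  refine Finset.measurable_sum _ fun j _ => ?_
  have := hw a
  have := measurable_outcomeReg Q a j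
  fun_prop

theorem measurable_weightedVar (hw : ∀ a, Measurable (w a)) (a : Trt m) :
    Measurable (weightedVar Q w a) := by
  have h1 := hw a
  have h2 := measurable_dotProduct_reg Q hw a
  refine measurable_integral_outcomeLaw Q
    (F := fun z => (w a z.1.2 ⬝ᵥ z.2 - w a z.1.2 ⬝ᵥ outcomeReg Q a z.1.2) ^ 2) ?_ a
  refine Measurable.pow_const (Measurable.sub ?_ (h2.comp (by fun_prop))) 2
  unfold dotProduct
  fun_prop

variable {Q}

theorem memLp_dotProduct {ν : Measure (Fin m → ℝ)} (h : ∀ j, MemLp (fun y => y j) 2 ν)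
    (u : Fin m → ℝ) : MemLp (fun y => u ⬝ᵥ y) 2 ν := by
  unfold dotProduct
  exact memLp_finsetSum _ fun j _ => (h j).const_mul _

theorem integral_dotProduct {a : Trt m} {x : Fin d → ℝ}
    (h : ∀ j, MemLp (fun y => y j) 2 (outcomeLaw Q a x)) (u : Fin m → ℝ) :
    ∫ y, u ⬝ᵥ y ∂(outcomeLaw Q a x) = u ⬝ᵥ outcomeReg Q a x := by
  unfold dotProduct
  rw [integral_finsetSum _ fun j _ => ((h j).integrable one_le_two).const_mul _]
  simp_rw [integral_const_mul]
  rfl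

theorem memLp_dotProduct_sub {a : Trt m} {x : Fin d → ℝ}
    (h : ∀ j, MemLp (fun y => y j) 2 (outcomeLaw Q a x)) (u : Fin m → ℝ) :
    MemLp (fun y => u ⬝ᵥ y - u ⬝ᵥ outcomeReg Q a x) 2 (outcomeLaw Q a x) :=
  (memLp_dotProduct h u).sub (memLp_const _)

theorem weightedVar_eq {a : Trt m} {x : Fin d → ℝ}
    (h : ∀ j, MemLp (fun y => y j) 2 (outcomeLaw Q a x)) :
    weightedVar Q w a x = w a x ⬝ᵥ (outcomeCov Q a x *ᵥ w a x) := by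
  set g := outcomeReg Q a x with hg
  have hi : ∀ i j, Integrable (fun y : Fin m → ℝ => (y i - g i) * (y j - g j))
      (outcomeLaw Q a x) := fun i j =>
    ((h i).sub (memLp_const _)).integrable_mul ((h j).sub (memLp_const _))
  have e : ∀ y : Fin m → ℝ, (w a x ⬝ᵥ y - w a x ⬝ᵥ g) ^ 2 =
      ∑ i, ∑ j, w a x i * w a x j * ((y i - g i) * (y j - g j)) := by
    intro y
    rw [← dotProduct_sub, sq, dotProduct, Finset.sum_mul_sum]
    refine Finset.sum_congr rfl fun i _ => Finset.sum_congr rfl fun j _ => ?_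
    simp only [Pi.sub_apply]
    ring
  change ∫ y, (w a x ⬝ᵥ y - w a x ⬝ᵥ g) ^ 2 ∂(outcomeLaw Q a x) = _
  simp_rw [e]
  rw [integral_finsetSum _ fun i _ => integrable_finsetSum _ fun j _ => (hi i j).const_mul _]
  have e2 : ∀ i, ∫ y, ∑ j, w a x i * w a x j * ((y i - g i) * (y j - g j)) ∂(outcomeLaw Q a x) =
      ∑ j, w a x i * w a x j * ∫ y, (y i - g i) * (y j - g j) ∂(outcomeLaw Q a x) := fun i => by
    rw [integral_finsetSum _ fun j _ => (hi i j).const_mul _]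
    simp_rw [integral_const_mul]
  rw [Finset.sum_congr rfl fun i _ => e2 i]
  simp only [dotProduct, Matrix.mulVec, Finset.mul_sum]
  refine Finset.sum_congr rfl fun i _ => Finset.sum_congr rfl fun j _ => ?_
  simp only [outcomeCov, Matrix.of_apply, covariance]
  rw [hg]
  unfold outcomeReg
  ring

/-- By Cauchy–Schwarz, pointwise in `y`. It transfers the local bound on the trace of the
covariance, part of the regularity of a submodel, to the scalar outcome for all bounded weights. -/
theorem weightedVar_le {a : Trt m} {x : Fin d → ℝ}
    (h : ∀ j, MemLp (fun y => y j) 2 (outcomeLaw Q a x)) {B : ℝ} (hB : w a x ⬝ᵥ w a x ≤ B) :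
    weightedVar Q w a x ≤ B * (outcomeCov Q a x).trace := by
  set g := outcomeReg Q a x with hg
  have hi : ∀ j, Integrable (fun y : Fin m → ℝ => (y j - g j) ^ 2) (outcomeLaw Q a x) := fun j =>
    ((h j).sub (memLp_const _)).integrable_sq
  have e : (outcomeCov Q a x).trace = ∫ y, ∑ j, (y j - g j) ^ 2 ∂(outcomeLaw Q a x) := by
    rw [integral_finsetSum _ fun j _ => hi j]
    simp only [Matrix.trace, Matrix.diag, outcomeCov, Matrix.of_apply, covariance]
    refine Finset.sum_congr rfl fun j _ => ?_
    rw [hg]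
    unfold outcomeReg
    exact integral_congr_ae (ae_of_all _ fun y => by ring)
  rw [e, ← integral_const_mul]
  refine integral_mono (memLp_dotProduct_sub h _).integrable_sq
    ((integrable_finsetSum _ fun j _ => hi j).const_mul B) fun y => ?_
  change (w a x ⬝ᵥ y - w a x ⬝ᵥ g) ^ 2 ≤ B * ∑ j, (y j - g j) ^ 2
  rw [← dotProduct_sub]
  have h1 := Finset.sum_mul_sq_le_sq_mul_sq Finset.univ (w a x) (y - g)
  refine h1.trans (mul_le_mul_of_nonneg_right ?_ (Finset.sum_nonneg fun j _ => sq_nonneg _))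
  refine le_trans (le_of_eq ?_) hB
  exact Finset.sum_congr rfl fun j _ => sq (w a x j)

variable (Q) in
theorem measurable_outcomeCov (a : Trt m) (i j : Fin m) :
    Measurable fun x => outcomeCov Q a x i j := by
  have h1 := measurable_outcomeReg Q a i
  have h2 := measurable_outcomeReg Q a j
  refine measurable_integral_outcomeLaw Q (F := fun z =>
    (z.2 i - outcomeReg Q a z.1.2 i) * (z.2 j - outcomeReg Q a z.1.2 j)) ?_ a
  have h3 : Measurable fun z : (Trt m × (Fin d → ℝ)) × (Fin m → ℝ) => outcomeReg Q a z.1.2 i :=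
    h1.comp (by fun_prop)
  have h4 : Measurable fun z : (Trt m × (Fin d → ℝ)) × (Fin m → ℝ) => outcomeReg Q a z.1.2 j :=
    h2.comp (by fun_prop)
  fun_prop

namespace HasMoments

variable (h : HasMoments Q)
include h

theorem integrable_trace (a : Trt m) :
    Integrable (fun x => (outcomeCov Q a x).trace) (covLaw Q) := by
  unfold Matrix.trace
  exact integrable_finsetSum _ fun j _ => h.integrable_cov a j j

theorem integrable_weightedVar (hw : ∀ a, Measurable (w a)) {B : ℝ}
    (hB : ∀ a x, w a x ⬝ᵥ w a x ≤ B) (a : Trt m) :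
    Integrable (weightedVar Q w a) (covLaw Q) := by
  refine ((h.integrable_trace a).const_mul B).mono'
    (measurable_weightedVar Q hw a).aestronglyMeasurable ((h.memLp a).mono fun x hx => ?_)
  rw [Real.norm_eq_abs, abs_of_nonneg (weightedVar_nonneg Q a x)]
  exact weightedVar_le hx (hB a x)

theorem integral_weightedVar_le (hw : ∀ a, Measurable (w a)) {B C : ℝ}
    (hB : ∀ a x, w a x ⬝ᵥ w a x ≤ B) (hB0 : 0 ≤ B) (a : Trt m)
    (hC : ∫ x, (outcomeCov Q a x).trace ∂(covLaw Q) ≤ C) :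
    ∫ x, weightedVar Q w a x ∂(covLaw Q) ≤ B * C := by
  refine (integral_mono_ae (h.integrable_weightedVar hw hB a)
    ((h.integrable_trace a).const_mul B)
    ((h.memLp a).mono fun x hx => weightedVar_le hx (hB a x))).trans ?_
  rw [integral_const_mul]
  exact mul_le_mul_of_nonneg_left hC hB0

end HasMoments

theorem abs_apply_le_of_dotProduct_self_le {u : Fin m → ℝ} {B : ℝ} (h : u ⬝ᵥ u ≤ B) (j : Fin m) :
    |u j| ≤ √B := by
  refine Real.abs_le_sqrt (le_trans ?_ h)
  rw [sq]
  exact Finset.single_le_sum (f := fun j => u j * u j) (fun j _ => mul_self_nonneg _)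
    (Finset.mem_univ j)

theorem HasMoments.integrable_dotProduct_reg (h : HasMoments Q) (hw : ∀ a, Measurable (w a)) {B : ℝ}
    (hB : ∀ a x, w a x ⬝ᵥ w a x ≤ B) (a : Trt m) :
    Integrable (fun x => w a x ⬝ᵥ outcomeReg Q a x) (covLaw Q) := by
  unfold dotProduct
  refine integrable_finsetSum _ fun j _ => ?_
  refine (h.integrable_reg a j).bdd_mul (c := √B) ?_
    (ae_of_all _ fun x => abs_apply_le_of_dotProduct_self_le (hB a x) j)
  have := hw a
  exact Measurable.aestronglyMeasurable (by fun_prop)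

/-- The scalar outcome `wᵀ(A, X) Y`. -/
def weightedOutcome (w : Trt m → (Fin d → ℝ) → Fin m → ℝ) (o : Obs m d) : ℝ :=
  w o.2.1 o.2.2 ⬝ᵥ o.1

theorem measurable_weightedOutcome (hw : ∀ a, Measurable (w a)) :
    Measurable (weightedOutcome w) := by
  have h1 : Measurable fun z : Trt m × (Fin d → ℝ) => w z.1 z.2 :=
    measurable_from_prod_countable_right hw
  have h2 : Measurable fun o : Obs m d => w o.2.1 o.2.2 :=
    h1.comp (by fun_prop : Measurable fun o : Obs m d => o.2)
  unfold weightedOutcome dotProduct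
  fun_prop

theorem setLIntegral_weightedOutcome_sub_sq (h : HasMoments Q) (hw : ∀ a, Measurable (w a))
    (a : Trt m) {k : (Fin d → ℝ) → ℝ≥0∞} (hk : Measurable k) :
    ∫⁻ o in (fun o => o.2.1) ⁻¹' {a},
      ENNReal.ofReal ((weightedOutcome w o - w a o.2.2 ⬝ᵥ outcomeReg Q a o.2.2) ^ 2) *
        k o.2.2 ∂Q =
    ∫⁻ o in (fun o => o.2.1) ⁻¹' {a},
      ENNReal.ofReal (weightedVar Q w a o.2.2) * k o.2.2 ∂Q := by
  have hA := measurableSet_treatment (m := m) (d := d) a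
  have mU := measurable_weightedOutcome (m := m) (d := d) hw
  have mG : Measurable fun o : Obs m d => w a o.2.2 ⬝ᵥ outcomeReg Q a o.2.2 :=
    (measurable_dotProduct_reg Q hw a).comp (by fun_prop)
  rw [← lintegral_indicator hA, ← lintegral_indicator hA, lintegral_eq_lintegral_outcomeLaw]
  swap
  · refine Measurable.indicator ?_ hA
    fun_prop
  refine lintegral_congr_ae ?_
  filter_upwards [ae_of_ae_covLaw Q (h.memLp a)] with o ho
  by_cases hoa : o.2.1 = a
  · have h1 : ∀ y, (y, o.2) ∈ (fun o : Obs m d => o.2.1) ⁻¹' {a} := fun y => hoa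
    have h2 : o ∈ (fun o : Obs m d => o.2.1) ⁻¹' {a} := hoa
    rw [Set.indicator_of_mem h2]
    simp only [Set.indicator_of_mem (h1 _)]
    rw [lintegral_mul_const, weightedVar, ofReal_integral_eq_lintegral_ofReal
      (memLp_dotProduct_sub ho _).integrable_sq (ae_of_all _ fun _ => sq_nonneg _)]
    · rw [hoa]
      unfold weightedOutcome
      simp only [hoa]
    · have h3 : Measurable fun y : Fin m → ℝ => weightedOutcome w (y, o.2) := mU.comp (by fun_prop)
      fun_prop
  · have h1 : ∀ y, (y, o.2) ∉ (fun o : Obs m d => o.2.1) ⁻¹' {a} := fun y => hoa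
    have h2 : o ∉ (fun o : Obs m d => o.2.1) ⁻¹' {a} := hoa
    rw [Set.indicator_of_notMem h2]
    simp only [Set.indicator_of_notMem (h1 _), lintegral_zero]

/-- Reduction to a scalar outcome: on `A = a` the variable `wᵀ(A, X) Y` has conditional mean `wᵀ g`
and conditional variance `wᵀ Σ w`, so one scalar regression per treatment encodes the vector
problem. -/
theorem isRegression (h : HasMoments Q) (hw : ∀ a, Measurable (w a)) {B : ℝ}
    (hB : ∀ a x, w a x ⬝ᵥ w a x ≤ B) (hW : MemLp (weightedReg Q w) 2 (covLaw Q)) :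
    IsRegression Q (fun o => o.2.1) (fun o => o.2.2) (weightedOutcome w) (propensity Q)
      (fun a x => w a x ⬝ᵥ outcomeReg Q a x) (weightedVar Q w) := by
  have mG := measurable_dotProduct_reg Q hw
  have iV : ∀ a, Integrable (fun o : Obs m d => weightedVar Q w a o.2.2) Q := fun a =>
    (integrable_covLaw_iff Q (measurable_weightedVar Q hw a).aestronglyMeasurable).1
      (h.integrable_weightedVar hw hB a)
  refine ⟨by fun_prop, by fun_prop, measurable_weightedOutcome hw, measurable_propensity Q, mG,
    measurable_weightedVar Q hw, propensity_nonneg Q, propensity_le_one Q, weightedVar_nonneg Q,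
    fun a f hf => setIntegral_treatment Q a hf, ?_,
    fun a k hk => setLIntegral_weightedOutcome_sub_sq h hw a hk, iV,
    hW.comp_measurePreserving ⟨by fun_prop, rfl⟩⟩
  rintro a c hc ⟨C, hC⟩
  have hA := measurableSet_treatment (m := m) (d := d) a
  have mU := measurable_weightedOutcome (m := m) (d := d) hw
  have mG' : Measurable fun o : Obs m d => w a o.2.2 ⬝ᵥ outcomeReg Q a o.2.2 :=
    (mG a).comp (by fun_prop)
  have hfin : ∫⁻ o in (fun o => o.2.1) ⁻¹' {a}, ENNReal.ofReal
      ((weightedOutcome w o - w a o.2.2 ⬝ᵥ outcomeReg Q a o.2.2) ^ 2) ∂Q < ∞ := by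
    have h1 := setLIntegral_weightedOutcome_sub_sq h hw a (k := 1) measurable_const
    simp only [Pi.one_apply, mul_one] at h1
    rw [h1]
    refine (setLIntegral_le_lintegral _ _).trans_lt ?_
    rw [← ofReal_integral_eq_lintegral_ofReal (iV a)
      (ae_of_all _ fun o => weightedVar_nonneg Q a _)]
    exact ENNReal.ofReal_lt_top
  have hL2 : MemLp (fun o => weightedOutcome w o - w a o.2.2 ⬝ᵥ outcomeReg Q a o.2.2) 2
      (Q.restrict ((fun o => o.2.1) ⁻¹' {a})) := by
    refine (memLp_two_iff_integrable_sq (by fun_prop)).2 ⟨by fun_prop, ?_⟩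
    rwa [hasFiniteIntegral_iff_ofReal (ae_of_all _ fun _ => sq_nonneg _)]
  have hint : Integrable (((fun o : Obs m d => o.2.1) ⁻¹' {a}).indicator fun o =>
      c o.2.2 * (weightedOutcome w o - w a o.2.2 ⬝ᵥ outcomeReg Q a o.2.2)) Q := by
    rw [integrable_indicator_iff hA]
    exact (hL2.integrable one_le_two).bdd_mul (c := C)
      (Measurable.aestronglyMeasurable (by fun_prop)) (ae_of_all _ fun o => hC _)
  rw [← integral_indicator hA, integral_eq_integral_outcomeLaw Q hint]
  refine integral_eq_zero_of_ae ?_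
  filter_upwards [ae_of_ae_covLaw Q (h.memLp a)] with o ho
  by_cases hoa : o.2.1 = a
  · have h1 : ∀ y, (y, o.2) ∈ (fun o : Obs m d => o.2.1) ⁻¹' {a} := fun y => hoa
    simp only [Set.indicator_of_mem (h1 _), weightedOutcome, hoa, Pi.zero_apply]
    rw [integral_const_mul, integral_sub ((memLp_dotProduct ho _).integrable one_le_two)
      (integrable_const _), integral_dotProduct ho]
    simp
  · have h1 : ∀ y, (y, o.2) ∉ (fun o : Obs m d => o.2.1) ⁻¹' {a} := fun y => hoa
    simp only [Set.indicator_of_notMem (h1 _), integral_zero, Pi.zero_apply]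

end Observation

/-! ### Laws of clusters of several types -/

section DataLaw

variable {K : ℕ} {M d : Fin K → ℕ}

theorem measurable_ofType (k : Fin K) :
    Measurable (ofType k : Obs (M k) (d k) → Data M d) := by
  intro s hs
  exact MeasurableSpace.measurableSet_iInf.1 hs k

theorem ofType_injective (k : Fin K) :
    Function.Injective (ofType k : Obs (M k) (d k) → Data M d) := fun o o' h => by
  simpa [ofType] using h

theorem measurableEmbedding_ofType (k : Fin K) :
    MeasurableEmbedding (ofType k : Obs (M k) (d k) → Data M d) := by
  refine ⟨ofType_injective k, measurable_ofType k, fun t ht => ?_⟩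
  refine MeasurableSpace.measurableSet_iInf.2 fun k' => ?_
  change MeasurableSet ((ofType k' : Obs (M k') (d k') → Data M d) ⁻¹' (ofType k '' t))
  by_cases h : k = k'
  · subst h
    rwa [Set.preimage_image_eq _ (ofType_injective k)]
  · have : (ofType k' : Obs (M k') (d k') → Data M d) ⁻¹' (ofType k '' t) = ∅ := by
      ext o
      simp only [Set.mem_preimage, Set.mem_image, Set.mem_empty_iff_false, iff_false, not_exists,
        not_and]
      intro o' _ ho
      exact h (congrArg Sigma.fst ho)
    rw [this]
    exact MeasurableSet.empty

theorem range_ofType (k : Fin K) :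
    Set.range (ofType k : Obs (M k) (d k) → Data M d) = Sigma.fst ⁻¹' {k} := by
  ext ⟨k', o⟩
  simp only [Set.mem_range, Set.mem_preimage, Set.mem_singleton_iff, ofType]
  constructor
  · rintro ⟨o', h⟩
    exact (congrArg Sigma.fst h).symm
  · rintro rfl
    exact ⟨o, rfl⟩

theorem measurableSet_fst (k : Fin K) :
    MeasurableSet (Sigma.fst ⁻¹' {k} : Set (Data M d)) := by
  rw [← range_ofType]
  exact (measurableEmbedding_ofType k).measurableSet_range

theorem map_comap_ofType (μ : Measure (Data M d)) (k : Fin K) :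
    (μ.comap (ofType k)).map (ofType k) = μ.restrict (Sigma.fst ⁻¹' {k}) := by
  rw [(measurableEmbedding_ofType k).map_comap, range_ofType]

theorem eq_sum_map_comap (μ : Measure (Data M d)) :
    μ = Measure.sum fun k => (μ.comap (ofType k)).map (ofType k) := by
  simp_rw [map_comap_ofType]
  rw [← Measure.restrict_iUnion]
  · have : (⋃ k : Fin K, (Sigma.fst ⁻¹' {k} : Set (Data M d))) = Set.univ := by ext; simp
    rw [this, Measure.restrict_univ]
  · intro i j hij
    refine Set.disjoint_left.2 fun z hz hz' => hij ?_
    exact (show z.1 = i from hz).symm.trans hz'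
  · exact measurableSet_fst

theorem lintegral_data (μ : Measure (Data M d)) (F : Data M d → ℝ≥0∞) :
    ∫⁻ z, F z ∂μ = ∑ k, ∫⁻ o, F (ofType k o) ∂(μ.comap (ofType k)) := by
  conv_lhs => rw [eq_sum_map_comap μ, lintegral_sum_measure, tsum_fintype]
  simp_rw [(measurableEmbedding_ofType _).lintegral_map]

theorem memLp_comap_ofType {μ : Measure (Data M d)} {F : Data M d → ℝ} (h : MemLp F 2 μ)
    (k : Fin K) : MemLp (fun o => F (ofType k o)) 2 (μ.comap (ofType k)) := by
  have h1 : MemLp F 2 ((μ.comap (ofType k)).map (ofType k)) := by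
    rw [map_comap_ofType]; exact h.restrict _
  exact (measurableEmbedding_ofType k).memLp_map_measure_iff.1 h1

theorem integral_data {μ : Measure (Data M d)} {F : Data M d → ℝ} (h : Integrable F μ) :
    ∫ z, F z ∂μ = ∑ k, ∫ o, F (ofType k o) ∂(μ.comap (ofType k)) := by
  have h1 := h
  conv_lhs => rw [eq_sum_map_comap μ]
  rw [eq_sum_map_comap μ] at h1
  rw [integral_sum_measure h1, tsum_fintype]
  simp_rw [(measurableEmbedding_ofType _).integral_map]

theorem measurable_data {β : Type*} [MeasurableSpace β] {F : Data M d → β}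
    (h : ∀ k, Measurable fun o => F (ofType k o)) : Measurable F := by
  intro s hs
  exact MeasurableSpace.measurableSet_iInf.2 fun k => h k hs

theorem integrable_data {μ : Measure (Data M d)} {F : Data M d → ℝ}
    (hm : ∀ k, Measurable fun o => F (ofType k o))
    (h : ∀ k, Integrable (fun o => F (ofType k o)) (μ.comap (ofType k))) : Integrable F μ := by
  refine ⟨(measurable_data hm).aestronglyMeasurable, ?_⟩
  rw [hasFiniteIntegral_iff_enorm, lintegral_data]
  exact ENNReal.sum_lt_top.2 fun k _ => hasFiniteIntegral_iff_enorm.1 (h k).2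

theorem memLp_data {μ : Measure (Data M d)} {F : Data M d → ℝ}
    (hm : ∀ k, Measurable fun o => F (ofType k o))
    (h : ∀ k, MemLp (fun o => F (ofType k o)) 2 (μ.comap (ofType k))) : MemLp F 2 μ := by
  refine (memLp_two_iff_integrable_sq (measurable_data hm).aestronglyMeasurable).2 ?_
  exact integrable_data (fun k => (hm k).pow_const 2) fun k => (h k).integrable_sq

theorem comap_withDensity (μ : Measure (Data M d)) {f : Data M d → ℝ≥0∞} (k : Fin K) :
    (μ.withDensity f).comap (ofType k) =
      (μ.comap (ofType k)).withDensity fun o => f (ofType k o) := by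
  have he := measurableEmbedding_ofType (M := M) (d := d) k
  ext t ht
  rw [he.comap_apply, withDensity_apply _ (he.measurableSet_image.2 ht), withDensity_apply _ ht,
    he.restrict_comap, ← he.lintegral_map, he.map_comap,
    Measure.restrict_restrict he.measurableSet_range,
    Set.inter_eq_right.2 (Set.image_subset_range _ _)]

variable (P : ProbabilityMeasure (Data M d)) (k : Fin K)

theorem lawGiven_eq :
    lawGiven P k =
      (ENNReal.ofReal (typeProb P k))⁻¹ • (P : Measure (Data M d)).comap (ofType k) := by
  have he := measurableEmbedding_ofType (M := M) (d := d) k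
  ext t ht
  rw [lawGiven, he.comap_apply, cond_apply (measurableSet_fst k), Measure.smul_apply,
    he.comap_apply, typeProb, ofReal_measureReal, smul_eq_mul]
  congr 2
  rw [← range_ofType]
  exact Set.inter_eq_right.2 (Set.image_subset_range _ _)

variable {P k}

theorem isProbabilityMeasure_lawGiven (h : 0 < typeProb P k) :
    IsProbabilityMeasure (lawGiven P k) := by
  refine ⟨?_⟩
  rw [lawGiven_eq, Measure.smul_apply, (measurableEmbedding_ofType k).comap_apply, Set.image_univ,
    range_ofType, typeProb, ofReal_measureReal, smul_eq_mul]
  refine ENNReal.inv_mul_cancel ?_ (measure_ne_top _ _)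
  intro h0
  simp [typeProb, Measure.real, h0] at h

theorem comap_ofType_eq (h : 0 < typeProb P k) :
    (P : Measure (Data M d)).comap (ofType k) =
      ENNReal.ofReal (typeProb P k) • lawGiven P k := by
  rw [lawGiven_eq, smul_smul, ENNReal.mul_inv_cancel (by simpa using h) (by simp), one_smul]

theorem integral_comap_ofType (h : 0 < typeProb P k) (F : Obs (M k) (d k) → ℝ) :
    ∫ o, F o ∂((P : Measure (Data M d)).comap (ofType k)) =
      typeProb P k * ∫ o, F o ∂(lawGiven P k) := by
  rw [comap_ofType_eq h, integral_smul_measure, ENNReal.toReal_ofReal h.le, smul_eq_mul]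

theorem integrable_comap_ofType_iff (h : 0 < typeProb P k) {F : Obs (M k) (d k) → ℝ} :
    Integrable F ((P : Measure (Data M d)).comap (ofType k)) ↔ Integrable F (lawGiven P k) := by
  rw [comap_ofType_eq h]
  exact integrable_smul_measure (by simpa using h) (by simp)

theorem memLp_comap_ofType_iff (h : 0 < typeProb P k) {F : Obs (M k) (d k) → ℝ}
    (hF : Measurable F) :
    MemLp F 2 ((P : Measure (Data M d)).comap (ofType k)) ↔ MemLp F 2 (lawGiven P k) := by
  rw [memLp_two_iff_integrable_sq hF.aestronglyMeasurable,
    memLp_two_iff_integrable_sq hF.aestronglyMeasurable, integrable_comap_ofType_iff h]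

theorem lawGiven_of_withDensity {μ : Measure (Data M d)} {f : Data M d → ℝ}
    (hf : Measurable f)
    (hP : (P : Measure (Data M d)) = μ.withDensity fun z => ENNReal.ofReal (f z))
    (h : 0 < typeProb P k) :
    lawGiven P k = (μ.comap (ofType k)).withDensity fun o =>
      ENNReal.ofReal (f (ofType k o) / typeProb P k) := by
  rw [lawGiven_eq, hP, comap_withDensity, ← withDensity_smul]
  · congr 1
    ext o
    rw [Pi.smul_apply, smul_eq_mul, div_eq_inv_mul, ENNReal.ofReal_mul (inv_nonneg.2 h.le),
      ENNReal.ofReal_inv_of_pos h]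
  · exact (hf.comp (measurable_ofType k)).ennreal_ofReal

theorem moments_iff : Moments P ↔ ∀ k, HasMoments (lawGiven P k) := by
  constructor
  · exact fun h k => ⟨fun a => (h k a).1, fun a => (h k a).2.1, fun a => (h k a).2.2⟩
  · exact fun h k a => ⟨(h k).memLp a, (h k).integrable_reg a, (h k).integrable_cov a⟩

end DataLaw

/-! ### Scores -/

namespace SmoothSubmodel

variable {Z : Type*} [MeasurableSpace Z] {P : ProbabilityMeasure Z} (S : SmoothSubmodel P)

theorem isRootDensity {η : EuclideanSpace ℝ (Fin S.dim)} (hη : η ∈ S.param) :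
    IsRootDensity S.μ (S.law η : Measure Z) fun z => √(S.dens η z) := by
  refine ⟨(S.measurable_dens η).sqrt, fun z => Real.sqrt_nonneg _, ?_, inferInstance⟩
  simp_rw [Real.sq_sqrt (S.dens_nonneg η _)]
  exact S.law_eq η hη

theorem isSmoothPath : IsSmoothPath S.μ (fun η => (S.law η : Measure Z))
    (fun η z => √(S.dens η z)) (S.ψ S.η₀) S.η₀ :=
  ⟨mem_of_superset (S.isOpen_param.mem_nhds S.η₀_mem) fun _ hη => S.isRootDensity hη,
    S.memLp_ψ _ S.η₀_mem, S.meanSquare_diff _ S.η₀_mem⟩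

theorem isRootDensity₀ : IsRootDensity S.μ (P : Measure Z) fun z => √(S.dens S.η₀ z) := by
  have := S.isRootDensity S.η₀_mem
  rwa [S.law_η₀] at this

/-- Where the density is zero the score takes the default value of a division by zero, and the
factor from the density removes that point from both sides. So the identity holds everywhere,
without the fact that `ψ` vanishes there almost surely. -/
theorem score_mul_sq (j : Fin S.dim) (z : Z) :
    S.score j z * √(S.dens S.η₀ z) ^ 2 = 2 * √(S.dens S.η₀ z) * S.ψ S.η₀ j z := by
  unfold score
  rcases eq_or_ne (√(S.dens S.η₀ z)) 0 with h | h
  · simp [h]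
  · field_simp

theorem integral_mul_score (F : Z → ℝ) (j : Fin S.dim) :
    ∫ z, F z * S.score j z ∂(P : Measure Z) =
      2 * ∫ z, F z * √(S.dens S.η₀ z) * S.ψ S.η₀ j z ∂S.μ := by
  rw [S.isRootDensity₀.integral_eq, ← integral_const_mul]
  refine integral_congr_ae (ae_of_all _ fun z => ?_)
  simp only
  rw [mul_assoc, S.score_mul_sq]
  ring

theorem memLp_score (j : Fin S.dim) : MemLp (S.score j) 2 (P : Measure Z) := by
  have h0 := S.isRootDensity₀
  have hψ := S.memLp_ψ _ S.η₀_mem j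
  have hac : (P : Measure Z) ≪ S.μ := by
    rw [h0.eq]; exact withDensity_absolutelyContinuous _ _
  have hm : AEStronglyMeasurable (S.score j) (P : Measure Z) := by
    have h1 := (hψ.aestronglyMeasurable.mono_ac hac).aemeasurable
    have h2 := S.measurable_dens S.η₀
    unfold score
    exact AEMeasurable.aestronglyMeasurable (by fun_prop)
  refine (memLp_two_iff_integrable_sq hm).2 (h0.integrable_iff.2 ?_)
  refine (hψ.integrable_sq.const_mul 4).mono' ?_ (ae_of_all _ fun z => ?_)
  · have h1 := hψ.aestronglyMeasurable.aemeasurable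
    have h2 := S.measurable_dens S.η₀
    unfold score
    exact AEMeasurable.aestronglyMeasurable (by fun_prop)
  · rw [Real.norm_eq_abs, abs_of_nonneg (by positivity)]
    unfold score
    rcases eq_or_ne (√(S.dens S.η₀ z)) 0 with h | h
    · rw [h]; simpa using sq_nonneg _
    · rw [div_pow, div_mul_cancel₀ _ (pow_ne_zero 2 h), mul_pow]
      norm_num

end SmoothSubmodel

/-! ### Conditional laws given the cluster type along a submodel. -/

section Fibre

variable {K : ℕ} {M d : Fin K → ℕ} {P : ProbabilityMeasure (Data M d)} (S : SmoothSubmodel P)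
  (k : Fin K)

/-- The path of the conditional laws given `L = k`. -/
theorem SmoothSubmodel.isSmoothPath_lawGiven {p : ℝ} (hp : 0 < p)
    (h : ∀ η ∈ S.param, typeProb (S.law η) k = p) :
    IsSmoothPath (S.μ.comap (ofType k)) (fun η => lawGiven (S.law η) k)
      (fun η o => √(S.dens η (ofType k o) / p)) (fun j o => S.ψ S.η₀ j (ofType k o) / √p)
      S.η₀ := by
  have hpar := S.isOpen_param.mem_nhds S.η₀_mem
  have sp := S.isSmoothPath
  refine ⟨?_, fun j => ?_, ?_⟩
  · filter_upwards [hpar] with η hη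
    have hk := h η hη
    refine ⟨?_, fun o => Real.sqrt_nonneg _, ?_,
      isProbabilityMeasure_lawGiven (by rw [hk]; exact hp)⟩
    · exact (((S.measurable_dens η).comp (measurable_ofType k)).div_const p).sqrt
    · rw [lawGiven_of_withDensity (S.measurable_dens η) (S.law_eq η hη) (by rw [hk]; exact hp), hk]
      simp_rw [Real.sq_sqrt (div_nonneg (S.dens_nonneg η _) hp.le)]
  · simp_rw [div_eq_mul_inv]
    exact (memLp_comap_ofType (S.memLp_ψ _ S.η₀_mem j) k).mul_const _
  · have h1 := sp.diff.const_mul p⁻¹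
    rw [mul_zero] at h1
    refine squeeze_zero' (Eventually.of_forall fun η => by
      exact div_nonneg (integral_nonneg fun _ => sq_nonneg _) (sq_nonneg _)) ?_ h1
    filter_upwards [nhdsWithin_le_nhds hpar] with η hη
    have mrem := (sp.memLp_remainder (S.isRootDensity hη)).integrable_sq
    rw [← mul_div_assoc]
    refine div_le_div_of_nonneg_right ?_ (sq_nonneg _)
    rw [integral_data mrem]
    have e : ∀ o, (√(S.dens η (ofType k o) / p) - √(S.dens S.η₀ (ofType k o) / p) -
        ∑ j, (η j - S.η₀ j) * (S.ψ S.η₀ j (ofType k o) / √p)) ^ 2 =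
        p⁻¹ * (√(S.dens η (ofType k o)) - √(S.dens S.η₀ (ofType k o)) -
        ∑ j, (η j - S.η₀ j) * S.ψ S.η₀ j (ofType k o)) ^ 2 := by
      intro o
      rw [Real.sqrt_div (S.dens_nonneg _ _), Real.sqrt_div (S.dens_nonneg _ _)]
      simp_rw [← mul_div_assoc]
      rw [← Finset.sum_div, ← sub_div, ← sub_div, div_pow, Real.sq_sqrt hp.le, div_eq_inv_mul]
    simp_rw [e]
    rw [integral_const_mul]
    refine mul_le_mul_of_nonneg_left ?_ (inv_nonneg.2 hp.le)
    -- Since the type probability is constant along the submodel, the remainder within type `k` is,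
    -- up to `1 / p`, one of the non-negative summands of the total remainder.
    exact Finset.single_le_sum (f := fun k => ∫ o, (√(S.dens η (ofType k o)) -
      √(S.dens S.η₀ (ofType k o)) - ∑ j, (η j - S.η₀ j) * S.ψ S.η₀ j (ofType k o)) ^ 2
      ∂(S.μ.comap (ofType k))) (fun k _ => integral_nonneg fun _ => sq_nonneg _) (Finset.mem_univ k)

end Fibre

theorem hasGradientAt_of_isLittleO {n : ℕ} {f : EuclideanSpace ℝ (Fin n) → ℝ}
    {η₀ : EuclideanSpace ℝ (Fin n)} {D : Fin n → ℝ}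
    (h : (fun η => f η - f η₀ - ∑ j, (η j - η₀ j) * D j) =o[𝓝 η₀] fun η => η - η₀) :
    HasGradientAt f (WithLp.toLp 2 D) η₀ := by
  rw [hasGradientAt_iff_isLittleO]
  refine h.congr_left fun η => ?_
  simp [PiLp.inner_apply, mul_comm]

/-- The derivative of a root density is orthogonal to the root density. -/
theorem IsSmoothPath.integral_mul_eq_zero {Ω : Type*} [MeasurableSpace Ω] {μ : Measure Ω} {n : ℕ}
    {Q : EuclideanSpace ℝ (Fin n) → Measure Ω} {s : EuclideanSpace ℝ (Fin n) → Ω → ℝ}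
    {ψ : Fin n → Ω → ℝ} {η₀ : EuclideanSpace ℝ (Fin n)} (p : IsSmoothPath μ Q s ψ η₀) (j : Fin n) :
    ∫ ω, s η₀ ω * ψ j ω ∂μ = 0 := by
  have h0 := p.root₀
  have := h0.prob
  have e1 : ∀ Q : Measure Ω, IsProbabilityMeasure Q → l2 Q (fun _ => (1 : ℝ)) = 1 := fun Q _ => by
    simp [l2]
  -- The integral of the constant one never changes along the path, so its gradient, given by the
  -- general formula, must be zero.
  have h := p.isLittleO_integral_sub (H := fun _ _ => 1) (T := fun _ => 1) (C := 1)
    (by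
      filter_upwards [p.root] with η hη
      have := hη.prob
      exact ⟨measurable_const, ⟨memLp_const _, (e1 _ h0.prob).le⟩,
        memLp_const _, (e1 _ hη.prob).le⟩)
    measurable_const (memLp_const _) (by simp)
  have h2 : (fun η => (0 : ℝ) - 0 - ∑ j, (η j - η₀ j) * (2 * ∫ ω, 1 * s η₀ ω * ψ j ω ∂μ))
      =o[𝓝 η₀] fun η => η - η₀ := by
    refine h.congr' ?_ EventuallyEq.rfl
    filter_upwards [p.root] with η hη
    have := hη.prob
    simp
  have h3 := hasGradientAt_of_isLittleO (f := fun _ => (0 : ℝ)) h2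
  have h4 := h3.unique (hasGradientAt_const η₀ (0 : ℝ))
  have h5 := congrArg (fun u : EuclideanSpace ℝ (Fin n) => u j) h4
  simpa using h5

/-! ### From the weighted score to the derivative of `θ_k`. -/

section MainGradient

variable {m d : ℕ} {Q : Measure (Obs m d)} [IsFiniteMeasure Q]
  {w : Trt m → (Fin d → ℝ) → Fin m → ℝ}

theorem phi_eq_ipw_sub (θ : ℝ) (o : Obs m d) : phi Q w θ o =
    ipw (fun o : Obs m d => o.2.1) (fun o => o.2.2) (weightedOutcome w) (propensity Q)
      (fun a x => w a x ⬝ᵥ outcomeReg Q a x) o - θ := by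
  unfold phi ipw
  congr 1
  refine Finset.sum_congr rfl fun a _ => ?_
  rw [dotProduct_add]
  congr 1
  by_cases h : o.2.1 = a
  · rw [Set.indicator_of_mem (show o ∈ (fun o : Obs m d => o.2.1) ⁻¹' {a} from h), if_pos h,
      dotProduct_smul, dotProduct_sub, smul_eq_mul, weightedOutcome, h]
    ring
  · rw [Set.indicator_of_notMem (show o ∉ (fun o : Obs m d => o.2.1) ⁻¹' {a} from h), if_neg h]
    simp

theorem thetaOf_eq (h : HasMoments Q) (hw : ∀ a, Measurable (w a)) {B : ℝ}
    (hB : ∀ a x, w a x ⬝ᵥ w a x ≤ B) :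
    thetaOf Q w = ∫ o, ∑ a, w a o.2.2 ⬝ᵥ outcomeReg Q a o.2.2 ∂Q := by
  unfold thetaOf
  have i := h.integrable_dotProduct_reg hw hB
  rw [integral_finsetSum _ fun a _ => (integrable_covLaw_iff Q (i a).aestronglyMeasurable).1 (i a)]
  exact Finset.sum_congr rfl fun a _ => integral_covLaw Q (i a).aestronglyMeasurable

end MainGradient

section DataGradient

variable {K : ℕ} {M d : Fin K → ℕ} {P : ProbabilityMeasure (Data M d)}
  {w : ∀ k, Trt (M k) → (Fin (d k) → ℝ) → Fin (M k) → ℝ}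

theorem Overlap.ae_obs (h : Overlap P) : ∃ c > 0, ∀ k a, ∀ᵐ o ∂(lawGiven P k),
    c < propensity (lawGiven P k) a o.2.2 := by
  obtain ⟨c, hc, h⟩ := h
  exact ⟨c, hc, fun k a => (ae_of_ae_covLaw _ (h k a)).mono fun o ho => ho.1⟩

/-- Differentiability of `θ_k` along a regular submodel. -/
theorem isLittleO_thetaOf {p : Fin K → ℝ} (hp_pos : ∀ k, 0 < p k) (overlap : Overlap P)
    (hw_meas : ∀ k a, Measurable (w k a)) {B : ℝ} (hB0 : 0 ≤ B)
    (hB : ∀ k a x, w k a x ⬝ᵥ w k a x ≤ B) {S : SmoothSubmodel P}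
    (hS : S ∈ regularSubmodels w (modelNP M d p) P) (θ : ℝ) (k : Fin K) :
    (fun η => thetaOf (lawGiven (S.law η) k) (w k) - thetaOf (lawGiven (S.law S.η₀) k) (w k) -
      ∑ j, (η j - S.η₀ j) * (2 * ∫ o, 1 / p k * phi (lawGiven P k) (w k) θ o *
        √(S.dens S.η₀ (ofType k o)) * S.ψ S.η₀ j (ofType k o) ∂(S.μ.comap (ofType k))))
      =o[𝓝 S.η₀] fun η => η - S.η₀ := by
  obtain ⟨hmod, -, C, hC⟩ := hS
  have hpar := S.isOpen_param.mem_nhds S.η₀_mem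
  obtain ⟨c, hc, hov⟩ := overlap.ae_obs
  have path := S.isSmoothPath_lawGiven k (hp_pos k) fun η hη => (hmod η hη).1 k
  have hmom : ∀ η ∈ S.param, HasMoments (lawGiven (S.law η) k) := fun η hη =>
    moments_iff.1 (hmod η hη).2.2 k
  have hreg : ∀ᶠ η in 𝓝 S.η₀, IsRegression (lawGiven (S.law η) k) (fun o => o.2.1)
      (fun o => o.2.2) (weightedOutcome (w k)) (propensity (lawGiven (S.law η) k))
      (fun a x => w k a x ⬝ᵥ outcomeReg (lawGiven (S.law η) k) a x)
      (weightedVar (lawGiven (S.law η) k) (w k)) := by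
    filter_upwards [hpar, hC] with η hη hCη
    exact isRegression (hmom η hη) (hw_meas k) (hB k) (hCη k).2.1
  -- One constant for both requirements: `B * C` bounds the weighted variances, `C` the second
  -- moment of the weighted regression.
  set C' : ℝ := max (B * C) C with hC'
  have main := path.isLittleO_sum_regression hreg hc (C := C')
    (by rw [S.law_η₀]; exact hov k)
    (by
      filter_upwards [hpar, hC] with η hη hCη a
      rw [← integral_covLaw _ (measurable_weightedVar _ (hw_meas k) a).aestronglyMeasurable]
      exact ((hmom η hη).integral_weightedVar_le (hw_meas k) (hB k) hB0 a
        ((hCη k).1 a)).trans (le_max_left _ _))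
    (by
      filter_upwards [hpar, hC] with η hη hCη
      have := (hCη k).2.2
      rw [integral_covLaw (f := fun x => weightedReg (lawGiven (S.law η) k) (w k) x ^ 2) _
        ((hCη k).2.1.aestronglyMeasurable.pow 2)] at this
      exact this.trans (le_max_right _ _))
  refine main.congr' ?_ EventuallyEq.rfl
  filter_upwards [hpar] with η hη
  rw [thetaOf_eq (hmom η hη) (hw_meas k) (hB k),
    thetaOf_eq (hmom S.η₀ S.η₀_mem) (hw_meas k) (hB k)]
  congr 1
  refine Finset.sum_congr rfl fun j _ => ?_
  congr 2
  have h0 := path.root₀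
  have := h0.prob
  have r0 := hreg.self_of_nhds
  have mT := r0.memLp_ipw hc (by rw [S.law_η₀]; exact hov k)
  have mTs := (h0.memLp_iff (r0.measurable_ipw r0.measurable_e)).1 mT
  have i1 := mTs.integrable_mul (path.memLp j)
  have i2 := h0.memLp.integrable_mul (path.memLp j)
  have hz := path.integral_mul_eq_zero j
  have hs : √(p k) ≠ 0 := (Real.sqrt_pos.2 (hp_pos k)).ne'
  have hs2 : √(p k) ^ 2 = p k := Real.sq_sqrt (hp_pos k).le
  -- The factor `1 / p k` is shared equally between the conditional root density and its derivative.
  -- Subtracting `θ` costs nothing because the root density is orthogonal to its derivative; hence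
  -- `θ` is arbitrary here.
  have e : ∀ o, 1 / p k * phi (lawGiven P k) (w k) θ o * √(S.dens S.η₀ (ofType k o)) *
      S.ψ S.η₀ j (ofType k o) =
      ipw (fun o => o.2.1) (fun o => o.2.2) (weightedOutcome (w k))
        (propensity (lawGiven (S.law S.η₀) k))
        (fun a x => w k a x ⬝ᵥ outcomeReg (lawGiven (S.law S.η₀) k) a x) o *
        √(S.dens S.η₀ (ofType k o) / p k) * (S.ψ S.η₀ j (ofType k o) / √(p k)) -
      θ * (√(S.dens S.η₀ (ofType k o) / p k) * (S.ψ S.η₀ j (ofType k o) / √(p k))) := by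
    intro o
    rw [phi_eq_ipw_sub, S.law_η₀, Real.sqrt_div (S.dens_nonneg _ _)]
    rw [← hs2]
    simp only [Real.sqrt_sq (Real.sqrt_nonneg _)]
    field_simp
  simp_rw [e]
  have i2' : Integrable (fun o => θ * (√(S.dens S.η₀ (ofType k o) / p k) *
      (S.ψ S.η₀ j (ofType k o) / √(p k)))) (S.μ.comap (ofType k)) := i2.const_mul θ
  have := integral_sub i1 i2'
  simp only [Pi.mul_apply] at this
  rw [this, integral_const_mul, hz, mul_zero, sub_zero]

end DataGradient

/-! ### From the efficient influence function to the efficiency bound -/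

section Bound

variable {Z : Type*} [MeasurableSpace Z] {P : ProbabilityMeasure Z}

namespace SmoothSubmodel

variable (S : SmoothSubmodel P)

/-- A quadratic function of `b`, whose minimum is attained at the inverse information applied to the
gradient and equals the second moment of `φ` minus the Cramér–Rao bound. -/
theorem integral_sub_sum_score_sq {φ : Z → ℝ} (hφ : MemLp φ 2 (P : Measure Z)) (b : Fin S.dim → ℝ) :
    ∫ z, (φ z - ∑ j, b j * S.score j z) ^ 2 ∂(P : Measure Z) =
      ∫ z, φ z ^ 2 ∂(P : Measure Z) -
        2 * (b ⬝ᵥ fun j => ∫ z, φ z * S.score j z ∂(P : Measure Z)) +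
        b ⬝ᵥ (S.information *ᵥ b) := by
  have m := S.memLp_score
  have i1 : ∀ j, Integrable (fun z => φ z * S.score j z) (P : Measure Z) := fun j =>
    hφ.integrable_mul (m j)
  have i2 : ∀ i j, Integrable (fun z => S.score i z * S.score j z) (P : Measure Z) := fun i j =>
    (m i).integrable_mul (m j)
  have e : ∀ z, (φ z - ∑ j, b j * S.score j z) ^ 2 = φ z ^ 2 -
      ∑ j, 2 * b j * (φ z * S.score j z) +
      ∑ i, ∑ j, b i * b j * (S.score i z * S.score j z) := by
    intro z
    have h1 : (∑ j, b j * S.score j z) ^ 2 =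
        ∑ i, ∑ j, b i * b j * (S.score i z * S.score j z) := by
      rw [sq, Finset.sum_mul_sum]
      exact Finset.sum_congr rfl fun i _ => Finset.sum_congr rfl fun j _ => by ring
    have h2 : ∑ j, 2 * b j * (φ z * S.score j z) = 2 * φ z * ∑ j, b j * S.score j z := by
      rw [Finset.mul_sum]
      exact Finset.sum_congr rfl fun j _ => by ring
    rw [← h1, h2]
    ring
  simp_rw [e]
  have i3 := integrable_finsetSum Finset.univ fun j _ => (i1 j).const_mul (2 * b j)
  have i4 : ∀ i, Integrable (fun z => ∑ j, b i * b j * (S.score i z * S.score j z))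
      (P : Measure Z) := fun i => integrable_finsetSum _ fun j _ => (i2 i j).const_mul (b i * b j)
  have i5 := integrable_finsetSum Finset.univ fun i _ => i4 i
  have i6 : Integrable (fun z => φ z ^ 2 - ∑ j, 2 * b j * (φ z * S.score j z)) (P : Measure Z) :=
    hφ.integrable_sq.sub i3
  rw [integral_add i6 i5, integral_sub hφ.integrable_sq i3,
    integral_finsetSum _ fun j _ => (i1 j).const_mul (2 * b j),
    integral_finsetSum _ fun i _ => i4 i]
  congr 1
  · congr 1
    simp only [dotProduct, Finset.mul_sum]
    refine Finset.sum_congr rfl fun j _ => ?_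
    rw [integral_const_mul]
    ring
  · simp only [dotProduct, Matrix.mulVec, Finset.mul_sum]
    refine Finset.sum_congr rfl fun i _ => ?_
    rw [integral_finsetSum _ fun j _ => (i2 i j).const_mul (b i * b j)]
    refine Finset.sum_congr rfl fun j _ => ?_
    rw [integral_const_mul, information, Matrix.of_apply]
    ring

theorem information_transpose : S.informationᵀ = S.information := by
  ext i j
  simp only [information, Matrix.transpose_apply, Matrix.of_apply, mul_comm]

theorem dotProduct_information_nonneg (b : Fin S.dim → ℝ) : 0 ≤ b ⬝ᵥ (S.information *ᵥ b) := by
  have h := S.integral_sub_sum_score_sq (φ := fun _ => 0) (memLp_const 0) b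
  have h1 : b ⬝ᵥ (S.information *ᵥ b) =
      ∫ z, (0 - ∑ j, b j * S.score j z) ^ 2 ∂(P : Measure Z) := by
    rw [h]
    simp [dotProduct]
  rw [h1]
  exact integral_nonneg fun _ => sq_nonneg _

end SmoothSubmodel

/-- The Cramér–Rao bound of a submodel is the squared norm of the projection of `φ` on the span of
the scores, so it is at most that of `φ`, and the defect is the squared distance of `φ` from that
span. Membership in the tangent space makes the distance arbitrarily small. -/
theorem IsEfficientInfluenceFunction.isEfficiencyBound {𝒞 : Set (SmoothSubmodel P)}
    {τ : ProbabilityMeasure Z → ℝ} {φ : Z → ℝ} (h : IsEfficientInfluenceFunction 𝒞 τ φ)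
    (h𝒞 : ∀ S ∈ 𝒞, IsUnit S.information.det) (h0 : ∫ z, φ z ∂(P : Measure Z) = 0) :
    IsEfficiencyBound 𝒞 τ (Var[φ; (P : Measure Z)]) := by
  obtain ⟨hφ, hgrad, htan⟩ := h
  have hvar : Var[φ; (P : Measure Z)] = ∫ z, φ z ^ 2 ∂(P : Measure Z) :=
    variance_of_integral_eq_zero hφ.aestronglyMeasurable.aemeasurable h0
  have key : ∀ S ∈ 𝒞, S.cramerRao τ ≤ ∫ z, φ z ^ 2 ∂(P : Measure Z) ∧
      ∀ b : Fin S.dim → ℝ, ∫ z, φ z ^ 2 ∂(P : Measure Z) - S.cramerRao τ ≤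
        ∫ z, (φ z - ∑ j, b j * S.score j z) ^ 2 ∂(P : Measure Z) := by
    intro S hS
    set D : Fin S.dim → ℝ := fun j => ∫ z, φ z * S.score j z ∂(P : Measure Z) with hD
    set b₀ := S.information⁻¹ *ᵥ D with hb₀
    have hcr : S.cramerRao τ = D ⬝ᵥ b₀ := by
      unfold SmoothSubmodel.cramerRao
      rw [(hgrad S hS).gradient]
    have hJ : S.information *ᵥ b₀ = D := by
      rw [hb₀, Matrix.mulVec_mulVec, Matrix.mul_nonsing_inv _ (h𝒞 S hS), Matrix.one_mulVec]
    have q := S.integral_sub_sum_score_sq hφ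
    constructor
    · have h1 := q b₀
      rw [hJ] at h1
      have h2 : 0 ≤ ∫ z, (φ z - ∑ j, b₀ j * S.score j z) ^ 2 ∂(P : Measure Z) :=
        integral_nonneg fun _ => sq_nonneg _
      rw [hcr, dotProduct_comm]
      linarith
    · intro b
      rw [q b, hcr]
      -- Completing the square: the excess over the minimum is the information form at `b - b₀`.
      have h1 := S.dotProduct_information_nonneg (b - b₀)
      rw [Matrix.mulVec_sub, hJ, sub_dotProduct, dotProduct_sub, dotProduct_sub,
        Matrix.dotProduct_mulVec b₀, ← Matrix.mulVec_transpose, S.information_transpose, hJ,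
        dotProduct_comm D b, dotProduct_comm b₀ D] at h1
      linarith
  rw [hvar]
  constructor
  · rintro c ⟨S, hS, rfl⟩
    exact (key S hS).1
  · intro c hc
    refine le_of_forall_pos_lt_add fun ε hε => ?_
    obtain ⟨S, hS, b, hb⟩ := htan ε hε
    have h1 := (key S hS).2 b
    have h2 : S.cramerRao τ ≤ c := hc ⟨S, hS, rfl⟩
    linarith

end Bound

/-! ### The gradient of the estimand -/

section Estimand

variable {m d : ℕ} {Q : Measure (Obs m d)} [IsFiniteMeasure Q]
  {w : Trt m → (Fin d → ℝ) → Fin m → ℝ}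

theorem measurable_phi (hw : ∀ a, Measurable (w a)) (θ : ℝ) : Measurable (phi Q w θ) := by
  have e : phi Q w θ = fun o => ipw (fun o : Obs m d => o.2.1) (fun o => o.2.2)
      (weightedOutcome w) (propensity Q) (fun a x => w a x ⬝ᵥ outcomeReg Q a x) o - θ :=
    funext fun o => phi_eq_ipw_sub θ o
  rw [e]
  refine Measurable.sub_const ?_ θ
  refine Finset.measurable_sum _ fun a _ => Measurable.add ?_
    ((measurable_dotProduct_reg Q hw a).comp (by fun_prop))
  exact (((measurable_weightedOutcome hw).sub
    ((measurable_dotProduct_reg Q hw a).comp (by fun_prop))).div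
    ((measurable_propensity Q a).comp (by fun_prop))).indicator (measurableSet_treatment a)

theorem memLp_phi [IsProbabilityMeasure Q] (h : HasMoments Q) (hw : ∀ a, Measurable (w a)) {B : ℝ}
    (hB : ∀ a x, w a x ⬝ᵥ w a x ≤ B) (hW : MemLp (weightedReg Q w) 2 (covLaw Q)) {c : ℝ}
    (hc : 0 < c) (he : ∀ a, ∀ᵐ o ∂Q, c < propensity Q a o.2.2) (θ : ℝ) :
    MemLp (phi Q w θ) 2 Q := by
  have := ((isRegression h hw hB hW).memLp_ipw hc he).sub (memLp_const θ)
  exact this.ae_eq (ae_of_all _ fun o => (phi_eq_ipw_sub θ o).symm)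

variable {K : ℕ} {M d : Fin K → ℕ} {P : ProbabilityMeasure (Data M d)}
  {w : ∀ k, Trt (M k) → (Fin (d k) → ℝ) → Fin (M k) → ℝ}

theorem sum_varphi_ofType (u θ : Fin K → ℝ) (k : Fin K) (o : Obs (M k) (d k)) :
    ∑ k', u k' * varphi w P (θ k') k' (ofType k o) =
      u k * (1 / typeProb P k * phi (lawGiven P k) (w k) (θ k) o) := by
  rw [Finset.sum_eq_single k]
  · rw [varphi, (ofType_injective k).extend_apply]
  · intro k' _ hk'
    rw [varphi, Function.extend_apply']
    · simp
    · rintro ⟨o', ho'⟩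
      exact hk' (congrArg Sigma.fst ho')
  · simp

variable {p : Fin K → ℝ} (hp : ∀ k, p k = typeProb P k) (hp_pos : ∀ k, 0 < p k)
  (overlap : Overlap P) (moments : Moments P) (hw_meas : ∀ k a, Measurable (w k a)) {B : ℝ}
  (hB0 : 0 ≤ B) (hB : ∀ k a x, w k a x ⬝ᵥ w k a x ≤ B)
  (finite_bound : ∀ k, MemLp (weightedReg (lawGiven P k) (w k)) 2 (covLaw (lawGiven P k)))
  {v : Fin K → ℝ → ℝ} {θ : Fin K → ℝ} {φ : Data M d → ℝ}
  (hφ : ∀ z, φ z = ∑ k, v k (p k) * varphi w P (θ k) k z)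

include hφ hp in
theorem influence_ofType (k : Fin K) (o : Obs (M k) (d k)) :
    φ (ofType k o) = v k (p k) * (1 / p k * phi (lawGiven P k) (w k) (θ k) o) := by
  rw [hφ, sum_varphi_ofType (fun k => v k (p k)), ← hp]

include hp hp_pos overlap moments hw_meas hB finite_bound hφ

theorem memLp_influence : MemLp φ 2 (P : Measure (Data M d)) := by
  obtain ⟨c, hc, hov⟩ := overlap.ae_obs
  have e : ∀ k, (fun o => φ (ofType k o)) = fun o =>
      v k (p k) * (1 / p k * phi (lawGiven P k) (w k) (θ k) o) := fun k =>
    funext fun o => influence_ofType hp hφ k o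
  have hm : ∀ k, Measurable fun o => φ (ofType k o) := fun k => by
    rw [e]
    exact ((measurable_phi (hw_meas k) _).const_mul _).const_mul _
  refine memLp_data hm fun k => ?_
  have hk : 0 < typeProb P k := hp k ▸ hp_pos k
  have := isProbabilityMeasure_lawGiven hk
  rw [memLp_comap_ofType_iff hk (hm k), e]
  exact ((memLp_phi (moments_iff.1 moments k) (hw_meas k) (hB k) (finite_bound k) hc
    (hov k) _).const_mul _).const_mul _

include hB0

theorem hasGradientAt_tau {S : SmoothSubmodel P}
    (hS : S ∈ regularSubmodels w (modelNP M d p) P) :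
    HasGradientAt (fun η => tau w v (S.law η))
      (WithLp.toLp 2 fun j => ∫ z, φ z * S.score j z ∂(P : Measure (Data M d))) S.η₀ := by
  have hpar := S.isOpen_param.mem_nhds S.η₀_mem
  have mφ := memLp_influence hp hp_pos overlap moments hw_meas hB finite_bound hφ
  have path := S.isSmoothPath
  apply hasGradientAt_of_isLittleO
  have main := Asymptotics.IsLittleO.sum (s := (Finset.univ : Finset (Fin K))) fun k _ =>
    (isLittleO_thetaOf hp_pos overlap hw_meas hB0 hB hS (θ k) k).const_mul_left (v k (p k))
  refine main.congr' ?_ EventuallyEq.rfl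
  filter_upwards [hpar] with η hη
  rw [Finset.sum_apply]
  -- The type probabilities are fixed in the model, so the factors `v k` are constants along the
  -- submodel and no regularity of `v` is needed.
  have t1 : ∀ η ∈ S.param, tau w v (S.law η) =
      ∑ k, v k (p k) * thetaOf (lawGiven (S.law η) k) (w k) := fun η hη => by
    unfold tau
    refine Finset.sum_congr rfl fun k _ => ?_
    rw [(hS.1 η hη).1 k]
  rw [t1 η hη, t1 _ S.η₀_mem]
  have hD : ∀ j, ∫ z, φ z * S.score j z ∂(P : Measure (Data M d)) =
      ∑ k, v k (p k) * (2 * ∫ o, 1 / p k * phi (lawGiven P k) (w k) (θ k) o *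
        √(S.dens S.η₀ (ofType k o)) * S.ψ S.η₀ j (ofType k o) ∂(S.μ.comap (ofType k))) := by
    intro j
    have mφs := (S.isRootDensity₀.memLp_iff (measurable_data fun k => by
      simp_rw [influence_ofType hp hφ k]
      exact ((measurable_phi (hw_meas k) _).const_mul _).const_mul _)).1 mφ
    have i : Integrable (fun z => φ z * √(S.dens S.η₀ z) * S.ψ S.η₀ j z) S.μ :=
      mφs.integrable_mul (path.memLp j)
    rw [S.integral_mul_score, integral_data i, Finset.mul_sum]
    refine Finset.sum_congr rfl fun k _ => ?_
    rw [mul_left_comm, ← integral_const_mul (v k (p k))]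
    refine congrArg (2 * ·) ?_
    refine integral_congr_ae (ae_of_all _ fun o => ?_)
    simp only [influence_ofType hp hφ k]
    ring
  simp_rw [hD, Finset.mul_sum]
  rw [Finset.sum_comm, ← Finset.sum_sub_distrib, ← Finset.sum_sub_distrib]
  refine Finset.sum_congr rfl fun k _ => ?_
  rw [mul_sub, mul_sub, Finset.mul_sum]
  congr 1
  exact Finset.sum_congr rfl fun j _ => by ring

end Estimand

/-! ### Mean and variance of the influence function -/

theorem integral_add_sq {Ω : Type*} [MeasurableSpace Ω] {μ : Measure Ω} {f g : Ω → ℝ}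
    (hf : MemLp f 2 μ) (hg : MemLp g 2 μ) :
    ∫ ω, (f ω + g ω) ^ 2 ∂μ = ∫ ω, f ω ^ 2 ∂μ + 2 * ∫ ω, f ω * g ω ∂μ + ∫ ω, g ω ^ 2 ∂μ := by
  have i : Integrable (fun ω => 2 * (f ω * g ω)) μ := (hf.integrable_mul hg).const_mul 2
  have i' : Integrable (fun ω => f ω ^ 2 + 2 * (f ω * g ω)) μ := hf.integrable_sq.add i
  rw [← integral_const_mul, ← integral_add hf.integrable_sq i, ← integral_add i' hg.integrable_sq]
  exact integral_congr_ae (ae_of_all _ fun ω => by ring)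

section Variance

variable {m d : ℕ} {Q : Measure (Obs m d)} [IsProbabilityMeasure Q]
  {w : Trt m → (Fin d → ℝ) → Fin m → ℝ}

instance : IsProbabilityMeasure (covLaw Q) :=
  Measure.isProbabilityMeasure_map (Measurable.aemeasurable (by fun_prop))

/-- Only the received treatment contributes a residual. This writes the influence function as a term
with mean zero given `(A, X)` plus a function of `X`, the orthogonal decomposition behind both the
variance formula and the tangent space. -/
theorem phi_apply (θ : ℝ) (o : Obs m d) : phi Q w θ o =
    (w o.2.1 o.2.2 ⬝ᵥ o.1 - w o.2.1 o.2.2 ⬝ᵥ outcomeReg Q o.2.1 o.2.2) /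
      propensity Q o.2.1 o.2.2 + (weightedReg Q w o.2.2 - θ) := by
  rw [phi_eq_ipw_sub]
  unfold ipw weightedReg
  rw [Finset.sum_add_distrib, Finset.sum_eq_single o.2.1]
  · rw [Set.indicator_of_mem (by simp)]
    simp only [weightedOutcome]
    ring
  · intro a _ ha
    exact Set.indicator_of_notMem (by simpa using Ne.symm ha) _
  · simp

variable (h : HasMoments Q) (hw : ∀ a, Measurable (w a)) {B : ℝ}
  (hB : ∀ a x, w a x ⬝ᵥ w a x ≤ B) (hW : MemLp (weightedReg Q w) 2 (covLaw Q)) {c : ℝ}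
  (hc : 0 < c) (he : ∀ a, ∀ᵐ o ∂Q, c < propensity Q a o.2.2)

include h in
theorem integral_residual_outcomeLaw : ∀ᵐ o ∂Q,
    ∫ y, (w o.2.1 o.2.2 ⬝ᵥ y - w o.2.1 o.2.2 ⬝ᵥ outcomeReg Q o.2.1 o.2.2) /
      propensity Q o.2.1 o.2.2 ∂(outcomeLaw Q o.2.1 o.2.2) = 0 := by
  filter_upwards [ae_all_iff.2 fun a => ae_of_ae_covLaw Q (h.memLp a)] with o ho
  rw [integral_div, integral_sub ((memLp_dotProduct (ho _) _).integrable one_le_two)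
    (integrable_const _), integral_dotProduct (ho _)]
  simp

include h hw hB

theorem integral_weightedReg : ∫ x, weightedReg Q w x ∂(covLaw Q) = thetaOf Q w := by
  unfold weightedReg thetaOf
  exact integral_finsetSum _ fun a _ => h.integrable_dotProduct_reg hw hB a

include hW hc he

theorem memLp_weightedReg_sub (θ : ℝ) : MemLp (fun o : Obs m d => weightedReg Q w o.2.2 - θ) 2 Q :=
  (hW.comp_measurePreserving ⟨by fun_prop, rfl⟩).sub (memLp_const θ)

theorem memLp_scaledResidual : MemLp (fun o : Obs m d => (w o.2.1 o.2.2 ⬝ᵥ o.1 -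
    w o.2.1 o.2.2 ⬝ᵥ outcomeReg Q o.2.1 o.2.2) / propensity Q o.2.1 o.2.2) 2 Q := by
  have h1 := (memLp_phi h hw hB hW hc he 0).sub (memLp_weightedReg_sub h hw hB hW hc he 0)
  refine h1.ae_eq (ae_of_all _ fun o => ?_)
  simp [phi_apply]

theorem integral_phi (θ : ℝ) : ∫ o, phi Q w θ o ∂Q = thetaOf Q w - θ := by
  have m1 := memLp_scaledResidual h hw hB hW hc he
  have m2 := memLp_weightedReg_sub h hw hB hW hc he θ
  have hW1 := hW.integrable one_le_two
  simp_rw [phi_apply]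
  rw [integral_add (m1.integrable one_le_two) (m2.integrable one_le_two),
    integral_eq_integral_outcomeLaw Q (m1.integrable one_le_two),
    integral_eq_zero_of_ae (integral_residual_outcomeLaw h), zero_add,
    ← integral_covLaw Q (f := fun x => weightedReg Q w x - θ) (hW.sub (memLp_const θ)).1,
    integral_sub hW1 (integrable_const _), integral_weightedReg h hw hB]
  simp

theorem integrable_weightedVar_div (a : Trt m) :
    Integrable (fun x => weightedVar Q w a x / propensity Q a x) (covLaw Q) := by
  have mV : Measurable fun x => weightedVar Q w a x / propensity Q a x :=
    (measurable_weightedVar Q hw a).div (measurable_propensity Q a)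
  have he' : ∀ᵐ x ∂(covLaw Q), c < propensity Q a x :=
    (ae_covLaw_iff Q (measurableSet_lt measurable_const (measurable_propensity Q a))).2 (he a)
  refine ((h.integrable_weightedVar hw hB a).div_const c).mono' mV.aestronglyMeasurable ?_
  filter_upwards [he'] with x hx
  rw [Real.norm_eq_abs, abs_of_nonneg (div_nonneg (weightedVar_nonneg Q a x) (hc.trans hx).le)]
  exact div_le_div_of_nonneg_left (weightedVar_nonneg Q a x) hc hx.le

/-- Pythagoras for the two summands: given `(A, X)` the second is constant and the first has mean
zero, so the cross term vanishes. -/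
theorem integral_phi_sq_eq_add (θ : ℝ) : ∫ o, phi Q w θ o ^ 2 ∂Q =
    ∫ x, ∑ a, weightedVar Q w a x / propensity Q a x ∂(covLaw Q) +
      ∫ x, (weightedReg Q w x - θ) ^ 2 ∂(covLaw Q) := by
  have m1 := memLp_scaledResidual h hw hB hW hc he
  have m2 := memLp_weightedReg_sub h hw hB hW hc he θ
  have i12 := m1.integrable_mul m2
  have mV : ∀ a, Measurable fun x => weightedVar Q w a x / propensity Q a x := fun a =>
    (measurable_weightedVar Q hw a).div (measurable_propensity Q a)
  have iV := integrable_weightedVar_div h hw hB hW hc he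
  have e1 : ∫ o : Obs m d, ((w o.2.1 o.2.2 ⬝ᵥ o.1 -
      w o.2.1 o.2.2 ⬝ᵥ outcomeReg Q o.2.1 o.2.2) / propensity Q o.2.1 o.2.2) ^ 2 ∂Q =
      ∫ x, ∑ a, weightedVar Q w a x / propensity Q a x ∂(covLaw Q) := by
    rw [integral_eq_integral_outcomeLaw Q m1.integrable_sq,
      integral_finsetSum _ fun a _ => iV a]
    have e2 : ∀ o : Obs m d, ∫ y, ((w o.2.1 o.2.2 ⬝ᵥ y -
        w o.2.1 o.2.2 ⬝ᵥ outcomeReg Q o.2.1 o.2.2) / propensity Q o.2.1 o.2.2) ^ 2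
          ∂(outcomeLaw Q o.2.1 o.2.2) =
        ∑ a, ((fun o : Obs m d => o.2.1) ⁻¹' {a}).indicator
          (fun o => weightedVar Q w a o.2.2 / propensity Q a o.2.2 ^ 2) o := by
      intro o
      simp_rw [div_pow]
      rw [integral_div, Finset.sum_eq_single o.2.1]
      · rw [Set.indicator_of_mem (by simp)]
        rfl
      · intro a _ ha
        exact Set.indicator_of_notMem (by simpa using Ne.symm ha) _
      · simp
    have mV2 : ∀ a, Measurable fun x => weightedVar Q w a x / propensity Q a x ^ 2 := fun a =>
      (measurable_weightedVar Q hw a).div ((measurable_propensity Q a).pow_const 2)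
    -- The squared weight gives `1 / e²`, and averaging over the treatment given `X` returns one
    -- factor `e`.
    have e3 : ∀ a, ∀ᵐ o ∂Q, propensity Q a o.2.2 *
        (weightedVar Q w a o.2.2 / propensity Q a o.2.2 ^ 2) =
        weightedVar Q w a o.2.2 / propensity Q a o.2.2 := fun a => by
      filter_upwards [he a] with o ho
      have := (hc.trans ho).ne'
      field_simp
    simp_rw [e2]
    rw [integral_finsetSum]
    · refine Finset.sum_congr rfl fun a _ => ?_
      rw [integral_indicator (measurableSet_treatment a), setIntegral_treatment Q a (mV2 a),
        integral_congr_ae (e3 a), ← integral_covLaw Q (mV a).aestronglyMeasurable]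
    · intro a _
      have i1 : Integrable (fun o : Obs m d => weightedVar Q w a o.2.2 / propensity Q a o.2.2) Q :=
        (integrable_covLaw_iff Q (mV a).aestronglyMeasurable).1 (iV a)
      refine Integrable.indicator ?_ (measurableSet_treatment a)
      refine (i1.div_const c).mono'
        ((mV2 a).comp (by fun_prop : Measurable fun o : Obs m d => o.2.2)).aestronglyMeasurable ?_
      filter_upwards [he a] with o ho
      have h0 := hc.trans ho
      have h1 := weightedVar_nonneg Q (w := w) a o.2.2
      rw [Real.norm_eq_abs, abs_of_nonneg (by positivity), sq, ← div_div]
      exact div_le_div_of_nonneg_left (by positivity) hc ho.le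
  have e4 : ∫ o : Obs m d, ((w o.2.1 o.2.2 ⬝ᵥ o.1 -
      w o.2.1 o.2.2 ⬝ᵥ outcomeReg Q o.2.1 o.2.2) / propensity Q o.2.1 o.2.2) *
      (weightedReg Q w o.2.2 - θ) ∂Q = 0 := by
    have := integral_eq_integral_outcomeLaw Q i12
    simp only [Pi.mul_apply] at this
    rw [this]
    refine integral_eq_zero_of_ae ?_
    filter_upwards [integral_residual_outcomeLaw (w := w) h] with o ho
    rw [integral_mul_const, ho, zero_mul, Pi.zero_apply]
  have e5 : ∫ o : Obs m d, (weightedReg Q w o.2.2 - θ) ^ 2 ∂Q =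
      ∫ x, (weightedReg Q w x - θ) ^ 2 ∂(covLaw Q) :=
    (integral_covLaw Q (f := fun x => (weightedReg Q w x - θ) ^ 2)
      ((hW.sub (memLp_const θ)).1.pow 2)).symm
  simp_rw [phi_apply]
  rw [integral_add_sq m1 m2, e4, e1, e5, mul_zero, add_zero]

theorem integral_phi_sq (θ : ℝ) {p : ℝ} (hp : p ≠ 0) :
    ∫ o, phi Q w θ o ^ 2 ∂Q = p * seb Q w p θ := by
  have iV := integrable_weightedVar_div h hw hB hW hc he
  have iW : Integrable (fun x => (weightedReg Q w x - θ) ^ 2) (covLaw Q) :=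
    (hW.sub (memLp_const θ)).integrable_sq
  rw [integral_phi_sq_eq_add h hw hB hW hc he,
    ← integral_add (integrable_finsetSum _ fun a _ => iV a) iW, seb, ← mul_assoc,
    mul_one_div_cancel hp, one_mul]
  refine integral_congr_ae ?_
  filter_upwards [ae_all_iff.2 h.memLp] with x hx
  congr 1
  exact Finset.sum_congr rfl fun a _ => by rw [weightedVar_eq (hx a)]

end Variance

section InfluenceVariance

variable {K : ℕ} {M d : Fin K → ℕ} {P : ProbabilityMeasure (Data M d)}
  {w : ∀ k, Trt (M k) → (Fin (d k) → ℝ) → Fin (M k) → ℝ}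
  {p : Fin K → ℝ} (hp : ∀ k, p k = typeProb P k) (hp_pos : ∀ k, 0 < p k)
  (overlap : Overlap P) (moments : Moments P) (hw_meas : ∀ k a, Measurable (w k a)) {B : ℝ}
  (hB : ∀ k a x, w k a x ⬝ᵥ w k a x ≤ B)
  (finite_bound : ∀ k, MemLp (weightedReg (lawGiven P k) (w k)) 2 (covLaw (lawGiven P k)))
  {v : Fin K → ℝ → ℝ} {θ : Fin K → ℝ} {φ : Data M d → ℝ}
  (hφ : ∀ z, φ z = ∑ k, v k (p k) * varphi w P (θ k) k z)

include hp hp_pos overlap moments hw_meas hB finite_bound hφ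

theorem integral_influence (hθ : ∀ k, θ k = thetaOf (lawGiven P k) (w k)) :
    ∫ z, φ z ∂(P : Measure (Data M d)) = 0 := by
  have mφ := memLp_influence hp hp_pos overlap moments hw_meas hB finite_bound hφ
  obtain ⟨c, hc, hov⟩ := overlap.ae_obs
  rw [integral_data (mφ.integrable one_le_two)]
  refine Finset.sum_eq_zero fun k _ => ?_
  have hk : 0 < typeProb P k := hp k ▸ hp_pos k
  have := isProbabilityMeasure_lawGiven hk
  simp_rw [influence_ofType hp hφ k]
  rw [integral_comap_ofType hk, integral_const_mul, integral_const_mul,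
    integral_phi (moments_iff.1 moments k) (hw_meas k) (hB k) (finite_bound k) hc (hov k), hθ]
  simp

theorem integral_influence_sq :
    ∫ z, φ z ^ 2 ∂(P : Measure (Data M d)) =
      ∑ k, v k (p k) ^ 2 * seb (lawGiven P k) (w k) (p k) (θ k) := by
  have mφ := memLp_influence hp hp_pos overlap moments hw_meas hB finite_bound hφ
  obtain ⟨c, hc, hov⟩ := overlap.ae_obs
  rw [integral_data mφ.integrable_sq]
  refine Finset.sum_congr rfl fun k _ => ?_
  have hk : 0 < typeProb P k := hp k ▸ hp_pos k
  have := isProbabilityMeasure_lawGiven hk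
  simp_rw [influence_ofType hp hφ k, mul_pow]
  rw [integral_comap_ofType hk, integral_const_mul, integral_const_mul,
    integral_phi_sq (moments_iff.1 moments k) (hw_meas k) (hB k) (finite_bound k) hc (hov k) _
      (hp_pos k).ne', ← hp]
  have := (hp_pos k).ne'
  field_simp

end InfluenceVariance

/-! ### Identification of the causal parameter -/

section Identification

variable {m d : ℕ}

/-- The conditional law of `Y` given `A = a`, `X`, as a kernel. -/
def outcomeKernelAt (Q : Measure (Obs m d)) [IsFiniteMeasure Q] (a : Trt m) :
    Kernel (Fin d → ℝ) (Fin m → ℝ) :=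
  (outcomeKernel Q).comap (fun x => (a, x)) (by fun_prop)

instance (Q : Measure (Obs m d)) [IsFiniteMeasure Q] (a : Trt m) :
    IsMarkovKernel (outcomeKernelAt Q a) := by unfold outcomeKernelAt; infer_instance

/-- Describes `(X, Y)` within the arm by the kernel that conditions on both `A` and `X`. It is to be
compared with the kernel of the potential outcome, which conditions on `X` only. -/
theorem map_restrict_treatment_compProd (Q : Measure (Obs m d)) [IsFiniteMeasure Q] (a : Trt m) :
    (Q.restrict ((fun o => o.2.1) ⁻¹' {a})).map (fun o => (o.2.2, o.1)) =
      (Q.restrict ((fun o => o.2.1) ⁻¹' {a})).map (fun o => o.2.2) ⊗ₘ outcomeKernelAt Q a := by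
  have hA := measurableSet_treatment (m := m) (d := d) a
  refine Measure.ext_of_lintegral _ fun F hF => ?_
  have hF' : Measurable (((fun o : Obs m d => o.2.1) ⁻¹' {a}).indicator
      fun o => F (o.2.2, o.1)) := Measurable.indicator (by fun_prop) hA
  rw [Measure.lintegral_compProd hF, lintegral_map hF (by fun_prop),
    lintegral_map (hF.lintegral_kernel_prod_right' (κ := outcomeKernelAt Q a)) (by fun_prop),
    ← lintegral_indicator hA, lintegral_eq_lintegral_outcomeLaw Q hF',
    ← lintegral_indicator hA]
  refine lintegral_congr fun o => ?_
  by_cases hoa : o.2.1 = a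
  · have h1 : ∀ y, (y, o.2) ∈ (fun o : Obs m d => o.2.1) ⁻¹' {a} := fun y => hoa
    rw [Set.indicator_of_mem (by simpa using hoa)]
    simp only [Set.indicator_of_mem (h1 _), hoa]
    rfl
  · have h1 : ∀ y, (y, o.2) ∉ (fun o : Obs m d => o.2.1) ⁻¹' {a} := fun y => hoa
    rw [Set.indicator_of_notMem (by simpa using hoa)]
    simp only [Set.indicator_of_notMem (h1 _), lintegral_zero]

/-- By conditional independence, restricting to an arm does not alter the conditional law of the
first coordinate given `X`; hence the kernel here involves no treatment. -/
theorem map_restrict_treatment_compProd_of_condIndepFun {ν : Measure (Obs m d)} [IsFiniteMeasure ν]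
    (h : CondIndepFun (MeasurableSpace.comap (fun t : Obs m d => t.2.2) inferInstance)
      (Measurable.comap_le (by fun_prop)) (fun t : Obs m d => t.1) (fun t => t.2.1) ν)
    (a : Trt m) :
    (ν.restrict ((fun o => o.2.1) ⁻¹' {a})).map (fun o => (o.2.2, o.1)) =
      (ν.restrict ((fun o => o.2.1) ⁻¹' {a})).map (fun o => o.2.2) ⊗ₘ
        condDistrib (fun o : Obs m d => o.1) (fun o => o.2.2) ν := by
  have hA := measurableSet_treatment (m := m) (d := d) a
  set κ := condDistrib (fun o : Obs m d => o.1) (fun o => o.2.2) ν with hκ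
  have h1 := (condIndepFun_iff_condDistrib_prod_ae_eq_prodMkRight (μ := ν)
    (f := fun o : Obs m d => o.1) (g := fun o : Obs m d => o.2.1) (k := fun o : Obs m d => o.2.2)
    (by fun_prop) (by fun_prop) (by fun_prop)).1 h.symm
  have h2 := (condDistrib_ae_eq_iff_measure_eq_compProd _
    (Measurable.aemeasurable (by fun_prop)) _).1 h1
  refine Measure.ext_of_lintegral _ fun F hF => ?_
  have hG : Measurable (({z : ((Fin d → ℝ) × Trt m) × (Fin m → ℝ) | z.1.2 = a}).indicator
      fun z => F (z.1.1, z.2)) := by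
    refine Measurable.indicator (by fun_prop) ?_
    exact (measurable_snd.comp measurable_fst) (measurableSet_singleton a)
  have h3 := congrArg (fun μ => ∫⁻ z, ({z : ((Fin d → ℝ) × Trt m) × (Fin m → ℝ) |
    z.1.2 = a}).indicator (fun z => F (z.1.1, z.2)) z ∂μ) h2
  rw [Measure.lintegral_compProd hG, lintegral_map hG (by fun_prop),
    lintegral_map hG.lintegral_kernel_prod_right' (by fun_prop)] at h3
  rw [Measure.lintegral_compProd hF, lintegral_map hF (by fun_prop),
    lintegral_map (hF.lintegral_kernel_prod_right' (κ := κ)) (by fun_prop),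
    ← lintegral_indicator hA, ← lintegral_indicator hA]
  convert h3 using 1
  · rfl
  refine lintegral_congr fun o => ?_
  by_cases hoa : o.2.1 = a
  · rw [Set.indicator_of_mem (by simpa using hoa)]
    simp only [Set.indicator_apply, Set.mem_ofPred_eq, hoa, if_true]
    rfl
  · rw [Set.indicator_of_notMem (by simpa using hoa)]
    simp only [Set.indicator_apply, Set.mem_ofPred_eq, hoa, if_false, lintegral_zero]

variable {Q : Measure (Obs m d)} [IsFiniteMeasure Q] {w : Trt m → (Fin d → ℝ) → Fin m → ℝ}

/-- On the arm the two joint laws coincide by `hR`, so their disintegrations agree for almost every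
`x` under the law of `X` within the arm. That law has the propensity as density, and positivity
extends the agreement to almost every `x`. -/
theorem integral_potentialOutcome {ν : Measure (Obs m d)} [IsFiniteMeasure ν]
    (hν : CondIndepFun (MeasurableSpace.comap (fun t : Obs m d => t.2.2) inferInstance)
      (Measurable.comap_le (by fun_prop)) (fun t : Obs m d => t.1) (fun t => t.2.1) ν)
    (a : Trt m)
    (hR : ν.restrict ((fun o => o.2.1) ⁻¹' {a}) = Q.restrict ((fun o => o.2.1) ⁻¹' {a}))
    (hX : ν.map (fun o => o.2.2) = covLaw Q) (he : ∀ᵐ x ∂(covLaw Q), 0 < propensity Q a x)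
    (h : HasMoments Q) (hw : ∀ a, Measurable (w a)) {B : ℝ} (hB : ∀ a x, w a x ⬝ᵥ w a x ≤ B) :
    ∫ o, w a o.2.2 ⬝ᵥ o.1 ∂ν = ∫ x, w a x ⬝ᵥ outcomeReg Q a x ∂(covLaw Q) := by
  set κ := condDistrib (fun o : Obs m d => o.1) (fun o => o.2.2) ν with hκ
  have h1 := map_restrict_treatment_compProd_of_condIndepFun hν a
  rw [hR, map_restrict_treatment_compProd] at h1
  have h2 := Kernel.ae_eq_of_compProd_eq h1
  rw [map_restrict_treatment] at h2
  have h3 : outcomeKernelAt Q a =ᵐ[covLaw Q] κ := by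
    have := (ae_withDensity_iff (measurable_propensity Q a).ennreal_ofReal).1 h2
    filter_upwards [this, he] with x hx hx0
    exact hx (ENNReal.ofReal_pos.2 hx0).ne'
  have h4 : ν.map (fun o => (o.2.2, o.1)) = covLaw Q ⊗ₘ outcomeKernelAt Q a := by
    rw [Measure.compProd_congr h3, ← hX]
    exact (compProd_map_condDistrib (by fun_prop)).symm
  have hwa := hw a
  have hF : Measurable fun z : (Fin d → ℝ) × (Fin m → ℝ) => w a z.1 ⬝ᵥ z.2 := by
    unfold dotProduct
    fun_prop
  have iF : Integrable (fun z : (Fin d → ℝ) × (Fin m → ℝ) => w a z.1 ⬝ᵥ z.2)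
      (covLaw Q ⊗ₘ outcomeKernelAt Q a) := by
    rw [Measure.integrable_compProd_iff hF.aestronglyMeasurable]
    constructor
    · filter_upwards [h.memLp a] with x hx
      exact (memLp_dotProduct hx _).integrable one_le_two
    -- No moment of the potential outcome is assumed. Integrability comes from `|wᵀ y| ≤ 1 + (wᵀ y -
    -- wᵀ g)² + |wᵀ g|`, whose mean involves only the conditional variance and the regression.
    · refine (((integrable_const (1 : ℝ)).add (h.integrable_weightedVar hw hB a)).add
        (h.integrable_dotProduct_reg hw hB a).abs).mono'
        (hF.norm.stronglyMeasurable.integral_kernel_prod_right'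
          (κ := outcomeKernelAt Q a)).aestronglyMeasurable ?_
      filter_upwards [h.memLp a] with x hx
      rw [Real.norm_eq_abs, abs_of_nonneg (integral_nonneg fun _ => norm_nonneg _)]
      have m1 := memLp_dotProduct_sub hx (w a x)
      have i1 : Integrable (fun y => 1 + (w a x ⬝ᵥ y - w a x ⬝ᵥ outcomeReg Q a x) ^ 2 +
          |w a x ⬝ᵥ outcomeReg Q a x|) (outcomeLaw Q a x) :=
        ((integrable_const (1 : ℝ)).add m1.integrable_sq).add (integrable_const _)
      have i2 : Integrable (fun y => ‖w a x ⬝ᵥ y‖) (outcomeLaw Q a x) :=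
        ((memLp_dotProduct hx _).integrable one_le_two).norm
      have i3 : Integrable (fun y => 1 + (w a x ⬝ᵥ y - w a x ⬝ᵥ outcomeReg Q a x) ^ 2)
          (outcomeLaw Q a x) := (integrable_const (1 : ℝ)).add m1.integrable_sq
      refine (integral_mono i2 i1 fun y => ?_).trans_eq ?_
      · simp only [Real.norm_eq_abs]
        have h1 : |w a x ⬝ᵥ y| ≤ |w a x ⬝ᵥ y - w a x ⬝ᵥ outcomeReg Q a x| +
            |w a x ⬝ᵥ outcomeReg Q a x| := by
          simpa using abs_add_le (w a x ⬝ᵥ y - w a x ⬝ᵥ outcomeReg Q a x)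
            (w a x ⬝ᵥ outcomeReg Q a x)
        have h2 := sq_abs (w a x ⬝ᵥ y - w a x ⬝ᵥ outcomeReg Q a x)
        nlinarith [sq_nonneg (|w a x ⬝ᵥ y - w a x ⬝ᵥ outcomeReg Q a x| - 1)]
      · rw [integral_add i3 (integrable_const _),
          integral_add (integrable_const _) m1.integrable_sq]
        simp [weightedVar]
  have h5 : ∫ o, w a o.2.2 ⬝ᵥ o.1 ∂ν =
      ∫ z, w a z.1 ⬝ᵥ z.2 ∂(ν.map fun o => (o.2.2, o.1)) :=
    (integral_map (φ := fun o : Obs m d => (o.2.2, o.1)) (by fun_prop)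
      hF.aestronglyMeasurable).symm
  rw [h5, h4, Measure.integral_compProd iF]
  refine integral_congr_ae ?_
  filter_upwards [h.memLp a] with x hx
  exact integral_dotProduct hx _

end Identification

section CausalParameter

variable {K : ℕ} {M d : Fin K → ℕ} {Ω : Type*} [MeasurableSpace Ω] (ρ : Measure Ω)
  [IsProbabilityMeasure ρ] (C : Cluster M d Ω)

theorem Cluster.lawGiven_observedLaw (k : Fin K) :
    lawGiven (C.observedLaw ρ) k =
      (ρ[|C.L ⁻¹' {k}]).map fun ω => (C.Y k ω, C.A k ω, C.X k ω) := by
  have hm : Measurable fun ω => (C.Y k ω, C.A k ω, C.X k ω) :=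
    (C.measurable_Y k).prodMk ((C.measurable_A k).prodMk (C.measurable_X k))
  have hL : MeasurableSet (C.L ⁻¹' {k}) := C.measurable_L (measurableSet_singleton k)
  have e0 : C.obs ⁻¹' (Sigma.fst ⁻¹' {k}) = C.L ⁻¹' {k} := rfl
  ext s hs
  have hs' : MeasurableSet (ofType k '' s : Set (Data M d)) :=
    (measurableEmbedding_ofType k).measurableSet_image.2 hs
  rw [lawGiven, (measurableEmbedding_ofType k).comap_apply, cond_apply (measurableSet_fst k),
    Measure.map_apply hm hs, cond_apply hL]
  have e1 : ((C.observedLaw ρ : ProbabilityMeasure (Data M d)) : Measure (Data M d)) =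
    ρ.map C.obs := rfl
  rw [e1, Measure.map_apply C.measurable_obs (measurableSet_fst k),
    Measure.map_apply C.measurable_obs ((measurableSet_fst k).inter hs'), Set.preimage_inter, e0]
  congr 2
  ext ω
  simp only [Set.mem_inter_iff, Set.mem_preimage, Set.mem_singleton_iff, Set.mem_image]
  constructor
  · rintro ⟨h1, o, ho, h2⟩
    subst h1
    refine ⟨rfl, ?_⟩
    have : o = (C.Y (C.L ω) ω, C.A (C.L ω) ω, C.X (C.L ω) ω) := ofType_injective _ h2
    rwa [← this]
  · rintro ⟨h1, h2⟩
    subst h1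
    exact ⟨rfl, _, h2, rfl⟩

theorem Cluster.thetaOf_lawGiven {P : ProbabilityMeasure (Data M d)} (hP : P = C.observedLaw ρ)
    {k : Fin K} (hk : 0 < typeProb P k) (consistency : C.Consistency ρ)
    (ignorability : C.Ignorability ρ) (overlap : Overlap P) (moments : Moments P)
    {w : ∀ k, Trt (M k) → (Fin (d k) → ℝ) → Fin (M k) → ℝ}
    (hw_meas : ∀ a, Measurable (w k a)) {B : ℝ} (hB : ∀ a x, w k a x ⬝ᵥ w k a x ≤ B) :
    thetaOf (lawGiven P k) (w k) = C.theta ρ w k := by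
  have hL : MeasurableSet (C.L ⁻¹' {k}) := C.measurable_L (measurableSet_singleton k)
  have hQ : lawGiven P k = (ρ[|C.L ⁻¹' {k}]).map fun ω => (C.Y k ω, C.A k ω, C.X k ω) := by
    rw [hP, C.lawGiven_observedLaw ρ]
  have hmY := C.measurable_Y k
  have hmA := C.measurable_A k
  have hmX := C.measurable_X k
  obtain ⟨c, hc, hov⟩ := overlap
  unfold thetaOf Cluster.theta
  refine Finset.sum_congr rfl fun a _ => ?_
  have hmP := C.measurable_Ypot k a
  have hA := measurableSet_treatment (m := M k) (d := d k) a
  have hcons : ∀ᵐ ω ∂(ρ[|C.L ⁻¹' {k}]), C.Y k ω = C.Ypot k (C.A k ω) ω := by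
    have h1 : ∀ᵐ ω ∂(ρ[|C.L ⁻¹' {k}]), C.Y (C.L ω) ω = C.Ypot (C.L ω) (C.A (C.L ω) ω) ω :=
      cond_absolutelyContinuous.ae_le consistency
    filter_upwards [h1, ae_cond_mem hL] with ω hω hk'
    have : C.L ω = k := hk'
    subst this
    exact hω
  have key := integral_potentialOutcome (Q := lawGiven P k) (ignorability k a) a ?_ ?_
    ((hov k a).mono fun x hx => hc.trans hx.1) (moments_iff.1 moments k) hw_meas hB
  · rw [← key, integral_map (by fun_prop)]
    have h1 := hw_meas a
    refine Measurable.aestronglyMeasurable ?_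
    unfold dotProduct
    fun_prop
  · have hm1 : Measurable fun ω => (C.Ypot k a ω, C.A k ω, C.X k ω) := by fun_prop
    have hm2 : Measurable fun ω => (C.Y k ω, C.A k ω, C.X k ω) := by fun_prop
    rw [hQ, Measure.restrict_map hm1 hA, Measure.restrict_map hm2 hA]
    refine Measure.map_congr ?_
    rw [EventuallyEq, ae_restrict_iff' (hm1 hA)]
    filter_upwards [hcons] with ω hω hωa
    have : C.A k ω = a := hωa
    rw [hω, this]
  · rw [covLaw, hQ, Measure.map_map (by fun_prop) (by fun_prop),
      Measure.map_map (by fun_prop) (by fun_prop)]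
    rfl

end CausalParameter

/-! ### Bounded changes of measure -/

section ChangeOfMeasure

variable {Ω : Type*} [MeasurableSpace Ω] {ν : Measure Ω} {u : Ω → ℝ}

theorem withDensity_ofReal_le_two_smul (h : ∀ ω, u ω ≤ 2) :
    ν.withDensity (fun ω => ENNReal.ofReal (u ω)) ≤ (2 : ℝ≥0∞) • ν := by
  rw [← withDensity_const]
  refine withDensity_mono (ae_of_all _ fun ω => ?_)
  simpa using ENNReal.ofReal_le_ofReal (h ω)

theorem integral_withDensity_ofReal_le [IsFiniteMeasure ν] (h : ∀ ω, u ω ≤ 2) {F : Ω → ℝ}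
    (hF : Integrable F ν) (h0 : ∀ ω, 0 ≤ F ω) :
    ∫ ω, F ω ∂(ν.withDensity fun ω => ENNReal.ofReal (u ω)) ≤ 2 * ∫ ω, F ω ∂ν := by
  have h1 := integral_mono_measure (withDensity_ofReal_le_two_smul (ν := ν) h)
    (ae_of_all _ h0) (hF.smul_measure (by norm_num))
  rw [integral_smul_measure] at h1
  simpa using h1

theorem integrable_withDensity_ofReal {F : Ω → ℝ} (hF : Integrable F ν) (h : ∀ ω, u ω ≤ 2) :
    Integrable F (ν.withDensity fun ω => ENNReal.ofReal (u ω)) :=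
  (hF.smul_measure (c := 2) (by norm_num)).mono_measure (withDensity_ofReal_le_two_smul h)

theorem memLp_withDensity_ofReal {F : Ω → ℝ} (hF : MemLp F 2 ν) (h : ∀ ω, u ω ≤ 2) :
    MemLp F 2 (ν.withDensity fun ω => ENNReal.ofReal (u ω)) :=
  (hF.smul_measure (c := 2) (by norm_num)).mono_measure (withDensity_ofReal_le_two_smul h)

variable [IsProbabilityMeasure ν]

/-- The shift of the mean is the `ν`-mean of `(u - 1) (f - c)`, where `c` is the mean of `f`, and
`|u - 1| ≤ 1`. So bounded tilting moves a mean by at most one standard deviation. -/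
theorem sq_integral_withDensity_sub_le (hu : Measurable u) (hu0 : ∀ ω, 0 ≤ u ω)
    (hu2 : ∀ ω, u ω ≤ 2) (hu1 : ∫ ω, u ω ∂ν = 1) {f : Ω → ℝ} (hf : MemLp f 2 ν) :
    (∫ ω, f ω ∂(ν.withDensity fun ω => ENNReal.ofReal (u ω)) - ∫ ω, f ω ∂ν) ^ 2 ≤ Var[f; ν] := by
  set c := ∫ ω, f ω ∂ν with hc
  have hfc : MemLp (fun ω => f ω - c) 2 ν := hf.sub (memLp_const c)
  have hub : ∀ ω, |u ω - 1| ≤ 1 := fun ω => by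
    rw [abs_le]; constructor <;> linarith [hu0 ω, hu2 ω]
  have hg : MemLp (fun ω => (u ω - 1) * (f ω - c)) 2 ν := by
    refine hfc.mono ((hu.sub_const 1).aestronglyMeasurable.mul hfc.1) (ae_of_all _ fun ω => ?_)
    rw [norm_mul]
    exact mul_le_of_le_one_left (norm_nonneg _) (hub ω)
  have iu : Integrable u ν := by
    refine (integrable_const (2 : ℝ)).mono' hu.aestronglyMeasurable (ae_of_all _ fun ω => ?_)
    rw [Real.norm_eq_abs, abs_of_nonneg (hu0 ω)]
    exact hu2 ω
  have iuf : Integrable (fun ω => u ω * f ω) ν :=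
    (hf.integrable one_le_two).bdd_mul (c := 2) hu.aestronglyMeasurable
      (ae_of_all _ fun ω => by rw [Real.norm_eq_abs, abs_of_nonneg (hu0 ω)]; exact hu2 ω)
  have e : ∫ ω, f ω ∂(ν.withDensity fun ω => ENNReal.ofReal (u ω)) - c =
      ∫ ω, (u ω - 1) * (f ω - c) ∂ν := by
    have e1 : ∀ ω, (u ω - 1) * (f ω - c) = u ω * f ω - f ω - (c * u ω - c) := fun ω => by ring
    have i1 : Integrable (fun ω => u ω * f ω - f ω) ν := iuf.sub (hf.integrable one_le_two)
    have i2 : Integrable (fun ω => c * u ω - c) ν := (iu.const_mul c).sub (integrable_const c)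
    simp_rw [e1]
    rw [integral_sub i1 i2, integral_sub iuf (hf.integrable one_le_two),
      integral_sub (iu.const_mul c) (integrable_const c), integral_const_mul, hu1,
      integral_withDensity_eq_integral_toReal_smul hu.ennreal_ofReal (ae_of_all _ fun _ =>
        ENNReal.ofReal_lt_top)]
    simp [ENNReal.toReal_ofReal (hu0 _), ← hc]
  rw [e, variance_eq_integral hf.1.aemeasurable]
  have h1 := variance_nonneg (fun ω => (u ω - 1) * (f ω - c)) ν
  rw [variance_eq_sub hg] at h1
  have h2 : ∫ ω, ((u ω - 1) * (f ω - c)) ^ 2 ∂ν ≤ ∫ ω, (f ω - c) ^ 2 ∂ν := by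
    refine integral_mono hg.integrable_sq hfc.integrable_sq fun ω => ?_
    simp only [mul_pow]
    exact mul_le_of_le_one_left (sq_nonneg _) ((sq_le_one_iff_abs_le_one _).2 (hub ω))
  simp only [Pi.pow_apply] at h1
  linarith

theorem isProbabilityMeasure_withDensity_ofReal (hu0 : ∀ ω, 0 ≤ u ω) (hu : Integrable u ν)
    (hu1 : ∫ ω, u ω ∂ν = 1) :
    IsProbabilityMeasure (ν.withDensity fun ω => ENNReal.ofReal (u ω)) := by
  constructor
  rw [withDensity_apply _ MeasurableSet.univ, Measure.restrict_univ,
    ← ofReal_integral_eq_lintegral_ofReal hu (ae_of_all _ hu0), hu1, ENNReal.ofReal_one]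

/-- Centring at the old mean can only increase the second moment under the new law, and the density
is at most `2`. -/
theorem variance_withDensity_le (hu : Measurable u) (hu0 : ∀ ω, 0 ≤ u ω)
    (hu2 : ∀ ω, u ω ≤ 2) (hu1 : ∫ ω, u ω ∂ν = 1) {f : Ω → ℝ} (hf : MemLp f 2 ν) :
    Var[f; ν.withDensity fun ω => ENNReal.ofReal (u ω)] ≤ 2 * Var[f; ν] := by
  have iu : Integrable u ν := by
    refine (integrable_const (2 : ℝ)).mono' hu.aestronglyMeasurable (ae_of_all _ fun ω => ?_)
    rw [Real.norm_eq_abs, abs_of_nonneg (hu0 ω)]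
    exact hu2 ω
  have := isProbabilityMeasure_withDensity_ofReal hu0 iu hu1
  have hfc : MemLp (fun ω => f ω - ∫ ω, f ω ∂ν) 2 ν := hf.sub (memLp_const _)
  have h1 := variance_le_expectation_sq (μ := ν.withDensity fun ω => ENNReal.ofReal (u ω))
    (memLp_withDensity_ofReal hfc hu2).1
  rw [variance_sub_const (memLp_withDensity_ofReal hf hu2).1] at h1
  refine h1.trans ?_
  rw [variance_eq_integral hf.1.aemeasurable]
  exact integral_withDensity_ofReal_le hu2 hfc.integrable_sq fun ω => sq_nonneg _

theorem abs_covariance_le {f g : Ω → ℝ} (hf : MemLp f 2 ν) (hg : MemLp g 2 ν) :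
    |cov[f, g; ν]| ≤ Var[f; ν] + Var[g; ν] := by
  have h1 := abs_integral_mul_le_l2 (hf.sub (memLp_const (∫ ω, f ω ∂ν)))
    (hg.sub (memLp_const (∫ ω, g ω ∂ν)))
  have h2 := l2_sq (μ := ν) (f - fun _ => ∫ ω, f ω ∂ν)
  have h3 := l2_sq (μ := ν) (g - fun _ => ∫ ω, g ω ∂ν)
  rw [variance_eq_integral hf.1.aemeasurable, variance_eq_integral hg.1.aemeasurable]
  simp only [Pi.sub_apply] at h1 h2 h3
  rw [← h2, ← h3]
  refine h1.trans ?_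
  nlinarith [sq_nonneg (l2 ν (f - fun _ => ∫ ω, f ω ∂ν) - l2 ν (g - fun _ => ∫ ω, g ω ∂ν)),
    sq_nonneg (l2 ν (f - fun _ => ∫ ω, f ω ∂ν)), sq_nonneg (l2 ν (g - fun _ => ∫ ω, g ω ∂ν))]

end ChangeOfMeasure

/-! ### Perturbations of the laws of the covariates and of the outcomes -/

section Tilt

variable {m d : ℕ}

/-- `Q'` has the density `u₁(X) u₂(O)` with respect to `Q`, where `u₁`, `u₂` are bounded away from
`0` and `∞`, and `u₂` changes only the conditional law of `Y` given `A`, `X`. -/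
structure IsTilt (Q Q' : Measure (Obs m d)) [IsFiniteMeasure Q] (u₁ : (Fin d → ℝ) → ℝ)
    (u₂ : Obs m d → ℝ) : Prop where
  eq_withDensity : Q' = Q.withDensity fun o => ENNReal.ofReal (u₁ o.2.2 * u₂ o)
  measurable_cov : Measurable u₁
  measurable_out : Measurable u₂
  cov_pos : ∀ x, 0 < u₁ x
  cov_le : ∀ x, u₁ x ≤ 2
  out_pos : ∀ o, 0 < u₂ o
  out_le : ∀ o, u₂ o ≤ 2
  integral_out : ∀ a x, ∫ y, u₂ (y, a, x) ∂(outcomeLaw Q a x) = 1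

namespace IsTilt

variable {Q Q' : Measure (Obs m d)} [IsFiniteMeasure Q] [IsFiniteMeasure Q']
  {u₁ : (Fin d → ℝ) → ℝ} {u₂ : Obs m d → ℝ} (t : IsTilt Q Q' u₁ u₂)
include t

theorem lintegral_eq {F : Obs m d → ℝ≥0∞} (hF : Measurable F) :
    ∫⁻ o, F o ∂Q' = ∫⁻ o, ENNReal.ofReal (u₁ o.2.2) *
      ∫⁻ y, ENNReal.ofReal (u₂ (y, o.2)) * F (y, o.2) ∂(outcomeLaw Q o.2.1 o.2.2) ∂Q := by
  have m1 := t.measurable_cov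
  have m2 := t.measurable_out
  have hm : Measurable fun o : Obs m d => ENNReal.ofReal (u₁ o.2.2 * u₂ o) := by fun_prop
  rw [t.eq_withDensity, lintegral_withDensity_eq_lintegral_mul _ hm hF,
    lintegral_eq_lintegral_outcomeLaw Q (hm.mul hF)]
  refine lintegral_congr fun o => ?_
  rw [← lintegral_const_mul _ (by fun_prop)]
  refine lintegral_congr fun y => ?_
  simp only [Pi.mul_apply]
  rw [ENNReal.ofReal_mul (t.cov_pos _).le, mul_assoc]

theorem lintegral_out (a : Trt m) (x : Fin d → ℝ) :
    ∫⁻ y, ENNReal.ofReal (u₂ (y, a, x)) ∂(outcomeLaw Q a x) = 1 := by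
  have m2 := t.measurable_out
  have iu : Integrable (fun y => u₂ (y, a, x)) (outcomeLaw Q a x) := by
    refine (integrable_const (2 : ℝ)).mono' (Measurable.aestronglyMeasurable (by fun_prop))
      (ae_of_all _ fun y => ?_)
    rw [Real.norm_eq_abs, abs_of_nonneg (t.out_pos _).le]
    exact t.out_le _
  rw [← ofReal_integral_eq_lintegral_ofReal iu (ae_of_all _ fun y => (t.out_pos _).le),
    t.integral_out, ENNReal.ofReal_one]

theorem lintegral_snd {F : Trt m × (Fin d → ℝ) → ℝ≥0∞} (hF : Measurable F) :
    ∫⁻ o, F o.2 ∂Q' = ∫⁻ o, ENNReal.ofReal (u₁ o.2.2) * F o.2 ∂Q := by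
  have m2 := t.measurable_out
  rw [t.lintegral_eq (by fun_prop)]
  refine lintegral_congr fun o => ?_
  simp only
  rw [lintegral_mul_const _ (by fun_prop), t.lintegral_out, one_mul]

theorem map_snd : (Q'.map fun o => o.2) =
    (Q.map fun o => o.2).withDensity fun z => ENNReal.ofReal (u₁ z.2) := by
  have m1 := t.measurable_cov
  refine Measure.ext_of_lintegral _ fun F hF => ?_
  rw [lintegral_map hF (by fun_prop), t.lintegral_snd hF,
    lintegral_withDensity_eq_lintegral_mul _ (by fun_prop) hF, lintegral_map _ (by fun_prop)]
  · rfl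
  · exact Measurable.mul (by fun_prop) hF

theorem covLaw_eq : covLaw Q' = (covLaw Q).withDensity fun x => ENNReal.ofReal (u₁ x) := by
  have m1 := t.measurable_cov
  refine Measure.ext_of_lintegral _ fun F hF => ?_
  rw [covLaw, lintegral_map hF (by fun_prop), t.lintegral_snd (F := fun z => F z.2) (by fun_prop),
    lintegral_withDensity_eq_lintegral_mul _ (by fun_prop) hF, covLaw,
    lintegral_map _ (by fun_prop)]
  · rfl
  · exact Measurable.mul (by fun_prop) hF

theorem ae_covLaw {p : (Fin d → ℝ) → Prop} (h : ∀ᵐ x ∂(covLaw Q), p x) :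
    ∀ᵐ x ∂(covLaw Q'), p x := by
  rw [t.covLaw_eq]
  exact (withDensity_absolutelyContinuous _ _).ae_le h

/-- The old outcome kernel reweighted by `u₂` disintegrates the new law, because `u₂` has
conditional mean one; uniqueness of conditional laws then applies. Positivity of `u₁` allows null
sets to be taken with respect to the old law. -/
theorem ae_outcomeLaw_eq : ∀ᵐ z ∂(Q.map fun o => o.2), outcomeLaw Q' z.1 z.2 =
    (outcomeLaw Q z.1 z.2).withDensity fun y => ENNReal.ofReal (u₂ (y, z.1, z.2)) := by
  have m1 := t.measurable_cov
  have m2 := t.measurable_out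
  have hf : Measurable (Function.uncurry fun (z : Trt m × (Fin d → ℝ)) (y : Fin m → ℝ) =>
      ENNReal.ofReal (u₂ (y, z))) := by
    unfold Function.uncurry
    fun_prop
  set κ := (outcomeKernel Q).withDensity fun z y => ENNReal.ofReal (u₂ (y, z)) with hκ
  have : IsFiniteKernel κ := Kernel.isFiniteKernel_withDensity_of_bounded _
    (B := ENNReal.ofReal 2) ENNReal.ofReal_ne_top fun z y => ENNReal.ofReal_le_ofReal (t.out_le _)
  have h1 : Q'.map (fun o => (o.2, o.1)) = (Q'.map fun o => o.2) ⊗ₘ κ := by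
    refine Measure.ext_of_lintegral _ fun F hF => ?_
    have mF : Measurable fun z => ∫⁻ y, F (z, y) ∂(κ z) := hF.lintegral_kernel_prod_right' (κ := κ)
    rw [Measure.lintegral_compProd hF, lintegral_map hF (by fun_prop),
      t.lintegral_eq (F := fun o => F (o.2, o.1)) (by fun_prop),
      lintegral_map mF (by fun_prop), t.lintegral_snd mF]
    refine lintegral_congr fun o => ?_
    rw [hκ, Kernel.lintegral_withDensity _ hf _ (by fun_prop)]
    rfl
  have h2 := condDistrib_ae_eq_of_measure_eq_compProd (μ := Q') (fun o : Obs m d => o.2)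
    (Y := fun o : Obs m d => o.1) (Measurable.aemeasurable (by fun_prop)) h1
  rw [t.map_snd] at h2
  have h3 := (ae_withDensity_iff (f := fun z : Trt m × (Fin d → ℝ) => ENNReal.ofReal (u₁ z.2))
    (by fun_prop)).1 h2
  filter_upwards [h3] with z hz
  have h4 := hz (ENNReal.ofReal_pos.2 (t.cov_pos _)).ne'
  rw [hκ, Kernel.withDensity_apply _ hf] at h4
  exact h4

/-- Integrating out `Y` leaves the factor `u₁(X)` alone, which scales the law of `X` and its
restriction to each arm alike. The two propensities are densities of the same measure and so agree
almost everywhere. This keeps the tilted laws in the model with known propensity score. -/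
theorem propensity_eq (a : Trt m) : ∀ᵐ x ∂(covLaw Q'), propensity Q' a x = propensity Q a x := by
  have m1 := t.measurable_cov
  have mQ := measurable_propensity Q a
  have mQ' := measurable_propensity Q' a
  have hA := measurableSet_treatment (m := m) (d := d) a
  have h1 : (covLaw Q').withDensity (fun x => ENNReal.ofReal (propensity Q' a x)) =
      (covLaw Q').withDensity fun x => ENNReal.ofReal (propensity Q a x) := by
    refine Measure.ext_of_lintegral _ fun F hF => ?_
    rw [lintegral_withDensity_eq_lintegral_mul _ (by fun_prop) hF,
      lintegral_withDensity_eq_lintegral_mul _ (by fun_prop) hF]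
    have h2 := setLIntegral_treatment Q' a hF
    have h3 := setLIntegral_treatment Q a (f := fun x => ENNReal.ofReal (u₁ x) * F x)
      (by fun_prop)
    have h4 := t.lintegral_snd (F := fun z => ({z : Trt m × (Fin d → ℝ) | z.1 = a}).indicator
      (fun z => F z.2) z)
      (Measurable.indicator (by fun_prop) (measurable_fst (measurableSet_singleton a)))
    have h5 : ∫⁻ o in (fun o : Obs m d => o.2.1) ⁻¹' {a}, F o.2.2 ∂Q' =
        ∫⁻ o in (fun o : Obs m d => o.2.1) ⁻¹' {a}, ENNReal.ofReal (u₁ o.2.2) * F o.2.2 ∂Q := by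
      rw [← lintegral_indicator hA, ← lintegral_indicator hA]
      refine Eq.trans ?_ (h4.trans ?_)
      · rfl
      · refine lintegral_congr fun o => ?_
        by_cases hoa : o.2.1 = a <;> simp [hoa]
    simp only [Pi.mul_apply]
    rw [← h2, h5, h3, t.covLaw_eq, lintegral_withDensity_eq_lintegral_mul _ (by fun_prop)
      (by fun_prop)]
    refine lintegral_congr fun x => ?_
    simp only [Pi.mul_apply]
    ring
  have h2 := (withDensity_eq_iff_of_sigmaFinite (by fun_prop) (by fun_prop)).1 h1
  filter_upwards [h2] with x hx
  have := congrArg ENNReal.toReal hx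
  rwa [ENNReal.toReal_ofReal (propensity_nonneg _ _ _),
    ENNReal.toReal_ofReal (propensity_nonneg _ _ _)] at this

variable (he : ∀ a, ∀ᵐ x ∂(covLaw Q), 0 < propensity Q a x) (h : HasMoments Q)
include he

theorem outcomeLaw_eq (a : Trt m) : ∀ᵐ x ∂(covLaw Q), outcomeLaw Q' a x =
    (outcomeLaw Q a x).withDensity fun y => ENNReal.ofReal (u₂ (y, a, x)) :=
  ae_covLaw_of_ae Q (he a) (p := fun a x => outcomeLaw Q' a x =
    (outcomeLaw Q a x).withDensity fun y => ENNReal.ofReal (u₂ (y, a, x))) t.ae_outcomeLaw_eq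

include h

theorem memLp_outcome (a : Trt m) :
    ∀ᵐ x ∂(covLaw Q), ∀ j, MemLp (fun y => y j) 2 (outcomeLaw Q' a x) := by
  filter_upwards [t.outcomeLaw_eq he a, h.memLp a] with x hx hm j
  rw [hx]
  exact memLp_withDensity_ofReal (hm j) fun y => t.out_le _

/-- The test function is quantified after the null set, so that it may depend on `x`, as the
weighted outcome does. -/
theorem outcome_bounds (a : Trt m) : ∀ᵐ x ∂(covLaw Q), ∀ f : (Fin m → ℝ) → ℝ,
    MemLp f 2 (outcomeLaw Q a x) →
      (∫ y, f y ∂(outcomeLaw Q' a x) - ∫ y, f y ∂(outcomeLaw Q a x)) ^ 2 ≤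
        Var[f; outcomeLaw Q a x] ∧
      Var[f; outcomeLaw Q' a x] ≤ 2 * Var[f; outcomeLaw Q a x] := by
  have m2 := t.measurable_out
  filter_upwards [t.outcomeLaw_eq he a] with x hx f hf
  have mu : Measurable fun y => u₂ (y, a, x) := by fun_prop
  rw [hx]
  exact ⟨sq_integral_withDensity_sub_le mu (fun _ => (t.out_pos _).le) (fun _ => t.out_le _)
    (t.integral_out a x) hf, variance_withDensity_le mu (fun _ => (t.out_pos _).le)
    (fun _ => t.out_le _) (t.integral_out a x) hf⟩

theorem hasMoments : HasMoments Q' := by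
  have hdiag : ∀ a x j, (∀ j, MemLp (fun y : Fin m → ℝ => y j) 2 (outcomeLaw Q a x)) →
      outcomeCov Q a x j j = Var[fun y => y j; outcomeLaw Q a x] := fun a x j hm =>
    covariance_self (hm j).1.aemeasurable
  refine ⟨fun a => t.ae_covLaw (t.memLp_outcome he h a), fun a j => ?_, fun a i j => ?_⟩
  · rw [t.covLaw_eq]
    refine integrable_withDensity_ofReal ?_ t.cov_le
    refine (((h.integrable_reg a j).abs.add (integrable_const (1 : ℝ))).add
      (h.integrable_cov a j j)).mono' (measurable_outcomeReg Q' a j).aestronglyMeasurable ?_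
    filter_upwards [h.memLp a, t.outcome_bounds he h a] with x hm hb
    have h1 := (hb _ (hm j)).1
    rw [← hdiag a x j hm] at h1
    change (outcomeReg Q' a x j - outcomeReg Q a x j) ^ 2 ≤ _ at h1
    simp only [Pi.add_apply, Real.norm_eq_abs]
    have h2 : |outcomeReg Q' a x j| ≤ |outcomeReg Q a x j| +
        |outcomeReg Q' a x j - outcomeReg Q a x j| := by
      simpa using abs_add_le (outcomeReg Q a x j) (outcomeReg Q' a x j - outcomeReg Q a x j)
    have h3 := sq_abs (outcomeReg Q' a x j - outcomeReg Q a x j)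
    nlinarith [sq_nonneg (|outcomeReg Q' a x j - outcomeReg Q a x j| - 1)]
  · rw [t.covLaw_eq]
    refine integrable_withDensity_ofReal ?_ t.cov_le
    refine (((h.integrable_cov a i i).add (h.integrable_cov a j j)).const_mul 2).mono'
      (measurable_outcomeCov Q' a i j).aestronglyMeasurable ?_
    filter_upwards [h.memLp a, t.memLp_outcome he h a, t.outcome_bounds he h a] with x hm hm' hb
    have h1 := (hb _ (hm i)).2
    have h2 := (hb _ (hm j)).2
    rw [← hdiag a x _ hm] at h1 h2
    have h3 := abs_covariance_le (hm' i) (hm' j)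
    simp only [Pi.add_apply, Real.norm_eq_abs]
    refine h3.trans ?_
    linarith

theorem integral_trace_le (a : Trt m) : ∫ x, (outcomeCov Q' a x).trace ∂(covLaw Q') ≤
    4 * ∫ x, (outcomeCov Q a x).trace ∂(covLaw Q) := by
  have hdiag : ∀ (Q : Measure (Obs m d)) [IsFiniteMeasure Q] x j,
      (∀ j, MemLp (fun y : Fin m → ℝ => y j) 2 (outcomeLaw Q a x)) →
      outcomeCov Q a x j j = Var[fun y => y j; outcomeLaw Q a x] := fun Q _ x j hm =>
    covariance_self (hm j).1.aemeasurable
  have i1 := h.integrable_trace a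
  -- The trace is non-negative only almost everywhere; its absolute value serves as a majorant that
  -- is non-negative everywhere. The factor `4` is `2` from the outcome density times `2` from the
  -- covariate density.
  have h1 : ∀ᵐ x ∂(covLaw Q), (outcomeCov Q' a x).trace ≤ 2 * |(outcomeCov Q a x).trace| ∧
      |(outcomeCov Q a x).trace| = (outcomeCov Q a x).trace := by
    filter_upwards [h.memLp a, t.memLp_outcome he h a, t.outcome_bounds he h a] with x hm hm' hb
    have h2 : 0 ≤ (outcomeCov Q a x).trace := Finset.sum_nonneg fun j _ => by
      rw [Matrix.diag_apply, hdiag Q x j hm]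
      exact variance_nonneg _ _
    rw [abs_of_nonneg h2]
    refine ⟨?_, rfl⟩
    simp only [Matrix.trace, Finset.mul_sum]
    refine Finset.sum_le_sum fun j _ => ?_
    rw [Matrix.diag_apply, Matrix.diag_apply, hdiag Q x j hm, hdiag Q' x j hm']
    exact (hb _ (hm j)).2
  have i2 : Integrable (fun x => 2 * |(outcomeCov Q a x).trace|) (covLaw Q) := i1.abs.const_mul 2
  have i3 : Integrable (fun x => 2 * |(outcomeCov Q a x).trace|) (covLaw Q') := by
    rw [t.covLaw_eq]
    exact integrable_withDensity_ofReal i2 t.cov_le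
  refine (integral_mono_ae ((t.hasMoments he h).integrable_trace a) i3
    (t.ae_covLaw (h1.mono fun x hx => hx.1))).trans ?_
  rw [t.covLaw_eq]
  refine (integral_withDensity_ofReal_le t.cov_le i2 fun x => by positivity).trans_eq ?_
  rw [integral_const_mul, integral_congr_ae (h1.mono fun x hx => hx.2)]
  ring

/-- Each regression moves by at most its conditional standard deviation, so Cauchy–Schwarz over the
treatments bounds the squared change of the sum. The resulting bound is the same for all tilts, as
regularity of a submodel requires. -/
theorem memLp_weightedReg {w : Trt m → (Fin d → ℝ) → Fin m → ℝ} (hw : ∀ a, Measurable (w a))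
    {B : ℝ} (hB : ∀ a x, w a x ⬝ᵥ w a x ≤ B) (hW : MemLp (weightedReg Q w) 2 (covLaw Q)) :
    MemLp (weightedReg Q' w) 2 (covLaw Q') ∧
    ∫ x, weightedReg Q' w x ^ 2 ∂(covLaw Q') ≤
      2 * ∫ x, (2 * weightedReg Q w x ^ 2 +
        2 * (Fintype.card (Trt m) * ∑ a, weightedVar Q w a x)) ∂(covLaw Q) := by
  have iV := h.integrable_weightedVar hw hB
  have iW := hW.integrable_sq
  have i1 : Integrable (fun x => 2 * weightedReg Q w x ^ 2 +
      2 * (Fintype.card (Trt m) * ∑ a, weightedVar Q w a x)) (covLaw Q) :=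
    (iW.const_mul 2).add (((integrable_finsetSum _ fun a _ => iV a).const_mul _).const_mul 2)
  have i2 := integrable_withDensity_ofReal i1 t.cov_le
  rw [← t.covLaw_eq] at i2
  have mW' : Measurable (weightedReg Q' w) :=
    Finset.measurable_sum _ fun a _ => measurable_dotProduct_reg Q' hw a
  have key : ∀ᵐ x ∂(covLaw Q), weightedReg Q' w x ^ 2 ≤ 2 * weightedReg Q w x ^ 2 +
      2 * (Fintype.card (Trt m) * ∑ a, weightedVar Q w a x) := by
    filter_upwards [ae_all_iff.2 h.memLp, ae_all_iff.2 (t.memLp_outcome he h),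
      ae_all_iff.2 (t.outcome_bounds he h)] with x hm hm' hb
    have h1 : ∀ a, (w a x ⬝ᵥ outcomeReg Q' a x - w a x ⬝ᵥ outcomeReg Q a x) ^ 2 ≤
        weightedVar Q w a x := fun a => by
      have := (hb a _ (memLp_dotProduct (hm a) (w a x))).1
      rw [variance_eq_integral (memLp_dotProduct (hm a) (w a x)).1.aemeasurable,
        integral_dotProduct (hm' a), integral_dotProduct (hm a)] at this
      exact this
    have h2 : (weightedReg Q' w x - weightedReg Q w x) ^ 2 ≤
        Fintype.card (Trt m) * ∑ a, weightedVar Q w a x := by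
      unfold weightedReg
      rw [← Finset.sum_sub_distrib]
      refine (sq_sum_le_card_mul_sum_sq).trans ?_
      rw [Finset.card_univ]
      exact mul_le_mul_of_nonneg_left (Finset.sum_le_sum fun a _ => h1 a) (Nat.cast_nonneg _)
    nlinarith [sq_nonneg (weightedReg Q' w x - 2 * weightedReg Q w x)]
  refine ⟨(memLp_two_of_sq_le mW' i2 (t.ae_covLaw key)).1, ?_⟩
  refine (integral_mono_of_nonneg (ae_of_all _ fun _ => sq_nonneg _) i2 (t.ae_covLaw key)).trans ?_
  rw [t.covLaw_eq]
  refine integral_withDensity_ofReal_le t.cov_le i1 fun x => ?_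
  have : 0 ≤ ∑ a, weightedVar Q w a x := Finset.sum_nonneg fun a _ => weightedVar_nonneg Q a x
  positivity

end IsTilt

end Tilt

/-! ### One-dimensional submodels with a bounded score -/

section BoundedScore

variable {Z : Type*} [MeasurableSpace Z]

/-- A measure of mass one, as a `ProbabilityMeasure`. -/
def toProbabilityMeasure (μ : Measure Z) (h : IsProbabilityMeasure μ) : ProbabilityMeasure Z :=
  ⟨μ, h⟩

/-- The density `1 + t h₁ + t² h₂`. -/
def quadraticDensity (h₁ h₂ : Z → ℝ) (t : ℝ) (z : Z) : ℝ := 1 + t * h₁ z + t ^ 2 * h₂ z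

/-- `h₁` and `h₂` are bounded by `C` and have mean zero. -/
structure IsBoundedDirection (P : ProbabilityMeasure Z) (h₁ h₂ : Z → ℝ) (C : ℝ) : Prop where
  measurable_fst : Measurable h₁
  measurable_snd : Measurable h₂
  nonneg : 0 ≤ C
  fst_le : ∀ z, |h₁ z| ≤ C
  snd_le : ∀ z, |h₂ z| ≤ C
  integral_fst : ∫ z, h₁ z ∂(P : Measure Z) = 0
  integral_snd : ∫ z, h₂ z ∂(P : Measure Z) = 0

namespace IsBoundedDirection

variable {P : ProbabilityMeasure Z} {h₁ h₂ : Z → ℝ} {C : ℝ} (b : IsBoundedDirection P h₁ h₂ C)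
include b

/-- The half-length of the parameter interval. -/
def radius (_ : IsBoundedDirection P h₁ h₂ C) : ℝ := 1 / (4 * (C + 1))

theorem radius_pos : 0 < b.radius := by
  have := b.nonneg
  unfold radius
  positivity

theorem radius_le_one : b.radius ≤ 1 := by
  have := b.nonneg
  unfold radius
  rw [div_le_one (by positivity)]
  linarith

theorem radius_mul_le : b.radius * C ≤ 1 / 4 := by
  have := b.nonneg
  unfold radius
  rw [div_mul_eq_mul_div, div_le_div_iff₀ (by positivity) (by norm_num)]
  linarith

theorem abs_mul_fst_le {t : ℝ} (ht : |t| < b.radius) (z : Z) : |t * h₁ z| ≤ 1 / 4 := by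
  rw [abs_mul]
  exact (mul_le_mul ht.le (b.fst_le z) (abs_nonneg _) b.radius_pos.le).trans b.radius_mul_le

theorem abs_sq_mul_snd_le {t : ℝ} (ht : |t| < b.radius) (z : Z) : |t ^ 2 * h₂ z| ≤ 1 / 4 := by
  rw [abs_mul, abs_pow, sq, mul_assoc]
  refine (mul_le_of_le_one_left (by positivity) (ht.le.trans b.radius_le_one)).trans ?_
  exact (mul_le_mul ht.le (b.snd_le z) (abs_nonneg _) b.radius_pos.le).trans b.radius_mul_le

theorem half_le_density {t : ℝ} (ht : |t| < b.radius) (z : Z) :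
    1 / 2 ≤ quadraticDensity h₁ h₂ t z := by
  have h1 := (abs_le.1 (b.abs_mul_fst_le ht z)).1
  have h2 := (abs_le.1 (b.abs_sq_mul_snd_le ht z)).1
  unfold quadraticDensity
  linarith

theorem measurable_density (t : ℝ) : Measurable (quadraticDensity h₁ h₂ t) := by
  have := b.measurable_fst
  have := b.measurable_snd
  unfold quadraticDensity
  fun_prop

theorem integrable_of_bound {h : Z → ℝ} (hm : Measurable h) (hb : ∀ z, |h z| ≤ C) :
    Integrable h (P : Measure Z) :=
  (integrable_const C).mono' hm.aestronglyMeasurable (ae_of_all _ hb)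

theorem isProbabilityMeasure_withDensity {t : ℝ} (ht : |t| < b.radius) :
    IsProbabilityMeasure ((P : Measure Z).withDensity fun z =>
      ENNReal.ofReal (quadraticDensity h₁ h₂ t z)) := by
  have i1 := (b.integrable_of_bound b.measurable_fst b.fst_le).const_mul t
  have i2 := (b.integrable_of_bound b.measurable_snd b.snd_le).const_mul (t ^ 2)
  have i3 : Integrable (fun z => 1 + t * h₁ z) (P : Measure Z) := (integrable_const 1).add i1
  refine isProbabilityMeasure_withDensity_ofReal
    (fun z => by linarith [b.half_le_density ht z]) (i3.add i2) ?_
  unfold quadraticDensity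
  rw [integral_add i3 i2, integral_add (integrable_const 1) i1, integral_const_mul,
    integral_const_mul, b.integral_fst, b.integral_snd]
  simp

theorem half_le_sqrt {t : ℝ} (ht : |t| < b.radius) (z : Z) :
    1 / 2 ≤ √(quadraticDensity h₁ h₂ t z) :=
  Real.le_sqrt_of_sq_le (by linarith [b.half_le_density ht z])

/-- Both roots are at least `1/2`, so the difference of the roots is at most that of the densities,
which is `(t' - t) (h₁ + (t + t') h₂)` with `|t + t'| ≤ 2`. -/
theorem abs_sqrt_sub_le {t t' : ℝ} (ht : |t| < b.radius) (ht' : |t'| < b.radius) (z : Z) :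
    |√(quadraticDensity h₁ h₂ t' z) - √(quadraticDensity h₁ h₂ t z)| ≤ 3 * C * |t' - t| := by
  have r := b.half_le_sqrt ht z
  have r' := b.half_le_sqrt ht' z
  have s := Real.sq_sqrt (by linarith [b.half_le_density ht z] : 0 ≤ quadraticDensity h₁ h₂ t z)
  have s' := Real.sq_sqrt (by linarith [b.half_le_density ht' z] :
    0 ≤ quadraticDensity h₁ h₂ t' z)
  set x := √(quadraticDensity h₁ h₂ t z)
  set x' := √(quadraticDensity h₁ h₂ t' z)
  have e : (x' - x) * (x' + x) = (t' - t) * (h₁ z + (t + t') * h₂ z) := by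
    have : (x' - x) * (x' + x) = x' ^ 2 - x ^ 2 := by ring
    rw [this, s, s', quadraticDensity, quadraticDensity]
    ring
  have h1 : |x' - x| ≤ |x' - x| * |x' + x| :=
    le_mul_of_one_le_right (abs_nonneg _) (by rw [abs_of_nonneg (by linarith)]; linarith)
  rw [← abs_mul, e, abs_mul] at h1
  have h2 : |t + t'| ≤ 2 := by
    have := abs_add_le t t'
    have := b.radius_le_one
    linarith
  have h3 : |h₁ z + (t + t') * h₂ z| ≤ 3 * C := by
    have h4 := abs_add_le (h₁ z) ((t + t') * h₂ z)
    rw [abs_mul] at h4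
    have h5 := mul_le_mul h2 (b.snd_le z) (abs_nonneg _) (by norm_num)
    linarith [b.fst_le z]
  rw [mul_comm (3 * C)]
  exact h1.trans (mul_le_mul_of_nonneg_left h3 (abs_nonneg _))

/-- The derivative of the root density. -/
def rootDeriv (_ : IsBoundedDirection P h₁ h₂ C) (t : ℝ) (z : Z) : ℝ :=
  (h₁ z + 2 * t * h₂ z) / (2 * √(quadraticDensity h₁ h₂ t z))

theorem abs_numerator_le {t : ℝ} (ht : |t| < b.radius) (z : Z) :
    |h₁ z + 2 * t * h₂ z| ≤ 3 * C := by
  have h4 := abs_add_le (h₁ z) (2 * t * h₂ z)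
  have h5 : |2 * t * h₂ z| ≤ 2 * C := by
    rw [abs_mul, abs_mul, abs_two]
    have := b.radius_le_one
    have := mul_le_mul (ht.le.trans this) (b.snd_le z) (abs_nonneg _) zero_le_one
    linarith
  linarith [b.fst_le z]

/-- With `x`, `x'` the two roots, the remainder equals `((t' - t)² h₂ - (x' - x)²) / (2 x)` exactly.
Both terms are quadratic in `t' - t`, the second by the Lipschitz bound. -/
theorem abs_remainder_le {t t' : ℝ} (ht : |t| < b.radius) (ht' : |t'| < b.radius) (z : Z) :
    |√(quadraticDensity h₁ h₂ t' z) - √(quadraticDensity h₁ h₂ t z) -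
      (t' - t) * b.rootDeriv t z| ≤ (9 * C ^ 2 + C) * (t' - t) ^ 2 := by
  have r := b.half_le_sqrt ht z
  have s := Real.sq_sqrt (by linarith [b.half_le_density ht z] : 0 ≤ quadraticDensity h₁ h₂ t z)
  have s' := Real.sq_sqrt (by linarith [b.half_le_density ht' z] :
    0 ≤ quadraticDensity h₁ h₂ t' z)
  have hd := b.abs_sqrt_sub_le ht ht' z
  unfold rootDeriv
  set x := √(quadraticDensity h₁ h₂ t z)
  set x' := √(quadraticDensity h₁ h₂ t' z)
  have hx : x ≠ 0 := by linarith
  have e1 : (t' - t) * (h₁ z + 2 * t * h₂ z) = x' ^ 2 - x ^ 2 - (t' - t) ^ 2 * h₂ z := by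
    rw [s, s', quadraticDensity, quadraticDensity]
    ring
  have e : x' - x - (t' - t) * ((h₁ z + 2 * t * h₂ z) / (2 * x)) =
      ((t' - t) ^ 2 * h₂ z - (x' - x) ^ 2) / (2 * x) := by
    rw [← mul_div_assoc, e1]
    field_simp
    ring
  have h1 : |(t' - t) ^ 2 * h₂ z - (x' - x) ^ 2| ≤ (9 * C ^ 2 + C) * (t' - t) ^ 2 := by
    have h2 : (x' - x) ^ 2 ≤ (3 * C * |t' - t|) ^ 2 := by
      rw [← sq_abs (x' - x)]
      exact pow_le_pow_left₀ (abs_nonneg _) hd 2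
    rw [mul_pow, sq_abs] at h2
    have h3 : |(t' - t) ^ 2 * h₂ z| ≤ (t' - t) ^ 2 * C := by
      rw [abs_mul, abs_of_nonneg (sq_nonneg _)]
      exact mul_le_mul_of_nonneg_left (b.snd_le z) (sq_nonneg _)
    have h4 := abs_sub ((t' - t) ^ 2 * h₂ z) ((x' - x) ^ 2)
    rw [abs_of_nonneg (sq_nonneg (x' - x))] at h4
    nlinarith
  rw [e, abs_div, abs_of_nonneg (by linarith : 0 ≤ 2 * x)]
  exact (div_le_self (abs_nonneg _) (by linarith)).trans h1

theorem abs_rootDeriv_sub_le {t t' : ℝ} (ht : |t| < b.radius) (ht' : |t'| < b.radius) (z : Z) :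
    |b.rootDeriv t' z - b.rootDeriv t z| ≤ (2 * C + 18 * C ^ 2) * |t' - t| := by
  have r := b.half_le_sqrt ht z
  have r' := b.half_le_sqrt ht' z
  have hd := b.abs_sqrt_sub_le ht ht' z
  have hn := b.abs_numerator_le ht z
  have hC := b.nonneg
  unfold rootDeriv
  set x := √(quadraticDensity h₁ h₂ t z)
  set x' := √(quadraticDensity h₁ h₂ t' z)
  have hx : x ≠ 0 := by linarith
  have hx' : x' ≠ 0 := by linarith
  have e : (h₁ z + 2 * t' * h₂ z) / (2 * x') - (h₁ z + 2 * t * h₂ z) / (2 * x) =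
      2 * ((t' - t) * h₂ z) / (2 * x') - (h₁ z + 2 * t * h₂ z) * (x' - x) / (2 * x * x') := by
    field_simp
    ring
  have h1 : |2 * ((t' - t) * h₂ z) / (2 * x')| ≤ 2 * (|t' - t| * C) := by
    rw [abs_div, abs_of_nonneg (by linarith : 0 ≤ 2 * x')]
    refine (div_le_self (abs_nonneg _) (by linarith)).trans ?_
    rw [abs_mul, abs_mul, abs_two]
    have := mul_le_mul_of_nonneg_left (b.snd_le z) (abs_nonneg (t' - t))
    linarith
  have h2 : |(h₁ z + 2 * t * h₂ z) * (x' - x) / (2 * x * x')| ≤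
      2 * (3 * C * (3 * C * |t' - t|)) := by
    rw [abs_div, abs_mul, abs_of_nonneg (by positivity : 0 ≤ 2 * x * x'),
      div_le_iff₀ (by positivity)]
    have h3 := mul_le_mul hn hd (abs_nonneg _) (by linarith)
    have h4 : 1 ≤ 2 * (2 * x * x') := by nlinarith
    have h5 : 0 ≤ 3 * C * (3 * C * |t' - t|) := by positivity
    nlinarith
  rw [e]
  refine (abs_sub _ _).trans ?_
  nlinarith

theorem measurable_rootDeriv (t : ℝ) : Measurable (b.rootDeriv t) := by
  have := b.measurable_fst
  have := b.measurable_snd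
  have := b.measurable_density t
  unfold rootDeriv
  fun_prop

theorem abs_rootDeriv_le {t : ℝ} (ht : |t| < b.radius) (z : Z) : |b.rootDeriv t z| ≤ 3 * C := by
  have r := b.half_le_sqrt ht z
  unfold rootDeriv
  rw [abs_div, abs_of_nonneg (by linarith : 0 ≤ 2 * √(quadraticDensity h₁ h₂ t z))]
  exact (div_le_self (abs_nonneg _) (by linarith)).trans (b.abs_numerator_le ht z)

theorem integral_sq_le {f : Z → ℝ} {c : ℝ} (h : ∀ z, |f z| ≤ c) :
    ∫ z, f z ^ 2 ∂(P : Measure Z) ≤ c ^ 2 := by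
  have h1 := integral_mono_of_nonneg (μ := (P : Measure Z)) (ae_of_all _ fun z => sq_nonneg (f z))
    (integrable_const (c ^ 2)) (ae_of_all _ fun z => by
      simp only
      rw [← sq_abs]
      exact pow_le_pow_left₀ (abs_nonneg _) (h z) 2)
  simpa using h1

open Classical in
/-- The law with density `1 + t h₁ + t² h₂` with respect to `P`, for small `t`. -/
def law (t : ℝ) : ProbabilityMeasure Z :=
  if h : |t| < b.radius then
    toProbabilityMeasure ((P : Measure Z).withDensity fun z =>
      ENNReal.ofReal (quadraticDensity h₁ h₂ t z)) (b.isProbabilityMeasure_withDensity h)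
  else P

theorem law_eq {t : ℝ} (ht : |t| < b.radius) : (b.law t : Measure Z) =
    (P : Measure Z).withDensity fun z => ENNReal.ofReal (quadraticDensity h₁ h₂ t z) := by
  unfold law
  rw [dif_pos ht]
  rfl

theorem law_zero : b.law 0 = P := by
  ext1
  rw [b.law_eq (by simpa using b.radius_pos)]
  simp [quadraticDensity]

/-- The submodel with the densities `1 + t h₁ + t² h₂`, `|t|` small, with respect to `P`. -/
def submodel : SmoothSubmodel P where
  dim := 1
  dim_pos := one_pos
  param := {η | |η 0| < b.radius}
  isOpen_param := isOpen_lt (by fun_prop) continuous_const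
  η₀ := 0
  η₀_mem := by simpa using b.radius_pos
  law η := b.law (η 0)
  law_η₀ := b.law_zero
  μ := P
  sigmaFinite_μ := inferInstance
  -- The maximum provides non-negativity at all parameter values; it is inactive on the parameter
  -- set, where the density is at least `1/2`.
  dens η z := max (quadraticDensity h₁ h₂ (η 0) z) 0
  measurable_dens η := (b.measurable_density _).max measurable_const
  dens_nonneg η z := le_max_right _ _
  law_eq η hη := by
    rw [b.law_eq hη]
    congr 1
    ext z
    rw [max_eq_left (by linarith [b.half_le_density hη z])]
  ψ η _ z := b.rootDeriv (η 0) z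
  memLp_ψ η hη _ := MemLp.of_bound (b.measurable_rootDeriv _).aestronglyMeasurable (3 * C)
    (ae_of_all _ (b.abs_rootDeriv_le hη))
  meanSquare_diff η hη := by
    have hnorm : ∀ η' : EuclideanSpace ℝ (Fin 1), ‖η' - η‖ ^ 2 = (η' 0 - η 0) ^ 2 := fun η' => by
      rw [EuclideanSpace.norm_sq_eq]
      simp
    have hopen : ∀ᶠ η' : EuclideanSpace ℝ (Fin 1) in 𝓝[≠] η, |η' 0| < b.radius :=
      nhdsWithin_le_nhds ((isOpen_lt (by fun_prop) continuous_const).mem_nhds hη)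
    have hlim : Tendsto (fun η' : EuclideanSpace ℝ (Fin 1) =>
        (9 * C ^ 2 + C) ^ 2 * (η' 0 - η 0) ^ 2) (𝓝[≠] η) (𝓝 0) := by
      have : Continuous fun η' : EuclideanSpace ℝ (Fin 1) =>
        (9 * C ^ 2 + C) ^ 2 * (η' 0 - η 0) ^ 2 := by fun_prop
      have h := (this.tendsto η).mono_left (nhdsWithin_le_nhds (s := {η}ᶜ))
      simpa using h
    refine squeeze_zero' (Eventually.of_forall fun η' => by positivity) ?_ hlim
    filter_upwards [hopen] with η' hη'
    rw [hnorm]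
    refine div_le_of_le_mul₀ (sq_nonneg _) (by positivity) ?_
    have h1 : ∀ z, |√(max (quadraticDensity h₁ h₂ (η' 0) z) 0) -
        √(max (quadraticDensity h₁ h₂ (η 0) z) 0) -
        ∑ j : Fin 1, (η' j - η j) * b.rootDeriv (η 0) z| ≤
        (9 * C ^ 2 + C) * (η' 0 - η 0) ^ 2 := fun z => by
      have h2 := b.half_le_density hη z
      have h3 := b.half_le_density hη' z
      rw [max_eq_left (by linarith), max_eq_left (by linarith), Fin.sum_univ_one]
      exact b.abs_remainder_le hη hη' z
    refine (b.integral_sq_le h1).trans_eq ?_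
    ring
  meanSquare_cont η hη _ := by
    have hopen : ∀ᶠ η' : EuclideanSpace ℝ (Fin 1) in 𝓝 η, |η' 0| < b.radius :=
      (isOpen_lt (by fun_prop) continuous_const).mem_nhds hη
    have hlim : Tendsto (fun η' : EuclideanSpace ℝ (Fin 1) =>
        ((2 * C + 18 * C ^ 2) * |η' 0 - η 0|) ^ 2) (𝓝 η) (𝓝 0) := by
      have : Continuous fun η' : EuclideanSpace ℝ (Fin 1) =>
        ((2 * C + 18 * C ^ 2) * |η' 0 - η 0|) ^ 2 := by fun_prop
      simpa using this.tendsto η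
    refine squeeze_zero' (Eventually.of_forall fun η' => by positivity) ?_ hlim
    filter_upwards [hopen] with η' hη'
    exact b.integral_sq_le (b.abs_rootDeriv_sub_le hη hη')

theorem submodel_score (j : Fin b.submodel.dim) (z : Z) : b.submodel.score j z = h₁ z := by
  simp [SmoothSubmodel.score, submodel, rootDeriv, quadraticDensity]
  ring

theorem submodel_information_det :
    b.submodel.information.det = ∫ z, h₁ z ^ 2 ∂(P : Measure Z) := by
  refine (Matrix.det_fin_one _).trans ?_
  simp only [SmoothSubmodel.information, b.submodel_score, sq]
  rfl

end IsBoundedDirection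

end BoundedScore

/-! ### Bounded directions in the tangent space of one cluster type -/

/-- Since `f` has mean zero, the left side is the variance of `f - g`. Recentring a truncation
therefore does not worsen the approximation. -/
theorem integral_sub_center_sq_le {Ω : Type*} [MeasurableSpace Ω] {ν : Measure Ω}
    [IsProbabilityMeasure ν] {f g : Ω → ℝ} (hf : MemLp f 2 ν) (hg : MemLp g 2 ν)
    (h0 : ∫ ω, f ω ∂ν = 0) :
    ∫ ω, (f ω - (g ω - ∫ ω, g ω ∂ν)) ^ 2 ∂ν ≤ ∫ ω, (f ω - g ω) ^ 2 ∂ν := by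
  have hD := hf.sub hg
  have h1 := variance_le_expectation_sq (μ := ν) hD.1
  rw [variance_eq_integral hD.1.aemeasurable] at h1
  have e : ∫ ω, (f - g) ω ∂ν = - ∫ ω, g ω ∂ν := by
    simp only [Pi.sub_apply]
    rw [integral_sub (hf.integrable one_le_two) (hg.integrable one_le_two), h0, zero_sub]
  rw [e] at h1
  refine le_trans (le_of_eq ?_) h1
  exact integral_congr_ae (ae_of_all _ fun ω => by simp only [Pi.sub_apply]; ring)

section Direction

variable {m d : ℕ}

/-- `b₁(X) + b₂(Y, A, X)` is a bounded score of a perturbation of the law of `X` and of the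
conditional law of `Y` given `A`, `X`. -/
structure IsDirection (Q : Measure (Obs m d)) [IsFiniteMeasure Q] (b₁ : (Fin d → ℝ) → ℝ)
    (b₂ : Obs m d → ℝ) (C : ℝ) : Prop where
  measurable_cov : Measurable b₁
  measurable_out : Measurable b₂
  cov_le : ∀ x, |b₁ x| ≤ C
  out_le : ∀ o, |b₂ o| ≤ C
  integral_cov : ∫ x, b₁ x ∂(covLaw Q) = 0
  integral_out : ∀ a x, ∫ y, b₂ (y, a, x) ∂(outcomeLaw Q a x) = 0

section

variable {Q : Measure (Obs m d)} [IsFiniteMeasure Q]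

theorem IsDirection.mono {b₁ : (Fin d → ℝ) → ℝ} {b₂ : Obs m d → ℝ} {C C' : ℝ}
    (b : IsDirection Q b₁ b₂ C) (h : C ≤ C') : IsDirection Q b₁ b₂ C' :=
  ⟨b.measurable_cov, b.measurable_out, fun x => (b.cov_le x).trans h,
    fun o => (b.out_le o).trans h, b.integral_cov, b.integral_out⟩

theorem IsDirection.const_mul {b₁ : (Fin d → ℝ) → ℝ} {b₂ : Obs m d → ℝ} {C : ℝ}
    (b : IsDirection Q b₁ b₂ C) (u : ℝ) :
    IsDirection Q (fun x => u * b₁ x) (fun o => u * b₂ o) (|u| * C) where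
  measurable_cov := b.measurable_cov.const_mul u
  measurable_out := b.measurable_out.const_mul u
  cov_le x := by rw [abs_mul]; exact mul_le_mul_of_nonneg_left (b.cov_le x) (abs_nonneg u)
  out_le o := by rw [abs_mul]; exact mul_le_mul_of_nonneg_left (b.out_le o) (abs_nonneg u)
  integral_cov := by rw [integral_const_mul, b.integral_cov, mul_zero]
  integral_out a x := by rw [integral_const_mul, b.integral_out, mul_zero]

theorem IsDirection.measurable_add {b₁ : (Fin d → ℝ) → ℝ} {b₂ : Obs m d → ℝ} {C : ℝ}
    (b : IsDirection Q b₁ b₂ C) : Measurable fun o : Obs m d => b₁ o.2.2 + b₂ o := by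
  have := b.measurable_cov
  have := b.measurable_out
  fun_prop

theorem IsDirection.memLp {b₁ : (Fin d → ℝ) → ℝ} {b₂ : Obs m d → ℝ} {C : ℝ}
    (b : IsDirection Q b₁ b₂ C) : MemLp (fun o : Obs m d => b₁ o.2.2 + b₂ o) 2 Q :=
  MemLp.of_bound b.measurable_add.aestronglyMeasurable (C + C)
    (ae_of_all _ fun _ => (abs_add_le _ _).trans (add_le_add (b.cov_le _) (b.out_le _)))

end

variable {Q : Measure (Obs m d)} [IsProbabilityMeasure Q] {w : Trt m → (Fin d → ℝ) → Fin m → ℝ}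

theorem exists_clip {Ω : Type*} [MeasurableSpace Ω] {μ : Measure Ω} {f : Ω → ℝ}
    (hf : MemLp f 2 μ) {ε : ℝ} (hε : 0 < ε) :
    ∃ N : ℝ, 0 ≤ N ∧ ∫ ω, (f ω - max (-N) (min (f ω) N)) ^ 2 ∂μ < ε := by
  obtain ⟨N, hN, h⟩ := exists_l2_sub_clip_lt hf (g := fun _ => 1) measurable_const
    (fun _ => zero_le_one) (ae_of_all _ fun _ h => absurd h one_ne_zero) (Real.sqrt_pos.2 hε)
  refine ⟨N, hN, ?_⟩
  have h1 : l2 μ (fun ω => f ω - clip N (fun _ => 1) f ω) ^ 2 < √ε ^ 2 :=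
    pow_lt_pow_left₀ h (l2_nonneg _) two_ne_zero
  rw [l2_sq, Real.sq_sqrt hε.le] at h1
  simpa [clip] using h1

theorem abs_integral_le_of_abs_le {Ω : Type*} [MeasurableSpace Ω] {ν : Measure Ω}
    [IsProbabilityMeasure ν] {f : Ω → ℝ} {N : ℝ} (hf : ∀ ω, |f ω| ≤ N) : |∫ ω, f ω ∂ν| ≤ N := by
  have := norm_integral_le_of_norm_le_const (μ := ν) (f := f) (C := N) (ae_of_all _ hf)
  simpa using this

theorem abs_max_min_le {N : ℝ} (hN : 0 ≤ N) (r : ℝ) : |max (-N) (min r N)| ≤ N :=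
  abs_le.2 ⟨le_max_left _ _, max_le (by linarith) (min_le_right _ _)⟩

/-- The regression part is truncated and centred under the law of `X`, the residual is truncated and
centred under the conditional law of the outcome. No function of `(A, X)` with mean zero given `X`
is needed, that is, no perturbation of the propensity score. -/
theorem exists_isDirection_integral_sq_lt (h : HasMoments Q) (hw : ∀ a, Measurable (w a)) {B : ℝ}
    (hB : ∀ a x, w a x ⬝ᵥ w a x ≤ B) (hW : MemLp (weightedReg Q w) 2 (covLaw Q)) {c : ℝ}
    (hc : 0 < c) (he : ∀ a, ∀ᵐ o ∂Q, c < propensity Q a o.2.2) {ε : ℝ} (hε : 0 < ε) :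
    ∃ b₁ b₂ C, 0 ≤ C ∧ IsDirection Q b₁ b₂ C ∧
      ∫ o, (phi Q w (thetaOf Q w) o - (b₁ o.2.2 + b₂ o)) ^ 2 ∂Q < ε := by
  set θ := thetaOf Q w with hθ
  set r : Obs m d → ℝ := fun o => (w o.2.1 o.2.2 ⬝ᵥ o.1 -
    w o.2.1 o.2.2 ⬝ᵥ outcomeReg Q o.2.1 o.2.2) / propensity Q o.2.1 o.2.2 with hr
  set D : (Fin d → ℝ) → ℝ := fun x => weightedReg Q w x - θ with hD
  have mD : MemLp D 2 (covLaw Q) := hW.sub (memLp_const θ)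
  have mr : MemLp r 2 Q := memLp_scaledResidual h hw hB hW hc he
  have hDm : Measurable D := (Finset.measurable_sum _ fun a _ =>
    measurable_dotProduct_reg Q hw a).sub_const θ
  have hrm : Measurable r := by
    have e : r = fun o => phi Q w 0 o - weightedReg Q w o.2.2 := funext fun o => by
      rw [phi_apply]; ring
    rw [e]
    exact (measurable_phi hw 0).sub ((Finset.measurable_sum _ fun a _ =>
      measurable_dotProduct_reg Q hw a).comp (by fun_prop : Measurable fun o : Obs m d => o.2.2))
  obtain ⟨N₁, hN₁, h₁⟩ := exists_clip mD (by linarith : 0 < ε / 4)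
  obtain ⟨N₂, hN₂, h₂⟩ := exists_clip mr (by linarith : 0 < ε / 4)
  set g₁ : (Fin d → ℝ) → ℝ := fun x => max (-N₁) (min (D x) N₁) with hg₁
  set g₂ : Obs m d → ℝ := fun o => max (-N₂) (min (r o) N₂) with hg₂
  have mg₁ : Measurable g₁ := by fun_prop
  have mg₂ : Measurable g₂ := by fun_prop
  have Lg₁ : MemLp g₁ 2 (covLaw Q) := MemLp.of_bound mg₁.aestronglyMeasurable N₁
    (ae_of_all _ fun x => abs_max_min_le hN₁ _)
  have Lg₂ : ∀ z, MemLp (fun y => g₂ (y, z)) 2 (outcomeKernel Q z) := fun z =>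
    MemLp.of_bound (Measurable.aestronglyMeasurable (by fun_prop)) N₂
      (ae_of_all _ fun x => abs_max_min_le hN₂ _)
  set b₁ : (Fin d → ℝ) → ℝ := fun x => g₁ x - ∫ x, g₁ x ∂(covLaw Q) with hb₁
  -- Centring by the chosen version of the conditional law makes the conditional mean zero at every
  -- `(a, x)`, not just almost everywhere, as a direction requires.
  set b₂ : Obs m d → ℝ := fun o => g₂ o - ∫ y, g₂ (y, o.2) ∂(outcomeKernel Q o.2) with hb₂
  have mI : Measurable fun z => ∫ y, g₂ (y, z) ∂(outcomeKernel Q z) :=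
    (Measurable.stronglyMeasurable (by fun_prop : Measurable fun p :
      (Trt m × (Fin d → ℝ)) × (Fin m → ℝ) => g₂ (p.2, p.1))).integral_kernel_prod_right'.measurable
  have mb₂ : Measurable b₂ := mg₂.sub (mI.comp measurable_snd)
  have bb₁ : ∀ x, |b₁ x| ≤ 2 * (N₁ + N₂) := fun x => by
    have h1 := abs_max_min_le hN₁ (D x)
    have h2 := abs_integral_le_of_abs_le (ν := covLaw Q) (f := g₁) (N := N₁)
      fun x => abs_max_min_le hN₁ _
    have h3 := abs_sub (g₁ x) (∫ x, g₁ x ∂(covLaw Q))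
    have h4 : |g₁ x| ≤ N₁ := h1
    simp only [hb₁]
    linarith
  have bb₂ : ∀ o, |b₂ o| ≤ 2 * (N₁ + N₂) := fun o => by
    have h1 := abs_max_min_le hN₂ (r o)
    have h2 := abs_integral_le_of_abs_le (ν := outcomeKernel Q o.2) (f := fun y => g₂ (y, o.2))
      (N := N₂) fun x => abs_max_min_le hN₂ _
    have h3 := abs_sub (g₂ o) (∫ y, g₂ (y, o.2) ∂(outcomeKernel Q o.2))
    have h4 : |g₂ o| ≤ N₂ := h1
    simp only [hb₂]
    linarith
  refine ⟨b₁, b₂, 2 * (N₁ + N₂), by positivity, ⟨mg₁.sub_const _, mb₂, bb₁, bb₂, ?_, ?_⟩, ?_⟩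
  · rw [hb₁, integral_sub (Lg₁.integrable one_le_two) (integrable_const _)]
    simp
  · intro a x
    have := integral_sub ((Lg₂ (a, x)).integrable one_le_two)
      (integrable_const (∫ y, g₂ (y, a, x) ∂(outcomeKernel Q (a, x))))
    refine this.trans ?_
    simp
  · have d1 : ∫ o : Obs m d, (D o.2.2 - b₁ o.2.2) ^ 2 ∂Q < ε / 4 := by
      rw [← integral_covLaw Q (f := fun x => (D x - b₁ x) ^ 2)
        (Measurable.aestronglyMeasurable (by fun_prop))]
      refine (integral_sub_center_sq_le mD Lg₁ ?_).trans_lt h₁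
      rw [hD, integral_sub (hW.integrable one_le_two) (integrable_const _),
        integral_weightedReg h hw hB]
      simp [hθ]
    have Lb₂ : MemLp b₂ 2 Q := MemLp.of_bound mb₂.aestronglyMeasurable _ (ae_of_all _ bb₂)
    have Lb₁ : MemLp (fun o : Obs m d => b₁ o.2.2) 2 Q :=
      MemLp.of_bound (Measurable.aestronglyMeasurable (by fun_prop)) _ (ae_of_all _ fun o => bb₁ _)
    have Lg₂' : MemLp g₂ 2 Q := MemLp.of_bound mg₂.aestronglyMeasurable N₂
      (ae_of_all _ fun x => abs_max_min_le hN₂ _)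
    have LD : MemLp (fun o : Obs m d => D o.2.2) 2 Q :=
      memLp_weightedReg_sub h hw hB hW hc he θ
    have L1 : MemLp (fun o : Obs m d => D o.2.2 - b₁ o.2.2) 2 Q := LD.sub Lb₁
    have L2 : MemLp (fun o => r o - b₂ o) 2 Q := mr.sub Lb₂
    have L3 : MemLp (fun o => r o - max (-N₂) (min (r o) N₂)) 2 Q := mr.sub Lg₂'
    have d2 : ∫ o, (r o - b₂ o) ^ 2 ∂Q < ε / 4 := by
      refine lt_of_le_of_lt ?_ h₂
      rw [integral_eq_integral_outcomeLaw Q L2.integrable_sq,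
        integral_eq_integral_outcomeLaw Q L3.integrable_sq]
      refine integral_mono_ae (integrable_integral_outcomeLaw Q L2.integrable_sq)
        (integrable_integral_outcomeLaw Q L3.integrable_sq) ?_
      filter_upwards [ae_integrable_outcomeLaw Q mr.integrable_sq,
        integral_residual_outcomeLaw (w := w) h] with o hsq h0
      have Lr : MemLp (fun y => r (y, o.2)) 2 (outcomeLaw Q o.2.1 o.2.2) :=
        (memLp_two_iff_integrable_sq (Measurable.aestronglyMeasurable (by fun_prop))).2 hsq
      exact integral_sub_center_sq_le Lr (Lg₂ o.2) h0
    have i1 := (L1.integrable_sq.const_mul 2).add (L2.integrable_sq.const_mul 2)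
    calc ∫ o, (phi Q w θ o - (b₁ o.2.2 + b₂ o)) ^ 2 ∂Q
        ≤ ∫ o : Obs m d, (2 * (D o.2.2 - b₁ o.2.2) ^ 2 + 2 * (r o - b₂ o) ^ 2) ∂Q := by
          refine integral_mono_of_nonneg (ae_of_all _ fun _ => sq_nonneg _) i1
            (ae_of_all _ fun o => ?_)
          have e : phi Q w θ o = r o + D o.2.2 := phi_apply θ o
          simp only [e]
          nlinarith [sq_nonneg ((D o.2.2 - b₁ o.2.2) - (r o - b₂ o))]
      _ = 2 * ∫ o : Obs m d, (D o.2.2 - b₁ o.2.2) ^ 2 ∂Q + 2 * ∫ o, (r o - b₂ o) ^ 2 ∂Q := by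
          rw [← integral_const_mul, ← integral_const_mul]
          exact integral_add (L1.integrable_sq.const_mul 2) (L2.integrable_sq.const_mul 2)
      _ < ε := by linarith

/-- A cluster without units has a single treatment vector, of probability one, against the upper
overlap bound. -/
theorem nonempty_of_overlap {c : ℝ} (hc : 0 < c)
    (he : ∀ a, ∀ᵐ x ∂(covLaw Q), propensity Q a x < 1 - c) : Nonempty (Fin m) := by
  by_contra hm
  have hm' : IsEmpty (Fin m) := not_nonempty_iff.1 hm
  obtain ⟨x, hx⟩ := (ae_all_iff.2 he).exists
  have h1 := sum_propensity Q x
  rw [Fintype.sum_unique] at h1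
  have h2 := h1.symm.trans_lt (hx _)
  linarith

/-- An influence function with suitable weights is nonzero because the outcome covariance is
positive definite, and an approximation with error smaller than its own norm cannot vanish. The
given weights may be zero, so others are used. -/
theorem exists_isDirection_integral_sq_pos (h : HasMoments Q) {c : ℝ} (hc : 0 < c)
    (he : ∀ a, ∀ᵐ x ∂(covLaw Q), c < propensity Q a x ∧ propensity Q a x < 1 - c)
    (hpos : ∀ a, ∀ᵐ x ∂(covLaw Q), (outcomeCov Q a x).PosDef) :
    ∃ b₁ b₂ C, 0 ≤ C ∧ IsDirection Q b₁ b₂ C ∧ 0 < ∫ o, (b₁ o.2.2 + b₂ o) ^ 2 ∂Q := by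
  obtain ⟨j⟩ := nonempty_of_overlap hc fun a => (he a).mono fun x hx => hx.2
  have he' : ∀ a, ∀ᵐ o ∂Q, c < propensity Q a o.2.2 := fun a =>
    ae_of_ae_covLaw Q ((he a).mono fun x hx => hx.1)
  set s : (Fin d → ℝ) → ℝ := fun x => ∑ a, outcomeReg Q a x j with hs
  have ms : Measurable s := Finset.measurable_sum _ fun a _ => measurable_outcomeReg Q a j
  have hs1 : ∀ x, 0 < 1 + |s x| := fun x => by positivity
  -- Selects one unit and divides by `1 + |s|`, so that the weighted regression is bounded by one
  -- and square integrable without further assumption.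
  set w : Trt m → (Fin d → ℝ) → Fin m → ℝ := fun _ x => Pi.single j (1 / (1 + |s x|)) with hw
  have mw : ∀ a, Measurable (w a) := fun a => by
    refine measurable_pi_iff.2 fun i => ?_
    by_cases hi : i = j
    · subst hi
      simp only [hw, Pi.single_eq_same]
      fun_prop
    · simp only [hw, Pi.single_eq_of_ne hi]
      fun_prop
  have hB : ∀ a x, w a x ⬝ᵥ w a x ≤ 1 := fun a x => by
    simp only [hw, single_dotProduct, Pi.single_eq_same]
    have : 1 / (1 + |s x|) ≤ 1 := by
      rw [div_le_one (hs1 x)]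
      linarith [abs_nonneg (s x)]
    have h0 : 0 ≤ 1 / (1 + |s x|) := (one_div_pos.2 (hs1 x)).le
    nlinarith
  have hreg : ∀ x, weightedReg Q w x = s x / (1 + |s x|) := fun x => by
    simp only [weightedReg, hw, single_dotProduct, hs, ← Finset.mul_sum]
    ring
  have hW : MemLp (weightedReg Q w) 2 (covLaw Q) := by
    refine MemLp.of_bound (Finset.measurable_sum _ fun a _ =>
      measurable_dotProduct_reg Q mw a).aestronglyMeasurable 1 (ae_of_all _ fun x => ?_)
    rw [hreg, Real.norm_eq_abs, abs_div, abs_of_pos (hs1 x), div_le_one (hs1 x)]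
    linarith
  have hφ : 0 < ∫ o, phi Q w (thetaOf Q w) o ^ 2 ∂Q := by
    rw [integral_phi_sq_eq_add h mw hB hW hc he']
    have iV := integrable_finsetSum Finset.univ fun a _ =>
      integrable_weightedVar_div h mw hB hW hc he' a
    have h0 : ∀ᵐ x ∂(covLaw Q), 0 < ∑ a, weightedVar Q w a x / propensity Q a x := by
      filter_upwards [ae_all_iff.2 h.memLp, ae_all_iff.2 he, ae_all_iff.2 hpos] with x h1 h2 h3
      refine Finset.sum_pos (fun a _ => div_pos ?_ (hc.trans (h2 a).1)) Finset.univ_nonempty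
      rw [weightedVar_eq (h1 a)]
      have h4 : w a x ≠ 0 := by
        simp only [hw, ne_eq, Pi.single_eq_zero_iff]
        exact (one_div_pos.2 (hs1 x)).ne'
      simpa using (h3 a).dotProduct_mulVec_pos h4
    refine add_pos_of_pos_of_nonneg ?_ (integral_nonneg fun _ => sq_nonneg _)
    refine lt_of_le_of_ne (integral_nonneg_of_ae (h0.mono fun x hx => hx.le)) fun h1 => ?_
    have h2 := (integral_eq_zero_iff_of_nonneg_ae (h0.mono fun x hx => hx.le) iV).1 h1.symm
    obtain ⟨x, hx1, hx2⟩ := (h0.and h2).exists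
    exact hx1.ne' hx2
  obtain ⟨b₁, b₂, C, hC, b, hb⟩ :=
    exists_isDirection_integral_sq_lt h mw hB hW hc he' hφ
  refine ⟨b₁, b₂, C, hC, b, lt_of_le_of_ne (integral_nonneg fun _ => sq_nonneg _) fun h1 => ?_⟩
  have h2 := (integral_eq_zero_iff_of_nonneg (fun _ => sq_nonneg _) b.memLp.integrable_sq).1 h1.symm
  refine hb.ne (integral_congr_ae ?_)
  filter_upwards [h2] with o ho
  have : b₁ o.2.2 + b₂ o = 0 := by simpa using ho
  rw [this, sub_zero]

end Direction

/-! ### Regular submodels with a given bounded score -/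

section Submodels

variable {K : ℕ} {M d : Fin K → ℕ} {P : ProbabilityMeasure (Data M d)}

/-- A family of functions of the observations, one for each type, as a function of `(L, O)`. -/
def onTypes (f : ∀ k, Obs (M k) (d k) → ℝ) (z : Data M d) : ℝ := f z.1 z.2

theorem onTypes_ofType (f : ∀ k, Obs (M k) (d k) → ℝ) (k : Fin K) (o : Obs (M k) (d k)) :
    onTypes f (ofType k o) = f k o := rfl

/-- The score composed of the directions of the types. -/
def sumDirection (b₁ : ∀ k, (Fin (d k) → ℝ) → ℝ) (b₂ : ∀ k, Obs (M k) (d k) → ℝ) :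
    Data M d → ℝ := onTypes fun k o => b₁ k o.2.2 + b₂ k o

/-- The second-order term of the density `(1 + t b₁) (1 + t b₂)`. -/
def prodDirection (b₁ : ∀ k, (Fin (d k) → ℝ) → ℝ) (b₂ : ∀ k, Obs (M k) (d k) → ℝ) :
    Data M d → ℝ := onTypes fun k o => b₁ k o.2.2 * b₂ k o

variable (hp_pos : ∀ k, 0 < typeProb P k) {b₁ : ∀ k, (Fin (d k) → ℝ) → ℝ}
  {b₂ : ∀ k, Obs (M k) (d k) → ℝ} {C : ℝ} (hC : 0 ≤ C)
  (b : ∀ k, IsDirection (lawGiven P k) (b₁ k) (b₂ k) C)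

include hp_pos b

theorem memLp_sumDirection : MemLp (sumDirection b₁ b₂) 2 (P : Measure (Data M d)) := by
  refine memLp_data (fun k => (b k).measurable_add) fun k => ?_
  have := isProbabilityMeasure_lawGiven (hp_pos k)
  exact (memLp_comap_ofType_iff (hp_pos k) (b k).measurable_add).2 (b k).memLp

include hC

/-- The density `(1 + t b₁) (1 + t b₂)` has the sum as first-order and the product as second-order
term. The product has mean zero too, since `b₁` depends on `X` only and `b₂` has mean zero given
`(A, X)`. -/
theorem isBoundedDirection :
    IsBoundedDirection P (sumDirection b₁ b₂) (prodDirection b₁ b₂) (2 * C + C ^ 2) := by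
  have m1 : ∀ k, Measurable fun o => sumDirection b₁ b₂ (ofType k o) := fun k =>
    (b k).measurable_add
  have m2 : ∀ k, Measurable fun o => prodDirection b₁ b₂ (ofType k o) := fun k => by
    have := (b k).measurable_cov
    have := (b k).measurable_out
    unfold prodDirection
    simp only [onTypes_ofType]
    fun_prop
  have l1 : ∀ z, |sumDirection b₁ b₂ z| ≤ 2 * C + C ^ 2 := fun ⟨k, o⟩ => by
    have h := (abs_add_le (b₁ k o.2.2) (b₂ k o)).trans
      (add_le_add ((b k).cov_le _) ((b k).out_le _))
    change |b₁ k o.2.2 + b₂ k o| ≤ _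
    nlinarith
  have l2 : ∀ z, |prodDirection b₁ b₂ z| ≤ 2 * C + C ^ 2 := fun ⟨k, o⟩ => by
    change |b₁ k o.2.2 * b₂ k o| ≤ _
    rw [abs_mul]
    have := mul_le_mul ((b k).cov_le o.2.2) ((b k).out_le o) (abs_nonneg _) hC
    nlinarith
  have hm1 := measurable_data m1
  have hm2 := measurable_data m2
  have hi : ∀ k, ∫ o, b₂ k o ∂(lawGiven P k) = 0 ∧
      ∫ o, b₁ k o.2.2 * b₂ k o ∂(lawGiven P k) = 0 := by
    intro k
    have c1 := (b k).measurable_cov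
    have c2 := (b k).measurable_out
    have i1 : Integrable (b₂ k) (lawGiven P k) :=
      (integrable_const C).mono' c2.aestronglyMeasurable (ae_of_all _ (b k).out_le)
    have i2 : Integrable (fun o => b₁ k o.2.2 * b₂ k o) (lawGiven P k) :=
      i1.bdd_mul (c := C) (Measurable.aestronglyMeasurable (by fun_prop))
        (ae_of_all _ fun o => (b k).cov_le _)
    rw [integral_eq_integral_outcomeLaw _ i1, integral_eq_integral_outcomeLaw _ i2]
    constructor
    · refine integral_eq_zero_of_ae (ae_of_all _ fun o => (b k).integral_out _ _)
    · refine integral_eq_zero_of_ae (ae_of_all _ fun o => ?_)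
      simp only
      rw [integral_const_mul]
      exact mul_eq_zero_of_right _ ((b k).integral_out _ _)
  refine ⟨hm1, hm2, by positivity, l1, l2, ?_, ?_⟩
  · rw [integral_data ((integrable_const _).mono' hm1.aestronglyMeasurable (ae_of_all _ l1))]
    refine Finset.sum_eq_zero fun k _ => ?_
    have := isProbabilityMeasure_lawGiven (hp_pos k)
    have c1 := (b k).measurable_cov
    have c2 := (b k).measurable_out
    have i1 : Integrable (b₂ k) (lawGiven P k) :=
      (integrable_const C).mono' c2.aestronglyMeasurable (ae_of_all _ (b k).out_le)
    have i2 : Integrable (fun o : Obs (M k) (d k) => b₁ k o.2.2) (lawGiven P k) :=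
      (integrable_const C).mono' (Measurable.aestronglyMeasurable (by fun_prop))
        (ae_of_all _ fun o => (b k).cov_le _)
    rw [integral_comap_ofType (hp_pos k)]
    refine mul_eq_zero_of_right _ ?_
    simp only [sumDirection, onTypes_ofType]
    rw [integral_add i2 i1, (hi k).1, ← integral_covLaw _ c1.aestronglyMeasurable,
      (b k).integral_cov, add_zero]
  · rw [integral_data ((integrable_const _).mono' hm2.aestronglyMeasurable (ae_of_all _ l2))]
    refine Finset.sum_eq_zero fun k _ => ?_
    rw [integral_comap_ofType (hp_pos k)]
    exact mul_eq_zero_of_right _ (hi k).2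

variable {t : ℝ} (ht : |t| < (isBoundedDirection hp_pos hC b).radius)
include ht

theorem comap_law_eq (k : Fin K) :
    (((isBoundedDirection hp_pos hC b).law t : ProbabilityMeasure (Data M d)) :
      Measure (Data M d)).comap (ofType k) = ENNReal.ofReal (typeProb P k) •
      (lawGiven P k).withDensity fun o =>
        ENNReal.ofReal ((1 + t * b₁ k o.2.2) * (1 + t * b₂ k o)) := by
  rw [(isBoundedDirection hp_pos hC b).law_eq ht, comap_withDensity, comap_ofType_eq (hp_pos k),
    withDensity_smul_measure]
  congr 2
  ext o
  congr 1
  simp only [quadraticDensity, sumDirection, prodDirection, onTypes_ofType]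
  ring

theorem abs_mul_le_half {x : ℝ} (hx : |x| ≤ C) : |t * x| ≤ 1 / 4 := by
  have h1 := (isBoundedDirection hp_pos hC b).radius_mul_le
  have h0 := (isBoundedDirection hp_pos hC b).radius_pos
  rw [abs_mul]
  refine (mul_le_mul ht.le hx (abs_nonneg _) h0.le).trans (le_trans ?_ h1)
  refine mul_le_mul_of_nonneg_left ?_ h0.le
  nlinarith

theorem lintegral_tilt_eq_one (k : Fin K) :
    ((lawGiven P k).withDensity fun o =>
      ENNReal.ofReal ((1 + t * b₁ k o.2.2) * (1 + t * b₂ k o))) Set.univ = 1 := by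
  have := isProbabilityMeasure_lawGiven (hp_pos k)
  have c1 := (b k).measurable_cov
  have c2 := (b k).measurable_out
  have i1 : Integrable (b₁ k) (covLaw (lawGiven P k)) :=
    (integrable_const C).mono' c1.aestronglyMeasurable (ae_of_all _ (b k).cov_le)
  have h1 := fun o => abs_le.1 (abs_mul_le_half hp_pos hC b ht ((b k).cov_le o))
  have h2 := fun o => abs_le.1 (abs_mul_le_half hp_pos hC b ht ((b k).out_le o))
  have i2 : ∀ a x, Integrable (fun y => b₂ k (y, a, x)) (outcomeLaw (lawGiven P k) a x) :=
    fun a x => (integrable_const C).mono' (Measurable.aestronglyMeasurable (by fun_prop))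
      (ae_of_all _ fun y => (b k).out_le _)
  rw [withDensity_apply _ MeasurableSet.univ, Measure.restrict_univ,
    lintegral_eq_lintegral_outcomeLaw _ (by fun_prop)]
  have e : ∀ o : Obs (M k) (d k), ∫⁻ y, ENNReal.ofReal ((1 + t * b₁ k (y, o.2).2.2) *
      (1 + t * b₂ k (y, o.2))) ∂(outcomeLaw (lawGiven P k) o.2.1 o.2.2) =
      ENNReal.ofReal (1 + t * b₁ k o.2.2) := by
    intro o
    have i3 : Integrable (fun y => (1 + t * b₁ k o.2.2) * (1 + t * b₂ k (y, o.2.1, o.2.2)))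
        (outcomeLaw (lawGiven P k) o.2.1 o.2.2) :=
      ((integrable_const (1 : ℝ)).add ((i2 o.2.1 o.2.2).const_mul t)).const_mul _
    have e1 := ofReal_integral_eq_lintegral_ofReal i3 (ae_of_all _ fun y => mul_nonneg
      (by linarith [(h1 o.2.2).1]) (by linarith [(h2 (y, o.2.1, o.2.2)).1]))
    rw [integral_const_mul, integral_add (integrable_const _) ((i2 o.2.1 o.2.2).const_mul t),
      integral_const_mul, (b k).integral_out] at e1
    refine e1.symm.trans ?_
    simp
  simp_rw [e]
  have i4 : Integrable (fun x => 1 + t * b₁ k x) (covLaw (lawGiven P k)) :=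
    (integrable_const (1 : ℝ)).add (i1.const_mul t)
  have e2 := (integrable_covLaw_iff (lawGiven P k) i4.1).1 i4
  rw [← ofReal_integral_eq_lintegral_ofReal e2 (ae_of_all _ fun o => by
    have := (h1 o.2.2).1
    simp only [Pi.zero_apply]
    linarith), ← integral_covLaw _ i4.1,
    integral_add (integrable_const _) (i1.const_mul t), integral_const_mul, (b k).integral_cov]
  simp

/-- The tilt has total mass one within each type, so the weights of the types do not move. -/
theorem typeProb_law (k : Fin K) :
    typeProb ((isBoundedDirection hp_pos hC b).law t) k = typeProb P k := by
  have h1 := congrArg (fun μ => μ Set.univ) (comap_law_eq hp_pos hC b ht k)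
  simp only [Measure.smul_apply, smul_eq_mul] at h1
  rw [lintegral_tilt_eq_one hp_pos hC b ht k, (measurableEmbedding_ofType k).comap_apply,
    Set.image_univ, range_ofType, mul_one] at h1
  rw [typeProb, Measure.real, h1, ENNReal.toReal_ofReal (hp_pos k).le]

theorem lawGiven_law (k : Fin K) :
    lawGiven ((isBoundedDirection hp_pos hC b).law t) k = (lawGiven P k).withDensity fun o =>
      ENNReal.ofReal ((1 + t * b₁ k o.2.2) * (1 + t * b₂ k o)) := by
  rw [lawGiven_eq, typeProb_law hp_pos hC b ht, comap_law_eq hp_pos hC b ht, smul_smul,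
    ENNReal.inv_mul_cancel (ENNReal.ofReal_pos.2 (hp_pos k)).ne' ENNReal.ofReal_ne_top, one_smul]

theorem isTilt (k : Fin K) :
    IsTilt (lawGiven P k) (lawGiven ((isBoundedDirection hp_pos hC b).law t) k)
      (fun x => 1 + t * b₁ k x) (fun o => 1 + t * b₂ k o) := by
  have c1 := (b k).measurable_cov
  have c2 := (b k).measurable_out
  have h1 := fun o => abs_le.1 (abs_mul_le_half hp_pos hC b ht ((b k).cov_le o))
  have h2 := fun o => abs_le.1 (abs_mul_le_half hp_pos hC b ht ((b k).out_le o))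
  refine ⟨lawGiven_law hp_pos hC b ht k, by fun_prop, by fun_prop,
    fun x => by linarith [(h1 x).1], fun x => by linarith [(h1 x).2],
    fun x => by linarith [(h2 x).1], fun x => by linarith [(h2 x).2], fun a x => ?_⟩
  have i2 : Integrable (fun y => b₂ k (y, a, x)) (outcomeLaw (lawGiven P k) a x) :=
    (integrable_const C).mono' (Measurable.aestronglyMeasurable (by fun_prop))
      (ae_of_all _ fun y => (b k).out_le _)
  rw [integral_add (integrable_const _) (i2.const_mul t), integral_const_mul, (b k).integral_out]
  simp

omit ht

/-- Every law of the family is a tilt of the law at the truth, and tilts preserve propensity,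
overlap and moments with bounds independent of `t`. Membership in the smaller model serves both
models. -/
theorem submodel_mem_regularSubmodels {p : Fin K → ℝ} (hp : ∀ k, p k = typeProb P k)
    (overlap : Overlap P) (moments : Moments P)
    {w : ∀ k, Trt (M k) → (Fin (d k) → ℝ) → Fin (M k) → ℝ}
    (hw_meas : ∀ k a, Measurable (w k a)) {B : ℝ} (hB : ∀ k a x, w k a x ⬝ᵥ w k a x ≤ B)
    (finite_bound : ∀ k, MemLp (weightedReg (lawGiven P k) (w k)) 2 (covLaw (lawGiven P k)))
    (hpos : ∫ z, sumDirection b₁ b₂ z ^ 2 ∂(P : Measure (Data M d)) ≠ 0) :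
    (isBoundedDirection hp_pos hC b).submodel ∈ regularSubmodels w (modelNPe p P) P := by
  set D := isBoundedDirection hp_pos hC b with hD
  obtain ⟨c, hc, hov⟩ := overlap
  have he : ∀ k a, ∀ᵐ x ∂(covLaw (lawGiven P k)), 0 < propensity (lawGiven P k) a x :=
    fun k a => (hov k a).mono fun x hx => hc.trans hx.1
  have hm := moments_iff.1 moments
  refine ⟨?_, ?_, ?_⟩
  · intro (η : EuclideanSpace ℝ (Fin 1)) hη
    have hη' : |η 0| < D.radius := hη
    have t := isTilt hp_pos hC b hη'
    refine ⟨⟨fun k => (typeProb_law hp_pos hC b hη' k).trans (hp k).symm, ⟨c, hc, fun k a => ?_⟩,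
      moments_iff.2 fun k => (t k).hasMoments (he k) (hm k)⟩, fun k a => (t k).propensity_eq a⟩
    filter_upwards [(t k).propensity_eq a, (t k).ae_covLaw (hov k a)] with x h1 h2
    exact h1.symm ▸ h2
  · rw [D.submodel_information_det]
    exact isUnit_iff_ne_zero.2 hpos
  · set u : ∀ k, Trt (M k) → ℝ := fun k a =>
      4 * ∫ x, (outcomeCov (lawGiven P k) a x).trace ∂(covLaw (lawGiven P k)) with hu
    set r : Fin K → ℝ := fun k => 2 * ∫ x, (2 * weightedReg (lawGiven P k) (w k) x ^ 2 +
      2 * (Fintype.card (Trt (M k)) * ∑ a, weightedVar (lawGiven P k) (w k) a x))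
        ∂(covLaw (lawGiven P k)) with hr
    -- A single constant above all the bounds of all types and treatments; absolute values let each
    -- be dominated by the sum.
    refine ⟨∑ k, (∑ a, |u k a| + |r k|), ?_⟩
    refine mem_of_superset (D.submodel.isOpen_param.mem_nhds D.submodel.η₀_mem)
      fun (η : EuclideanSpace ℝ (Fin 1)) hη k => ?_
    have hη' : |η 0| < D.radius := hη
    have t := isTilt hp_pos hC b hη' k
    have h1 : ∑ a, |u k a| + |r k| ≤ ∑ k, (∑ a, |u k a| + |r k|) :=
      Finset.single_le_sum (f := fun k => ∑ a, |u k a| + |r k|)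
        (fun k _ => by positivity) (Finset.mem_univ k)
    have h2 := t.memLp_weightedReg (he k) (hm k) (hw_meas k) (hB k) (finite_bound k)
    refine ⟨fun a => ?_, h2.1, ?_⟩
    · refine (t.integral_trace_le (he k) (hm k) a).trans (le_trans ?_ h1)
      have h3 : |u k a| ≤ ∑ a, |u k a| :=
        Finset.single_le_sum (f := fun a => |u k a|) (fun a _ => abs_nonneg _) (Finset.mem_univ a)
      have := le_abs_self (u k a)
      have := abs_nonneg (r k)
      linarith
    · refine h2.2.trans (le_trans ?_ h1)
      have h3 : 0 ≤ ∑ a, |u k a| := Finset.sum_nonneg fun a _ => abs_nonneg _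
      have := le_abs_self (r k)
      linarith

end Submodels

/-! ### The influence function lies in the tangent space -/

section Tangent

variable {K : ℕ} {M d : Fin K → ℕ} {P : ProbabilityMeasure (Data M d)}

theorem integral_data_sq (hp_pos : ∀ k, 0 < typeProb P k) {F : Data M d → ℝ}
    (hF : MemLp F 2 (P : Measure (Data M d))) :
    ∫ z, F z ^ 2 ∂(P : Measure (Data M d)) =
      ∑ k, typeProb P k * ∫ o, F (ofType k o) ^ 2 ∂(lawGiven P k) := by
  rw [integral_data hF.integrable_sq]
  exact Finset.sum_congr rfl fun k _ => integral_comap_ofType (hp_pos k) _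

theorem exists_common_bound {b₁ : ∀ k, (Fin (d k) → ℝ) → ℝ} {b₂ : ∀ k, Obs (M k) (d k) → ℝ}
    {C : Fin K → ℝ} (hC : ∀ k, 0 ≤ C k)
    (b : ∀ k, IsDirection (lawGiven P k) (b₁ k) (b₂ k) (C k)) :
    0 ≤ ∑ k, C k ∧ ∀ k, IsDirection (lawGiven P k) (b₁ k) (b₂ k) (∑ k, C k) :=
  ⟨Finset.sum_nonneg fun k _ => hC k, fun k =>
    (b k).mono (Finset.single_le_sum (fun k _ => hC k) (Finset.mem_univ k))⟩

variable {w : ∀ k, Trt (M k) → (Fin (d k) → ℝ) → Fin (M k) → ℝ}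
  {p : Fin K → ℝ} (hp : ∀ k, p k = typeProb P k) (hp_pos : ∀ k, 0 < p k)
  (overlap : Overlap P) (moments : Moments P) (hw_meas : ∀ k a, Measurable (w k a)) {B : ℝ}
  (hB : ∀ k a x, w k a x ⬝ᵥ w k a x ≤ B)
  (finite_bound : ∀ k, MemLp (weightedReg (lawGiven P k) (w k)) 2 (covLaw (lawGiven P k)))

include hp hp_pos overlap moments hw_meas hB finite_bound

/-- Covers the case in which the approximating score vanishes: such a score has singular information
and generates no regular submodel. Here positive definiteness of the covariances is used. -/
theorem regularSubmodels_nonempty (posDef : PosDefCov P) :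
    (regularSubmodels w (modelNPe p P) P).Nonempty := by
  have hk : ∀ k, 0 < typeProb P k := fun k => hp k ▸ hp_pos k
  obtain ⟨c, hc, hov⟩ := id overlap
  have h1 : ∀ k, ∃ b₁ b₂ C, 0 ≤ C ∧ IsDirection (lawGiven P k) b₁ b₂ C ∧
      0 < ∫ o, (b₁ o.2.2 + b₂ o) ^ 2 ∂(lawGiven P k) := fun k => by
    have := isProbabilityMeasure_lawGiven (hk k)
    exact exists_isDirection_integral_sq_pos (moments_iff.1 moments k) hc (hov k) (posDef k)
  choose b₁ b₂ C hC b hb using h1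
  obtain ⟨hC', b'⟩ := exists_common_bound hC b
  refine ⟨_, submodel_mem_regularSubmodels hk hC' b' hp overlap moments hw_meas hB finite_bound ?_⟩
  rw [integral_data_sq hk (memLp_sumDirection hk b')]
  obtain ⟨⟨k, _⟩⟩ : Nonempty (Data M d) := (P : Measure (Data M d)).nonempty_of_neZero
  refine (Finset.sum_pos (fun k _ => mul_pos (hk k) (hb k)) ⟨k, Finset.mem_univ k⟩).ne'

theorem exists_score_approx (posDef : PosDefCov P) {v : Fin K → ℝ → ℝ} {θ : Fin K → ℝ}
    (hθ : ∀ k, θ k = thetaOf (lawGiven P k) (w k)) {φ : Data M d → ℝ}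
    (hφ : ∀ z, φ z = ∑ k, v k (p k) * varphi w P (θ k) k z) {ε : ℝ} (hε : 0 < ε) :
    ∃ S ∈ regularSubmodels w (modelNPe p P) P, ∃ β : Fin S.dim → ℝ,
      ∫ z, (φ z - ∑ j, β j * S.score j z) ^ 2 ∂(P : Measure (Data M d)) < ε := by
  have hk : ∀ k, 0 < typeProb P k := fun k => hp k ▸ hp_pos k
  have mφ := memLp_influence hp hp_pos overlap moments hw_meas hB finite_bound hφ
  obtain ⟨c, hc, hov⟩ := overlap.ae_obs
  set u : Fin K → ℝ := fun k => v k (p k) * (1 / p k) with hu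
  -- Each type is approximated with error `ε / A`, so the total error is at most `(A - 1) ε / A`;
  -- the added one keeps `A` positive and the inequality strict.
  set A : ℝ := ∑ k, typeProb P k * u k ^ 2 + 1 with hA
  have hA0 : 0 < A := by
    have : 0 ≤ ∑ k, typeProb P k * u k ^ 2 :=
      Finset.sum_nonneg fun k _ => mul_nonneg (hk k).le (sq_nonneg _)
    linarith
  have h1 : ∀ k, ∃ b₁ b₂ C, 0 ≤ C ∧ IsDirection (lawGiven P k) b₁ b₂ C ∧
      ∫ o, (phi (lawGiven P k) (w k) (thetaOf (lawGiven P k) (w k)) o -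
        (b₁ o.2.2 + b₂ o)) ^ 2 ∂(lawGiven P k) < ε / A := fun k => by
    have := isProbabilityMeasure_lawGiven (hk k)
    exact exists_isDirection_integral_sq_lt (moments_iff.1 moments k) (hw_meas k) (hB k)
      (finite_bound k) hc (hov k) (div_pos hε hA0)
  choose b₁ b₂ C hC b hb using h1
  obtain ⟨hC', b'⟩ := exists_common_bound (fun k => mul_nonneg (abs_nonneg (u k)) (hC k))
    fun k => by
      have := isProbabilityMeasure_lawGiven (hk k)
      exact (b k).const_mul (u k)
  set h : Data M d → ℝ := sumDirection (fun k x => u k * b₁ k x) (fun k o => u k * b₂ k o) with hh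
  have mh : MemLp h 2 (P : Measure (Data M d)) := memLp_sumDirection hk b'
  have hlt : ∫ z, (φ z - h z) ^ 2 ∂(P : Measure (Data M d)) < ε := by
    have md : MemLp (fun z => φ z - h z) 2 (P : Measure (Data M d)) := mφ.sub mh
    rw [integral_data_sq hk md]
    have e : ∀ k o, (φ (ofType k o) - h (ofType k o)) ^ 2 = u k ^ 2 *
        (phi (lawGiven P k) (w k) (thetaOf (lawGiven P k) (w k)) o -
          (b₁ k o.2.2 + b₂ k o)) ^ 2 := fun k o => by
      rw [influence_ofType hp hφ, hh, sumDirection, onTypes_ofType, hθ k, hu]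
      ring
    simp_rw [e, integral_const_mul]
    calc ∑ k, typeProb P k * (u k ^ 2 * ∫ o, (phi (lawGiven P k) (w k)
          (thetaOf (lawGiven P k) (w k)) o - (b₁ k o.2.2 + b₂ k o)) ^ 2 ∂(lawGiven P k))
        ≤ ∑ k, typeProb P k * u k ^ 2 * (ε / A) := by
          refine Finset.sum_le_sum fun k _ => ?_
          rw [← mul_assoc]
          exact mul_le_mul_of_nonneg_left (hb k).le (mul_nonneg (hk k).le (sq_nonneg _))
      _ = (A - 1) * (ε / A) := by rw [← Finset.sum_mul, hA]; ring
      _ < ε := by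
          have : 0 < ε / A := div_pos hε hA0
          have : A * (ε / A) = ε := by field_simp
          linarith
  by_cases hz : ∫ z, h z ^ 2 ∂(P : Measure (Data M d)) = 0
  -- The approximating score is zero almost surely, so the coefficients zero in any regular submodel
  -- do as well.
  · obtain ⟨S, hS⟩ := regularSubmodels_nonempty hp hp_pos overlap moments hw_meas hB finite_bound
      posDef
    refine ⟨S, hS, 0, ?_⟩
    have h2 := (integral_eq_zero_iff_of_nonneg (fun _ => sq_nonneg _) mh.integrable_sq).1 hz
    refine lt_of_eq_of_lt (integral_congr_ae ?_) hlt
    filter_upwards [h2] with z hz'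
    have : h z = 0 := by simpa using hz'
    simp [this]
  · refine ⟨_, submodel_mem_regularSubmodels hk hC' b' hp overlap moments hw_meas hB
      finite_bound hz, fun _ => 1, ?_⟩
    refine lt_of_eq_of_lt (integral_congr_ae (ae_of_all _ fun z => ?_)) hlt
    simp only [IsBoundedDirection.submodel_score, one_mul]
    rw [Finset.sum_const, Finset.card_univ, Fintype.card_fin]
    change (φ z - 1 • h z) ^ 2 = _
    rw [one_smul]

end Tangent

/-! ### The efficient influence function in the two models -/

section Efficiency

variable {K : ℕ} {M d : Fin K → ℕ} {P : ProbabilityMeasure (Data M d)}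
  {w : ∀ k, Trt (M k) → (Fin (d k) → ℝ) → Fin (M k) → ℝ} {p : Fin K → ℝ}

theorem regularSubmodels_modelNPe_subset :
    regularSubmodels w (modelNPe p P) P ⊆ regularSubmodels w (modelNP M d p) P :=
  fun _ hS => ⟨fun η hη => (hS.1 η hη).1, hS.2⟩

/-- The derivative is established on the larger class of submodels and the approximation is found in
the smaller one, so the conclusion holds for every class in between, in particular for both models.
-/
theorem isEfficientInfluenceFunction_tau (hp : ∀ k, p k = typeProb P k) (hp_pos : ∀ k, 0 < p k)
    (overlap : Overlap P) (moments : Moments P) (posDef : PosDefCov P)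
    (hw_meas : ∀ k a, Measurable (w k a)) {B : ℝ} (hB : ∀ k a x, w k a x ⬝ᵥ w k a x ≤ B)
    (finite_bound : ∀ k, MemLp (weightedReg (lawGiven P k) (w k)) 2 (covLaw (lawGiven P k)))
    {v : Fin K → ℝ → ℝ} {θ : Fin K → ℝ} (hθ : ∀ k, θ k = thetaOf (lawGiven P k) (w k))
    {φ : Data M d → ℝ} (hφ : ∀ z, φ z = ∑ k, v k (p k) * varphi w P (θ k) k z)
    {𝒞 : Set (SmoothSubmodel P)} (h₁ : regularSubmodels w (modelNPe p P) P ⊆ 𝒞)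
    (h₂ : 𝒞 ⊆ regularSubmodels w (modelNP M d p) P) :
    IsEfficientInfluenceFunction 𝒞 (tau w v) φ := by
  -- The derivative estimate needs a non-negative bound on the weights, which `B` need not be when
  -- there are no cluster types.
  have hB' : ∀ k a x, w k a x ⬝ᵥ w k a x ≤ max B 0 := fun k a x =>
    (hB k a x).trans (le_max_left _ _)
  refine ⟨memLp_influence hp hp_pos overlap moments hw_meas hB finite_bound hφ, fun S hS =>
    hasGradientAt_tau hp hp_pos overlap moments hw_meas (le_max_right _ _) hB' finite_bound hφ
      (h₂ hS), fun ε hε => ?_⟩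
  obtain ⟨S, hS, β, hβ⟩ := exists_score_approx hp hp_pos overlap moments hw_meas hB finite_bound
    posDef hθ hφ hε
  exact ⟨S, h₁ hS, β, hβ⟩

end Efficiency

end

end PartialInterference

theorem mainTheorem8 {K : ℕ} {M d : Fin K → ℕ} {Ω : Type*} [MeasurableSpace Ω]
    (ρ : Measure Ω) [IsProbabilityMeasure ρ] (C : PartialInterference.Cluster M d Ω)
    (P : ProbabilityMeasure (PartialInterference.Data M d)) (hP : P = C.observedLaw ρ)
    (p : Fin K → ℝ) (hp : ∀ k, p k = PartialInterference.typeProb P k) (hp_pos : ∀ k, 0 < p k)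
    (consistency : C.Consistency ρ) (ignorability : C.Ignorability ρ)
    (overlap : PartialInterference.Overlap P) (moments : PartialInterference.Moments P)
    (posDef : PartialInterference.PosDefCov P)
    (w : ∀ k, PartialInterference.Trt (M k) → (Fin (d k) → ℝ) → Fin (M k) → ℝ)
    (hw_meas : ∀ k a, Measurable (w k a))
    (hw_bdd : ∃ B : ℝ, ∀ k a x, w k a x ⬝ᵥ w k a x ≤ B)
    (finite_bound : ∀ k, MemLp
      (PartialInterference.weightedReg (PartialInterference.lawGiven P k) (w k)) 2
      (PartialInterference.covLaw (PartialInterference.lawGiven P k)))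
    (v : Fin K → ℝ → ℝ) (θ : Fin K → ℝ) (hθ : ∀ k, θ k = C.theta ρ w k)
    (φ : PartialInterference.Data M d → ℝ)
    (hφ : ∀ z, φ z = ∑ k, v k (p k) * PartialInterference.varphi w P (θ k) k z) :
    PartialInterference.tau w v P = ∑ k, v k (p k) * θ k ∧
    PartialInterference.IsEfficientInfluenceFunction
      (PartialInterference.regularSubmodels w (PartialInterference.modelNP M d p) P)
      (PartialInterference.tau w v) φ ∧
    PartialInterference.IsEfficientInfluenceFunction
      (PartialInterference.regularSubmodels w (PartialInterference.modelNPe p P) P)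
      (PartialInterference.tau w v) φ ∧
    PartialInterference.IsEfficiencyBound
      (PartialInterference.regularSubmodels w (PartialInterference.modelNP M d p) P)
      (PartialInterference.tau w v) (Var[φ; (P : Measure (PartialInterference.Data M d))]) ∧
    PartialInterference.IsEfficiencyBound
      (PartialInterference.regularSubmodels w (PartialInterference.modelNPe p P) P)
      (PartialInterference.tau w v) (Var[φ; (P : Measure (PartialInterference.Data M d))]) ∧
    Var[φ; (P : Measure (PartialInterference.Data M d))] =
      ∑ k, v k (p k) ^ 2 *
        PartialInterference.seb (PartialInterference.lawGiven P k) (w k) (p k) (θ k) := by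
  obtain ⟨B, hB⟩ := hw_bdd
  have hθ' : ∀ k, θ k =
      PartialInterference.thetaOf (PartialInterference.lawGiven P k) (w k) := fun k => by
    rw [hθ, C.thetaOf_lawGiven ρ hP (hp k ▸ hp_pos k) consistency ignorability overlap moments
      (hw_meas k) (hB k)]
  have mφ := PartialInterference.memLp_influence hp hp_pos overlap moments hw_meas hB
    finite_bound hφ
  have h0 := PartialInterference.integral_influence hp hp_pos overlap moments hw_meas hB
    finite_bound hφ hθ'
  have eif := PartialInterference.isEfficientInfluenceFunction_tau hp hp_pos overlap moments posDef
    hw_meas hB finite_bound hθ' hφ PartialInterference.regularSubmodels_modelNPe_subset subset_rfl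
  have eif' := PartialInterference.isEfficientInfluenceFunction_tau hp hp_pos overlap moments posDef
    hw_meas hB finite_bound hθ' hφ subset_rfl PartialInterference.regularSubmodels_modelNPe_subset
  refine ⟨?_, eif, eif', eif.isEfficiencyBound (fun S hS => hS.2.1) h0,
    eif'.isEfficiencyBound (fun S hS => hS.2.1) h0, ?_⟩
  · unfold PartialInterference.tau
    exact Finset.sum_congr rfl fun k _ => by rw [hp, hθ']
  · rw [variance_of_integral_eq_zero mφ.1.aemeasurable h0]
    exact PartialInterference.integral_influence_sq hp hp_pos overlap moments hw_meas hB
      finite_bound hφ
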